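/- **Setting.** Let $d\ge 3$. For $x\in\mathbb{Z}^d$ let $|x|$ be the Euclidean norm, $V_t(x)=\{y\in\mathbb{Z}^d:|y-x|\le t\}$, $V_t=V_t(0)$ and $\mathrm{d}_L(x)=L-|x|$. An environment $\omega=(\omega_x)_{x\in\mathbb{Z}^d}$ assigns to each site $x$ a probability distribution $\omega_x$ on $\{\pm e_1,\dots,\pm e_d\}$, and $p_\omega(x,x+e)=\omega_x(e)$; simple random walk is the case $\omega_x(\pm e_i)=1/(2d)$. For $V\subset\mathbb{Z}^d$ put $\Pi_V(x,z)=\mathrm{P}_{x,\omega}(X_{\tau_V}=z)$ with $\tau_V=\inf\{n\ge 0:X_n\notin V\}$, where $\mathrm{P}_{x,\omega}$ is the law of the Markov chain $(X_n)$ with transition probabilities $p_\omega$ started at $x$, and let $\pi_V$ be the same quantity for simple random walk. For nonnegative kernels on $\mathbb{Z}^d$, $FG(x,y)=\sum_uF(x,u)G(u,y)$; the Green's function of $F$ in $V$ is $\sum_{k\ge0}(1_VF)^k$, where $(1_VF)(x,y)=1_V(x)F(x,y)$ and $(1_VF)^0(x,y)=\delta_x(y)$. Write $\|f\|_1=\sum_x|f(x)|$.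 Fix a smooth probability density $\varphi\ge 0$ with compact support in $(1,2)$ and a smooth $h:\mathbb{R}_+\to\mathbb{R}_+$ with $h(x)=x$ for $x\le 1/2$, $h(x)=1$ for $x\ge 2$, strictly increasing and concave on $(1/2,2)$, and $|h'|\le 1$. Let $s_L=L/(\log L)^3$, $r_L=L/(\log L)^{15}$, and, for $100\le r\le r_L$, $$h_{L,r}(x)=\tfrac1{20}\max\{s_L\,h(\mathrm{d}_L(x)/s_L),\,r\}\ \ (|x|<L),\qquad h_{L,r}(x)=\tfrac{r}{20}\ \ (|x|\ge L).$$ **Coarse grained kernels.** For $x\in V_L$ let $$\hat\Pi_{L,r}(x,\cdot)=\frac1{h_{L,r}(x)}\int_0^\infty\varphi\Big(\frac t{h_{L,r}(x)}\Big)\Pi_{V_t(x)\cap V_L}(x,\cdot)\,dt,$$ and $\hat\Pi_{L,r}(x,\cdot)=\delta_x$ for $x\notin V_L$; $\hat\pi_{L,r}$ is defined in the same way with $\pi$ in place of $\Pi$. For $x\in V_{L+r}$ let $\tilde\pi_{L,r}(x,\cdot)$ be given by the same formula with $\pi_{V_t(x)\cap V_{L+r}}$ in place of $\Pi_{V_t(x)\cap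 V_L}$. Let $\tilde\Pi_{L,r}(x,\cdot)$ be given by the same formula with $\Pi_{V_t(x)}$ for $x\in V_L$, and let $\tilde\Pi_{L,r}(x,\cdot)=\tilde\pi_{L,r}(x,\cdot)$ for $x\in V_{L+r}\setminus V_L$. **Goodified kernels.** For $\delta>0$, a point $x\in V_L$ is good (with respect to $L,\delta,r$) if $\|(\Pi_{V_t(x)}-\pi_{V_t(x)})(x,\cdot)\|_1\le\delta$ for all $t\in[h_{L,r}(x),2h_{L,r}(x)]$ and if, in case $\mathrm{d}_L(x)>2r$, additionally $\|(\hat\Pi_{L,r}-\hat\pi_{L,r})\hat\pi_{L,r}(x,\cdot)\|_1\le(\log h_{L,r}(x))^{-9}$. Let $\mathcal{B}_{L,r}$ be the set of points of $V_L$ that are not good, and $\mathcal{B}^\star_{L,r}=\mathcal{B}_{L,r}\cup\mathcal{B}_{L,r_L}$. Let $\hat\Pi^g_{L,r}(x,\cdot)=\hat\pi_{L,r}(x,\cdot)$ for $x\in\mathcal{B}^\star_{L,r}$ and $\hat\Pi^g_{L,r}(x,\cdot)=\hat\Pi_{L,r}(x,\cdot)$ otherwise; define $\tilde\Pi^g_{L,r}$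 in the same way from $\tilde\pi_{L,r}$ and $\tilde\Pi_{L,r}$. Let $\hat g_{L,r}$ and $\hat G^g_{L,r}$ be the Green's functions in $V_L$ of $\hat\pi_{L,r}$ and $\hat\Pi^g_{L,r}$, and let $\tilde g_{L,r}$ and $\tilde G^g_{L,r}$ be the Green's functions in $V_{L+r}$ of $\tilde\pi_{L,r}$ and $\tilde\Pi^g_{L,r}$. **The kernel $\Gamma_{L,r}$ and the relation $\preceq$.** For $x,y\in V_{L+r}$ let $\tilde d(x)=\max\{\tfrac12\mathrm{d}_{L+r}(x),3r\}$, $a(x)=\min\{\tilde d(x),s_L\}$, $U(x)=V_{a(x)}(x)\cap V_{L+r}$ and $$\Gamma_{L,r}(x,y)=\min\left\{\frac{\tilde d(x)\tilde d(y)}{a(y)^2(a(y)+|x-y|)^d},\ \frac{1}{a(y)^2(a(y)+|x-y|)^{d-2}}\right\}.$$ Write $F\preceq G$ if $\sum_{z\in U(y)}F(x,z)\le\sum_{z\in U(y)}G(x,z)$ for all $x,y\in V_{L+r}$. **Lemma.** All constants below depend only on $d$ (and on the fixed functions $\varphi,h$). 1. There are $C_1>0$ and $L_0>0$ such that for all $L\ge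 L_0$ and all $r\in[100,r_L]$, $$\hat g_{L,r}\preceq C_1\Gamma_{L,r}\quad\text{and}\quad\tilde g_{L,r}\preceq C_1\Gamma_{L,r}.$$ 2. There are $C>0$, $\delta_0>0$ and $L_0>0$ such that for all $\delta\in(0,\delta_0]$, all $L\ge L_0$, all $r\in[100,r_L]$ and every environment $\omega$, $$\hat G^g_{L,r}\preceq C\,\Gamma_{L,r}\quad\text{and}\quad\tilde G^g_{L,r}\preceq C\,\Gamma_{L,r}.$$ -/

import Mathlib

open MeasureTheory ProbabilityTheory
open scoped ENNReal

namespace RWRE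

/-! ### The lattice, balls and kernels -/

/-- The lattice `ℤ^d`, with its discrete measurable structure. -/
abbrev Lat (d : ℕ) : Type := Fin d → ℤ

/-- The Euclidean norm `|x|` of a lattice point. -/
noncomputable def eNorm {d : ℕ} (x : Lat d) : ℝ :=
  ‖(WithLp.toLp 2 (fun i => (x i : ℝ)) : EuclideanSpace ℝ (Fin d))‖

/-- The lattice ball `V_t(x) = {y ∈ ℤ^d : |y - x| ≤ t}`. -/
def ballAt {d : ℕ} (t : ℝ) (x : Lat d) : Set (Lat d) := {y | eNorm (y - x) ≤ t}

/-- The centred lattice ball `V_t = {y ∈ ℤ^d : |y| ≤ t}`. -/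
def ball0 (d : ℕ) (t : ℝ) : Set (Lat d) := {y | eNorm y ≤ t}

/-- `d_L(x) = L - |x|`. -/
noncomputable def bdist {d : ℕ} (L : ℝ) (x : Lat d) : ℝ := L - eNorm x

/-- Nonnegative kernels on `ℤ^d × ℤ^d`. -/
abbrev Kern (d : ℕ) : Type := Lat d → Lat d → ℝ≥0∞

open Classical in
/-- The kernel `(x, y) ↦ δ_x(y)`. -/
noncomputable def diracKern (d : ℕ) : Kern d := fun x y => if y = x then 1 else 0

/-- The product `FG(x,y) = ∑_u F(x,u) G(u,y)`. -/
noncomputable def kernMul {d : ℕ} (F G : Kern d) : Kern d := fun x y => ∑' u, F x u * G u y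

/-- The powers `F^k`, with `F^0(x,y) = δ_x(y)`. -/
noncomputable def kernPow {d : ℕ} (F : Kern d) : ℕ → Kern d
  | 0 => diracKern d
  | k + 1 => kernMul F (kernPow F k)

open Classical in
/-- The kernel `1_V F`. -/
noncomputable def killed {d : ℕ} (V : Set (Lat d)) (F : Kern d) : Kern d :=
  fun x y => if x ∈ V then F x y else 0

/-- The Green's function `g_V(F)(x,y) = ∑_{k ≥ 0} (1_V F)^k (x,y)`. -/
noncomputable def green {d : ℕ} (V : Set (Lat d)) (F : Kern d) : Kern d :=
  fun x y => ∑' k : ℕ, kernPow (killed V F) k x y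

/-- `‖f‖₁ = ∑_x |f(x)| ∈ [0,∞]`. -/
noncomputable def l1norm {d : ℕ} (f : Lat d → ℝ) : ℝ≥0∞ := ∑' x, ‖f x‖ₑ

/-- The signed kernel `F - G`, for kernels with finite entries. -/
noncomputable def kernDiff {d : ℕ} (F G : Kern d) (x y : Lat d) : ℝ := (F x y).toReal - (G x y).toReal

/-! ### Environments, Markov chains and exit distributions -/

/-- The directions `±e_i`: `(i, true)` stands for `e_i` and `(i, false)` for `-e_i`. -/
def dirVec {d : ℕ} (e : Fin d × Bool) : Lat d :=
  if e.2 then Pi.single e.1 1 else - Pi.single e.1 1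

/-- An environment: a probability distribution on `{±e_i}` at every lattice site. -/
abbrev Env (d : ℕ) : Type := Lat d → PMF (Fin d × Bool)

/-- The transition probabilities `p_ω(x, x + e) = ω_x(e)`. -/
noncomputable def envStep {d : ℕ} (ω : Env d) (x : Lat d) : PMF (Lat d) :=
  (ω x).map (fun e => x + dirVec e)

/-- The environment of simple random walk, `p(x, x ± e_i) = 1/(2d)`. -/
noncomputable def srwEnv (d : ℕ) [NeZero d] : Env d :=
  fun _ => PMF.uniformOfFintype (Fin d × Bool)

/-- The transition probabilities `p` as a Markov kernel on `ℤ^d`. -/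
noncomputable def stepKernel {d : ℕ} (p : Lat d → PMF (Lat d)) : Kernel (Lat d) (Lat d) :=
  Kernel.ofFunOfCountable (fun x => (p x).toMeasure)

instance stepKernel_isMarkov {d : ℕ} (p : Lat d → PMF (Lat d)) :
    IsMarkovKernel (stepKernel p) :=
  ⟨fun x => by
    change IsProbabilityMeasure ((p x).toMeasure)
    infer_instance⟩

/-- The law `P_{x,p}` on path space `(ℤ^d)^ℕ` of the Markov chain with transition probabilities
`p` started at `x` (obtained from the Ionescu-Tulcea theorem). -/
noncomputable def chainLaw {d : ℕ} (p : Lat d → PMF (Lat d)) (x : Lat d) :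
    Measure (ℕ → Lat d) :=
  Kernel.traj (X := fun _ : ℕ => Lat d)
    (fun n => (stepKernel p).comap
      (fun y : ((i : Finset.Iic n) → Lat d) => y ⟨n, Finset.mem_Iic.2 le_rfl⟩)
      (measurable_pi_apply _))
    0 (fun _ => x)

/-- The exit distribution `ex_V(x,z;p) = P_{x,p}(X_{τ_V} = z)`, where
`τ_V = inf {n : X_n ∉ V}`: for some `n` we have `τ_V = n` and `X_n = z`. -/
noncomputable def exitDist {d : ℕ} (V : Set (Lat d)) (p : Lat d → PMF (Lat d)) : Kern d :=
  fun x z => chainLaw p x {X | ∃ n : ℕ, (∀ k < n, X k ∈ V) ∧ X n ∉ V ∧ X n = z}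

/-! ### Coarse graining -/

/-- A smooth probability density on `ℝ_+` with compact support in `(1,2)`. -/
structure IsCGDensity (φ : ℝ → ℝ) : Prop where
  smooth : ContDiff ℝ ((⊤ : ℕ∞) : WithTop ℕ∞) φ
  nonneg : ∀ t, 0 ≤ φ t
  support : tsupport φ ⊆ Set.Ioo 1 2
  mass : ∫ t, φ t = 1

/-- The profile `h : ℝ_+ → ℝ_+` used to interpolate between the step sizes. -/
structure IsCGProfile (h : ℝ → ℝ) : Prop where
  smooth : ContDiffOn ℝ ((⊤ : ℕ∞) : WithTop ℕ∞) h (Set.Ici 0)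
  eq_self : ∀ x, 0 ≤ x → x ≤ 1 / 2 → h x = x
  eq_one : ∀ x, 2 ≤ x → h x = 1
  strictMono : StrictMonoOn h (Set.Ioo (1 / 2) 2)
  concave : ConcaveOn ℝ (Set.Ioo (1 / 2) 2) h
  deriv_le : ∀ x, 0 < x → |deriv h x| ≤ 1

/-- The coarse grained transitions on `W` belonging to the field `m = (m_x)` and `p`:
`(1/m_x) ∫_0^∞ φ(t/m_x) ex_{V_t(x) ∩ W}(x,z;p) dt`. -/
noncomputable def cgKern {d : ℕ} (φ : ℝ → ℝ) (W : Set (Lat d)) (m : Lat d → ℝ)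
    (p : Lat d → PMF (Lat d)) : Kern d :=
  fun x z => ∫⁻ t in Set.Ici (0 : ℝ),
    ENNReal.ofReal (1 / m x * φ (t / m x)) * exitDist (ballAt t x ∩ W) p x z

/-- `s_L = L / (log L)^3`. -/
noncomputable def sScale (L : ℝ) : ℝ := L / Real.log L ^ 3

/-- `r_L = L / (log L)^15`. -/
noncomputable def rScale (L : ℝ) : ℝ := L / Real.log L ^ 15

open Classical in
/-- The field `h_{L,r}(x) = (1/20) max {s_L h(d_L(x)/s_L), r}`, extended by `r/20` outside the
open ball of radius `L`. -/
noncomputable def hField {d : ℕ} (h : ℝ → ℝ) (L r : ℝ) (x : Lat d) : ℝ :=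
  if eNorm x < L then 1 / 20 * max (sScale L * h (bdist L x / sScale L)) r else 1 / 20 * r

open Classical in
/-- The coarse grained kernel in `V_L` for the environment `ω`, set to be `δ_x` outside `V_L`. -/
noncomputable def hatKern {d : ℕ} (φ h : ℝ → ℝ) (L r : ℝ) (ω : Env d) : Kern d :=
  fun x => if x ∈ ball0 d L then cgKern φ (ball0 d L) (hField h L r) (envStep ω) x
    else diracKern d x

/-- The kernel `π̂_{L,r}` of coarse grained simple random walk in `V_L`. -/
noncomputable def hatPi {d : ℕ} [NeZero d] (φ h : ℝ → ℝ) (L r : ℝ) : Kern d :=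
  hatKern φ h L r (srwEnv d)

open Classical in
/-- The kernel `π̃_{L,r}` of coarse grained simple random walk in the enlarged ball `V_{L+r}`
(with `δ_x` outside `V_{L+r}`). -/
noncomputable def tildePi {d : ℕ} [NeZero d] (φ h : ℝ → ℝ) (L r : ℝ) : Kern d :=
  fun x => if x ∈ ball0 d (L + r) then
      cgKern φ (ball0 d (L + r)) (hField h L r) (envStep (srwEnv d)) x
    else diracKern d x

open Classical in
/-- The kernel `Π̃_{L,r}`: for `x ∈ V_L` the exit measures are taken from uncut balls `V_t(x)`,
elsewhere it is `π̃_{L,r}`. -/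
noncomputable def tildeBigPi {d : ℕ} [NeZero d] (φ h : ℝ → ℝ) (L r : ℝ) (ω : Env d) : Kern d :=
  fun x => if x ∈ ball0 d L then cgKern φ Set.univ (hField h L r) (envStep ω) x
    else tildePi φ h L r x

/-! ### Good and bad points, goodified kernels -/

/-- `x` is good with respect to `L`, `δ` and `r`. -/
def IsGood {d : ℕ} [NeZero d] (φ h : ℝ → ℝ) (L r δ : ℝ) (ω : Env d) (x : Lat d) : Prop :=
  (∀ t ∈ Set.Icc (hField h L r x) (2 * hField h L r x),
    l1norm (kernDiff (exitDist (ballAt t x) (envStep ω))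
      (exitDist (ballAt t x) (envStep (srwEnv d))) x) ≤ ENNReal.ofReal δ) ∧
  (2 * r < bdist L x →
    l1norm (fun z => ∑' u, kernDiff (hatKern φ h L r ω) (hatPi φ h L r) x u *
        (hatPi φ h L r u z).toReal)
      ≤ ENNReal.ofReal ((Real.log (hField h L r x) ^ 9)⁻¹))

/-- The set `𝓑_{L,r}` of bad points in `V_L`. -/
def badSet {d : ℕ} [NeZero d] (φ h : ℝ → ℝ) (L r δ : ℝ) (ω : Env d) : Set (Lat d) :=
  {x | x ∈ ball0 d L ∧ ¬ IsGood φ h L r δ ω x}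

/-- The set `𝓑*_{L,r} = 𝓑_{L,r} ∪ 𝓑_{L,r_L}`. -/
def badStar {d : ℕ} [NeZero d] (φ h : ℝ → ℝ) (L r δ : ℝ) (ω : Env d) : Set (Lat d) :=
  badSet φ h L r δ ω ∪ badSet φ h L (rScale L) δ ω

open Classical in
/-- The goodified kernel `Π̂^g_{L,r}`. -/
noncomputable def hatGood {d : ℕ} [NeZero d] (φ h : ℝ → ℝ) (L r δ : ℝ) (ω : Env d) : Kern d :=
  fun x => if x ∈ badStar φ h L r δ ω then hatPi φ h L r x else hatKern φ h L r ω x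

open Classical in
/-- The goodified kernel `Π̃^g_{L,r}`. -/
noncomputable def tildeGood {d : ℕ} [NeZero d] (φ h : ℝ → ℝ) (L r δ : ℝ) (ω : Env d) : Kern d :=
  fun x => if x ∈ badStar φ h L r δ ω then tildePi φ h L r x else tildeBigPi φ h L r ω x

/-- `ĝ_{L,r}`, the Green's function of `π̂_{L,r}` in `V_L`. -/
noncomputable def hatg {d : ℕ} [NeZero d] (φ h : ℝ → ℝ) (L r : ℝ) : Kern d :=
  green (ball0 d L) (hatPi φ h L r)

/-- `g̃_{L,r}`, the Green's function of `π̃_{L,r}` in `V_{L+r}`. -/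
noncomputable def tildeg {d : ℕ} [NeZero d] (φ h : ℝ → ℝ) (L r : ℝ) : Kern d :=
  green (ball0 d (L + r)) (tildePi φ h L r)

/-- `Ĝ^g_{L,r}`, the Green's function of `Π̂^g_{L,r}` in `V_L`. -/
noncomputable def hatGg {d : ℕ} [NeZero d] (φ h : ℝ → ℝ) (L r δ : ℝ) (ω : Env d) : Kern d :=
  green (ball0 d L) (hatGood φ h L r δ ω)

/-- `G̃^g_{L,r}`, the Green's function of `Π̃^g_{L,r}` in `V_{L+r}`. -/
noncomputable def tildeGg {d : ℕ} [NeZero d] (φ h : ℝ → ℝ) (L r δ : ℝ) (ω : Env d) : Kern d :=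
  green (ball0 d (L + r)) (tildeGood φ h L r δ ω)

/-! ### The kernel `Γ_{L,r}` and the relation `≼` -/

/-- `d̃(x) = max (d_{L+r}(x)/2, 3r)`. -/
noncomputable def dTilde {d : ℕ} (L r : ℝ) (x : Lat d) : ℝ := max (bdist (L + r) x / 2) (3 * r)

/-- `a(x) = min (d̃(x), s_L)`. -/
noncomputable def aFun {d : ℕ} (L r : ℝ) (x : Lat d) : ℝ := min (dTilde L r x) (sScale L)

noncomputable def Gamma1 {d : ℕ} (L r : ℝ) (x y : Lat d) : ℝ :=
  dTilde L r x * dTilde L r y / (aFun L r y ^ 2 * (aFun L r y + eNorm (x - y)) ^ d)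

noncomputable def Gamma2 {d : ℕ} (L r : ℝ) (x y : Lat d) : ℝ :=
  1 / (aFun L r y ^ 2 * (aFun L r y + eNorm (x - y)) ^ (d - 2))

/-- `Γ_{L,r} = min {Γ^{(1)}_{L,r}, Γ^{(2)}_{L,r}}`. -/
noncomputable def Gam {d : ℕ} (L r : ℝ) (x y : Lat d) : ℝ := min (Gamma1 L r x y) (Gamma2 L r x y)

/-- The positive kernel `C Γ_{L,r}`. -/
noncomputable def GamKern {d : ℕ} (C L r : ℝ) : Kern d := fun x y => ENNReal.ofReal (C * Gam L r x y)

/-- The neighbourhood `U(x) = V_{a(x)}(x) ∩ V_{L+r}`. -/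
def nbhd {d : ℕ} (L r : ℝ) (x : Lat d) : Set (Lat d) :=
  ballAt (aFun L r x) x ∩ ball0 d (L + r)

/-- `F ≼ G`: `F(x,U(y)) ≤ G(x,U(y))` for all `x, y ∈ V_{L+r}`, where
`F(x,U) = ∑_{z ∈ U} F(x,z)`. -/
def KernLE {d : ℕ} (L r : ℝ) (F G : Kern d) : Prop :=
  ∀ x ∈ ball0 d (L + r), ∀ y ∈ ball0 d (L + r),
    ∑' z : nbhd L r y, F x z ≤ ∑' z : nbhd L r y, G x z

end RWRE

/-! The sum of a Green's function over U(y) is an expected occupation time, that is, the potential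
of the indicator of U(y), and a potential is the smallest nonnegative supersolution
(`potential_le`). So it suffices to exhibit a function f ≥ 0 which does not increase in mean along
the goodified walk killed outside V_{L+r} and which loses at least m per step on U(y): the
occupation time is then at most f/m (`occ_le_of_drift`). The whole proof is the construction of
explicit functions f with f/m of order a(y)^d Γ(x,y), which by volume counting is at most a constant
times the mass Γ gives to U(y) (`le_tsum_gamKern`).

Robustness against the environment (`tildeGood_drift`). Suppose f has simple random walk drift f -
avg f of order μ, with f and μ nearly constant on the scale of one coarse grained step h. Then a
step of simple random walk gains order h²μ. At a good point the step differs by a signed D with ‖D‖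
≤ δ and, away from the boundary, ‖Dπ̂‖ ≤ (log h)^{-9}. Writing Df = (Dπ̂)f + D(f - π̂f), the second
term is at most δ times a multiple of the gain, and the first at most a multiple of (log h)^{-9} f.
Hence f survives the perturbation if h²μ dominates (log h)^{-9} f away from the boundary and δf
within distance Kr of it.

Harmonic functions have μ = 0, so the natural candidates are corrected. Let R = L + (e^κ+2)r and
S(z) = (R²-|z|²)/R. The boundary function `bdryFun` starts from the Poisson-type kernel
S(z)/|z-ζ|^d, with ζ the reflection of y in the sphere of radius R, and the interior function
`intFun` from (s_L²+|z-y|²)^{-(d-2)/2}. Both receive terms with 1/log(S/r), whose relative drift is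
of order S^{-2} log^{-2}. As h is of order S near the boundary and of order L/(log L)³ inside, the
gain is at least of order (log L)^{-6-2} relative to f in the worst case, which beats (log h)^{-9}.
The drifts are computed exactly in the continuum and transferred to the lattice by third derivative
bounds (`abs_avg_product_sub_le`); taking κ large makes the logarithmic corrections and the lattice
errors small (`bdryFun_drift`, `intFun_drift`).

Assembly (`occ_tildeGood_le`). If y lies in the boundary layer where d̃(y) ≤ s_L, `bdryFun` alone
gives the bound. Otherwise `intFun` gives it for x within 3/4 of the distance from y to the sphere
of radius R, and a maximum principle with `bdryFun` carries it further out (`occ_le_outside`). The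
walk in V_L is compared with the one in V_{L+r} at the cost of a factor 2 (`occ_le_two_mul`).
Goodification does not change simple random walk, so the first assertion is a case of the second. -/

namespace RWRE

/-! ### Kernels acting on functions, potentials and supersolutions. -/

variable {d : ℕ}

/-- The action `F g (x) = ∑_u F(x,u) g(u)` of a kernel on functions. -/
noncomputable def kAct (F : Kern d) (g : Lat d → ℝ≥0∞) (x : Lat d) : ℝ≥0∞ := ∑' u, F x u * g u

/-- The potential `∑_n F^n g` of a nonnegative function. -/
noncomputable def potential (F : Kern d) (g : Lat d → ℝ≥0∞) (x : Lat d) : ℝ≥0∞ :=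
  ∑' n : ℕ, (kAct F)^[n] g x

theorem kAct_mono {F : Kern d} {g g' : Lat d → ℝ≥0∞} (hg : ∀ x, g x ≤ g' x) (x : Lat d) :
    kAct F g x ≤ kAct F g' x :=
  ENNReal.tsum_le_tsum fun u => mul_le_mul_right (hg u) _

theorem kAct_tsum {ι : Type*} (F : Kern d) (g : ι → Lat d → ℝ≥0∞) (x : Lat d) :
    kAct F (fun z => ∑' i, g i z) x = ∑' i, kAct F (g i) x := by
  unfold kAct
  simp_rw [← ENNReal.tsum_mul_left]
  exact ENNReal.tsum_comm

theorem kAct_sum {ι : Type*} (s : Finset ι) (F : Kern d) (g : ι → Lat d → ℝ≥0∞) (x : Lat d) :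
    kAct F (fun z => ∑ i ∈ s, g i z) x = ∑ i ∈ s, kAct F (g i) x := by
  unfold kAct
  simp_rw [Finset.mul_sum]
  exact Summable.tsum_finsetSum (fun _ _ => ENNReal.summable)

theorem kAct_iterate_tsum {ι : Type*} (F : Kern d) (n : ℕ)
    (g : ι → Lat d → ℝ≥0∞) (x : Lat d) :
    (kAct F)^[n] (fun z => ∑' i, g i z) x = ∑' i, (kAct F)^[n] (g i) x := by
  induction n generalizing x with
  | zero => simp
  | succ n ih =>
    simp_rw [Function.iterate_succ_apply']
    rw [← kAct_tsum]
    congr 1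
    funext z
    exact ih z

theorem potential_eq (F : Kern d) (g : Lat d → ℝ≥0∞) (x : Lat d) :
    potential F g x = g x + kAct F (potential F g) x := by
  unfold potential
  rw [tsum_eq_zero_add' ENNReal.summable, kAct_tsum]
  simp_rw [Function.iterate_succ_apply']
  rfl

/-- The partial sums of the potential satisfy P_{n+1} = g + F P_n, so monotonicity keeps them below
any supersolution u. This minimality is the only source of upper bounds for Green's functions and
exit laws below. -/
theorem potential_le {F : Kern d} {g u : Lat d → ℝ≥0∞} (h : ∀ x, g x + kAct F u x ≤ u x)
    (x : Lat d) : potential F g x ≤ u x := by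
  have key : ∀ n x, ∑ k ∈ Finset.range n, (kAct F)^[k] g x ≤ u x := by
    intro n
    induction n with
    | zero => intro x; simp
    | succ n ih =>
      intro x
      rw [Finset.sum_range_succ']
      simp_rw [Function.iterate_succ_apply']
      rw [← kAct_sum, add_comm]
      exact (add_le_add le_rfl (kAct_mono ih x)).trans (h x)
  unfold potential
  rw [ENNReal.tsum_eq_iSup_nat]
  exact iSup_le fun n => key n x

theorem kAct_killed_of_mem {V : Set (Lat d)} {F : Kern d} {g : Lat d → ℝ≥0∞} {x : Lat d}
    (hx : x ∈ V) : kAct (killed V F) g x = kAct F g x := by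
  simp [kAct, killed, hx]

theorem kAct_killed_of_notMem {V : Set (Lat d)} {F : Kern d} {g : Lat d → ℝ≥0∞} {x : Lat d}
    (hx : x ∉ V) : kAct (killed V F) g x = 0 := by
  simp [kAct, killed, hx]

theorem tsum_kernPow_mul (F : Kern d) (n : ℕ) (g : Lat d → ℝ≥0∞) (x : Lat d) :
    ∑' z, kernPow F n x z * g z = (kAct F)^[n] g x := by
  induction n generalizing x with
  | zero =>
    simp only [kernPow, diracKern, Function.iterate_zero, id]
    rw [tsum_eq_single x]
    · simp
    · intro b hb; simp [hb]
  | succ n ih =>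
    simp only [kernPow, kernMul, Function.iterate_succ_apply']
    simp_rw [← ENNReal.tsum_mul_right]
    rw [ENNReal.tsum_comm]
    refine tsum_congr fun u => ?_
    rw [← ih, ← ENNReal.tsum_mul_left]
    exact tsum_congr fun z => mul_assoc _ _ _

/-- Replaces matrix powers by iterates on functions, so that Green's functions can be bounded by
supersolutions. -/
theorem tsum_green_mul (V : Set (Lat d)) (F : Kern d) (g : Lat d → ℝ≥0∞) (x : Lat d) :
    ∑' z, green V F x z * g z = potential (killed V F) g x := by
  unfold green potential
  simp_rw [← ENNReal.tsum_mul_right]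
  rw [ENNReal.tsum_comm]
  exact tsum_congr fun n => tsum_kernPow_mul _ n g x

/-! ### Exit distributions -/

/-- The transition probabilities as a kernel in the sense of `Kern`. -/
noncomputable def stepKern (p : Lat d → PMF (Lat d)) : Kern d := fun x y => p x y

theorem lintegral_stepKernel (p : Lat d → PMF (Lat d)) (g : Lat d → ℝ≥0∞) (x : Lat d) :
    ∫⁻ y, g y ∂(stepKernel p x) = kAct (stepKern p) g x := by
  change ∫⁻ y, g y ∂((p x).toMeasure) = _
  rw [lintegral_countable']
  refine tsum_congr fun y => ?_
  rw [PMF.toMeasure_apply_singleton _ _ (measurableSet_singleton y), mul_comm]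
  rfl

open Classical in
-- Bridge from the path measure to iterated kernels. The last step is peeled off by the Markov
-- property, and the induction hypothesis is applied to the killed one-step average of g.
theorem lintegral_chainLaw_survive (p : Lat d → PMF (Lat d)) (V : Set (Lat d)) (x : Lat d)
    (n : ℕ) (g : Lat d → ℝ≥0∞) :
    ∫⁻ X, (if ∀ k < n, X k ∈ V then g (X n) else 0) ∂(chainLaw p x)
      = (kAct (killed V (stepKern p)))^[n] g x := by
  induction n generalizing g with
  | zero =>
    simp only [not_lt_zero, false_imp_iff, implies_true, if_true, Function.iterate_zero, id]
    have h0 : ∫⁻ X, g (X 0) ∂(chainLaw p x)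
        = ∫⁻ w, g (w ⟨0, Finset.mem_Iic.2 le_rfl⟩) ∂((chainLaw p x).map
            (Preorder.frestrictLe (π := fun _ : ℕ => Lat d) 0)) := by
      rw [lintegral_map (by fun_prop) (by fun_prop)]
      rfl
    rw [h0, chainLaw, Kernel.traj_map_frestrictLe_apply, Kernel.partialTraj_self, Kernel.id_apply,
      lintegral_dirac]
  | succ n ih =>
    rw [Function.iterate_succ_apply, ← ih]
    set κ : (n : ℕ) → Kernel ((i : Finset.Iic n) → Lat d) (Lat d) :=
      (fun n => (stepKernel p).comap
        (fun y : ((i : Finset.Iic n) → Lat d) => y ⟨n, Finset.mem_Iic.2 le_rfl⟩)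
        (measurable_pi_apply _)) with hκ
    have hκv : ∀ h : (i : Finset.Iic n) → Lat d,
        κ n h = stepKernel p (h ⟨n, Finset.mem_Iic.2 le_rfl⟩) := fun h => by
      simp [hκ, Kernel.comap_apply]
    let A : ((i : Finset.Iic n) → Lat d) → Prop := fun h => ∀ k : Finset.Iic n, h k ∈ V
    let G : ((i : Finset.Iic n) → Lat d) × Lat d → ℝ≥0∞ := fun q => if A q.1 then g q.2 else 0
    have hG : Measurable G := measurable_of_countable G
    have e1 : ∫⁻ X, (if ∀ k < n + 1, X k ∈ V then g (X (n + 1)) else 0) ∂(chainLaw p x)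
        = ∫⁻ q, G q ∂((chainLaw p x).map
            (fun X => (Preorder.frestrictLe (π := fun _ : ℕ => Lat d) n X, X (n + 1)))) := by
      rw [lintegral_map hG (by fun_prop)]
      refine lintegral_congr fun X => ?_
      have : (∀ k < n + 1, X k ∈ V) ↔ A (Preorder.frestrictLe (π := fun _ : ℕ => Lat d) n X) :=
        ⟨fun h k => h k (Nat.lt_succ_of_le (Finset.mem_Iic.1 k.2)),
          fun h k hk => h ⟨k, Finset.mem_Iic.2 (Nat.le_of_lt_succ hk)⟩⟩
      simp only [G, this]
    -- Given the path up to time n, the next position has law p(X_n, ·): the joint law is a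
    -- composition product.
    have e2 : (chainLaw p x).map
            (fun X => (Preorder.frestrictLe (π := fun _ : ℕ => Lat d) n X, X (n + 1)))
        = (((chainLaw p x).map (Preorder.frestrictLe (π := fun _ : ℕ => Lat d) n)) ⊗ₘ (κ n)) := by
      have h1 := Kernel.partialTraj_compProd_eq_map_traj (X := fun _ : ℕ => Lat d) (κ := κ) (Nat.zero_le n)
        (x₀ := fun _ => x)
      rw [← Kernel.traj_map_frestrictLe_apply] at h1
      exact h1.symm
    rw [e1, e2, Measure.lintegral_compProd hG, lintegral_map (measurable_of_countable _)
      (by fun_prop)]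
    refine lintegral_congr fun X => ?_
    rw [hκv]
    by_cases hX : ∀ k < n + 1, X k ∈ V
    · have hA : A (Preorder.frestrictLe (π := fun _ : ℕ => Lat d) n X) :=
        fun k => hX k (Nat.lt_succ_of_le (Finset.mem_Iic.1 k.2))
      simp only [G, hA, if_true]
      rw [if_pos fun k hk => hX k (hk.trans (Nat.lt_succ_self n)),
        kAct_killed_of_mem (hX n (Nat.lt_succ_self n)), lintegral_stepKernel]
      rfl
    · have hA : ¬ A (Preorder.frestrictLe (π := fun _ : ℕ => Lat d) n X) := fun h => hX
        fun k hk => h ⟨k, Finset.mem_Iic.2 (Nat.le_of_lt_succ hk)⟩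
      simp only [G, hA, if_false, lintegral_zero]
      by_cases hX' : ∀ k < n, X k ∈ V
      · rw [if_pos hX', kAct_killed_of_notMem]
        intro hn
        refine hX fun k hk => ?_
        rcases Nat.lt_succ_iff_lt_or_eq.1 hk with h | h
        · exact hX' k h
        · exact h ▸ hn
      · rw [if_neg hX']

open Classical in
theorem exitDist_eq_potential (V : Set (Lat d)) (p : Lat d → PMF (Lat d)) (x z : Lat d) :
    exitDist V p x z
      = potential (killed V (stepKern p)) (fun w => if w ∉ V ∧ w = z then 1 else 0) x := by
  unfold exitDist potential
  have hmeas : ∀ n : ℕ, MeasurableSet {X : ℕ → Lat d | (∀ k < n, X k ∈ V) ∧ X n ∉ V ∧ X n = z} := by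
    intro n
    have hV : ∀ k, MeasurableSet {X : ℕ → Lat d | X k ∈ V} := fun k =>
      measurableSet_preimage (f := fun X : ℕ → Lat d => X k) (measurable_pi_apply k)
        (Set.to_countable V).measurableSet
    have hz : ∀ k, MeasurableSet {X : ℕ → Lat d | X k = z} := fun k =>
      measurableSet_preimage (f := fun X : ℕ → Lat d => X k) (measurable_pi_apply k)
        (measurableSet_singleton z)
    have : {X : ℕ → Lat d | (∀ k < n, X k ∈ V) ∧ X n ∉ V ∧ X n = z}
        = (⋂ k, ⋂ (_ : k < n), {X : ℕ → Lat d | X k ∈ V}) ∩ ({X : ℕ → Lat d | X n ∈ V}ᶜ ∩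
          {X : ℕ → Lat d | X n = z}) := by
      ext X; simp
    rw [this]
    exact (MeasurableSet.iInter fun k => MeasurableSet.iInter fun _ => hV k).inter
      ((hV n).compl.inter (hz n))
  rw [Set.ofPred_exists, measure_iUnion _ hmeas]
  · refine tsum_congr fun n => ?_
    rw [← lintegral_chainLaw_survive, ← lintegral_indicator_one (hmeas n)]
    refine lintegral_congr fun X => ?_
    by_cases h1 : ∀ k < n, X k ∈ V
    · by_cases h2 : X n ∉ V ∧ X n = z
      · rw [if_pos h1, if_pos h2, Set.indicator_of_mem (by exact ⟨h1, h2⟩)]; rfl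
      · rw [if_pos h1, if_neg h2, Set.indicator_of_notMem (fun h => h2 h.2)]
    · rw [if_neg h1, Set.indicator_of_notMem (fun h => h1 h.1)]
  · intro m n hmn
    refine Set.disjoint_left.2 fun X hm hn => ?_
    rcases lt_or_gt_of_ne hmn with h | h
    · exact hm.2.1 (hn.1 m h)
    · exact hn.2.1 (hm.1 n h)

open Classical in
/-- Expectations under the exit distribution are potentials of the killed chain. -/
theorem tsum_exitDist_mul (V : Set (Lat d)) (p : Lat d → PMF (Lat d)) (u : Lat d → ℝ≥0∞)
    (x : Lat d) :
    ∑' z, exitDist V p x z * u z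
      = potential (killed V (stepKern p)) (fun w => if w ∈ V then 0 else u w) x := by
  simp_rw [exitDist_eq_potential]
  unfold potential
  simp_rw [← ENNReal.tsum_mul_right]
  rw [ENNReal.tsum_comm]
  refine tsum_congr fun n => ?_
  have hmul : ∀ (c : ℝ≥0∞) (g : Lat d → ℝ≥0∞) (n : ℕ) (x : Lat d),
      (kAct (killed V (stepKern p)))^[n] g x * c
        = (kAct (killed V (stepKern p)))^[n] (fun w => g w * c) x := by
    intro c g n
    induction n generalizing g with
    | zero => intro x; rfl
    | succ n ih =>
      intro x
      rw [Function.iterate_succ_apply, ih, Function.iterate_succ_apply]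
      refine congrFun (congrArg _ (funext fun w => ?_)) x
      unfold kAct
      rw [← ENNReal.tsum_mul_right]
      exact tsum_congr fun _ => mul_assoc _ _ _
  simp_rw [hmul]
  rw [← kAct_iterate_tsum]
  refine congrFun (congrArg _ (funext fun w => ?_)) x
  rw [tsum_eq_single w]
  · by_cases h : w ∈ V <;> simp [h]
  · intro z hz
    simp [hz.symm]

/-- Optional stopping for nonnegative supermartingales. Only an inequality is claimed, so the exit
time need not be finite, and u may take the value ∞. -/
theorem exitDist_supermartingale {V : Set (Lat d)} {p : Lat d → PMF (Lat d)} {u : Lat d → ℝ≥0∞}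
    (hu : ∀ x ∈ V, kAct (stepKern p) u x ≤ u x) (x : Lat d) :
    ∑' z, exitDist V p x z * u z ≤ u x := by
  classical
  rw [tsum_exitDist_mul]
  refine potential_le (fun y => ?_) x
  by_cases hy : y ∈ V
  · rw [kAct_killed_of_mem hy, if_pos hy, zero_add]
    exact hu y hy
  · rw [kAct_killed_of_notMem hy, if_neg hy, add_zero]

theorem kAct_stepKern_one (p : Lat d → PMF (Lat d)) (x : Lat d) :
    kAct (stepKern p) (fun _ => 1) x = 1 := by
  simp only [kAct, stepKern, mul_one]
  exact (p x).tsum_coe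

theorem tsum_exitDist_le_one (V : Set (Lat d)) (p : Lat d → PMF (Lat d)) (x : Lat d) :
    ∑' z, exitDist V p x z ≤ 1 := by
  have := exitDist_supermartingale (V := V) (p := p) (u := fun _ => 1)
    (fun y _ => (kAct_stepKern_one p y).le) x
  simpa using this

theorem exitDist_le_one (V : Set (Lat d)) (p : Lat d → PMF (Lat d)) (x z : Lat d) :
    exitDist V p x z ≤ 1 := (ENNReal.le_tsum z).trans (tsum_exitDist_le_one V p x)

theorem exitDist_eq_zero_of_mem {V : Set (Lat d)} (p : Lat d → PMF (Lat d)) (x : Lat d)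
    {z : Lat d} (hz : z ∈ V) : exitDist V p x z = 0 := by
  unfold exitDist
  have : {X : ℕ → Lat d | ∃ n, (∀ k < n, X k ∈ V) ∧ X n ∉ V ∧ X n = z} = ∅ := by
    ext X
    simp only [Set.mem_ofPred_eq, Set.mem_empty_iff_false, iff_false]
    rintro ⟨n, -, h1, h2⟩
    exact h1 (h2 ▸ hz)
  rw [this, measure_empty]

/-- The exit distribution of `V ∩ W`, restricted to `W`, is dominated by that of `V`. -/
theorem exitDist_inter_le {V W : Set (Lat d)} (p : Lat d → PMF (Lat d)) (x : Lat d) {z : Lat d}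
    (hz : z ∈ W) : exitDist (V ∩ W) p x z ≤ exitDist V p x z := by
  unfold exitDist
  refine measure_mono ?_
  rintro X ⟨n, h1, h2, h3⟩
  refine ⟨n, fun k hk => (h1 k hk).1, fun h => h2 ⟨h, h3 ▸ hz⟩, h3⟩

/-- A set which the chain enters through `B` carries no exit mass outside `B`. -/
theorem exitDist_eq_zero_of_step {V B : Set (Lat d)} {p : Lat d → PMF (Lat d)}
    (hB : ∀ x ∈ V, ∀ y, p x y ≠ 0 → y ∈ B) {x z : Lat d} (hx : x ∈ B) (hz : z ∉ B) :
    exitDist V p x z = 0 := by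
  classical
  -- The supermartingale vanishing on B and infinite off B forces the exit mass off B to be zero.
  have h := exitDist_supermartingale (V := V) (p := p) (u := fun y => if y ∈ B then 0 else ⊤)
    (fun y hy => by
      have : kAct (stepKern p) (fun y => if y ∈ B then 0 else ⊤) y = 0 := by
        unfold kAct
        rw [ENNReal.tsum_eq_zero]
        intro w
        by_cases hw : p y w = 0
        · simp [stepKern, hw]
        · simp [hB y hy w hw]
      rw [this]; exact zero_le) x
  rw [if_pos hx, nonpos_iff_eq_zero, ENNReal.tsum_eq_zero] at h
  have := h z
  rw [if_neg hz, mul_eq_zero] at this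
  simpa using this

end RWRE

namespace RWRE

variable {d : ℕ}

/-! ### The Euclidean norm on the lattice -/

/-- The embedding of the lattice into Euclidean space. -/
noncomputable def emb (x : Lat d) : EuclideanSpace ℝ (Fin d) := WithLp.toLp 2 fun i => (x i : ℝ)

@[simp] theorem emb_apply (x : Lat d) (i : Fin d) : emb x i = x i := rfl

theorem eNorm_eq (x : Lat d) : eNorm x = ‖emb x‖ := rfl

theorem emb_sub (x y : Lat d) : emb (x - y) = emb x - emb y := by
  ext i; simp

theorem eNorm_sub_eq (x y : Lat d) : eNorm (x - y) = ‖emb x - emb y‖ := by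
  rw [eNorm_eq, emb_sub]

theorem eNorm_nonneg (x : Lat d) : 0 ≤ eNorm x := norm_nonneg _

theorem eNorm_sq (x : Lat d) : eNorm x ^ 2 = ∑ i, (x i : ℝ) ^ 2 := by
  rw [eNorm_eq, EuclideanSpace.norm_sq_eq]
  simp

theorem eNorm_zero : eNorm (0 : Lat d) = 0 := by
  rw [← sq_eq_zero_iff, eNorm_sq]; simp

theorem eNorm_sub_comm (x y : Lat d) : eNorm (x - y) = eNorm (y - x) := by
  rw [eNorm_sub_eq, eNorm_sub_eq, norm_sub_rev]

theorem eNorm_sub_le (x y z : Lat d) : eNorm (x - z) ≤ eNorm (x - y) + eNorm (y - z) := by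
  simp only [eNorm_sub_eq]; exact norm_sub_le_norm_sub_add_norm_sub _ _ _

theorem eNorm_le_add (x y : Lat d) : eNorm x ≤ eNorm y + eNorm (x - y) := by
  rw [eNorm_sub_eq, eNorm_eq, eNorm_eq]
  calc ‖emb x‖ = ‖emb y + (emb x - emb y)‖ := by congr 1; abel
    _ ≤ _ := norm_add_le _ _

theorem abs_coord_le_eNorm (x : Lat d) (i : Fin d) : |(x i : ℝ)| ≤ eNorm x := by
  have := PiLp.norm_apply_le (emb x) i
  simpa [eNorm_eq] using this

theorem eNorm_dirVec (e : Fin d × Bool) : eNorm (dirVec e) = 1 := by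
  have h : eNorm (dirVec e) ^ 2 = 1 := by
    rw [eNorm_sq]
    rcases e with ⟨i, b⟩
    rw [Finset.sum_eq_single i]
    · cases b <;> simp [dirVec]
    · intro j _ hj
      cases b <;> simp [dirVec, hj]
    · simp
  have := eNorm_nonneg (dirVec e)
  nlinarith

theorem finite_ballAt (t : ℝ) (x : Lat d) : (ballAt t x).Finite := by
  refine (Set.finite_Icc (x - fun _ => ⌈t⌉) (x + fun _ => ⌈t⌉)).subset fun y hy => ?_
  have hy' : eNorm (y - x) ≤ t := hy
  have h : ∀ i, |y i - x i| ≤ ⌈t⌉ := fun i => by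
    have := (abs_coord_le_eNorm (y - x) i).trans (hy'.trans (Int.le_ceil t))
    exact_mod_cast this
  constructor <;> intro i <;> have := abs_le.1 (h i) <;> simp <;> omega

theorem mem_ballAt {t : ℝ} {x y : Lat d} : y ∈ ballAt t x ↔ eNorm (y - x) ≤ t := Iff.rfl

theorem mem_ball0 {t : ℝ} {y : Lat d} : y ∈ ball0 d t ↔ eNorm y ≤ t := Iff.rfl

theorem ball0_mono {s t : ℝ} (h : s ≤ t) : ball0 d s ⊆ ball0 d t := fun _ hx => le_trans hx h

/-! ### Nearest neighbour steps -/

theorem kAct_envStep (ω : Env d) (u : Lat d → ℝ≥0∞) (x : Lat d) :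
    kAct (stepKern (envStep ω)) u x = ∑ e, ω x e * u (x + dirVec e) := by
  classical
  unfold kAct stepKern envStep
  simp only [PMF.map_apply, tsum_fintype, Finset.sum_mul]
  rw [Summable.tsum_finsetSum (fun _ _ => ENNReal.summable)]
  refine Finset.sum_congr rfl fun e _ => ?_
  rw [tsum_eq_single (x + dirVec e)]
  · simp
  · intro b hb; simp [hb]

theorem eNorm_of_envStep_ne_zero {ω : Env d} {x y : Lat d} (h : envStep ω x y ≠ 0) :
    eNorm (y - x) = 1 := by
  have : y ∈ (envStep ω x).support := h
  rw [envStep, PMF.support_map] at this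
  obtain ⟨e, -, rfl⟩ := this
  simp [eNorm_dirVec]

/-- One step average of simple random walk. -/
noncomputable def avg (f : Lat d → ℝ) (x : Lat d) : ℝ :=
  1 / (2 * d) * ∑ e : Fin d × Bool, f (x + dirVec e)

theorem avg_add (f g : Lat d → ℝ) (x : Lat d) :
    avg (fun z => f z + g z) x = avg f x + avg g x := by
  simp [avg, Finset.sum_add_distrib, mul_add]

theorem avg_const_mul (c : ℝ) (f : Lat d → ℝ) (x : Lat d) :
    avg (fun z => c * f z) x = c * avg f x := by
  simp only [avg, ← Finset.mul_sum]; ring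

theorem avg_const [NeZero d] (c : ℝ) (x : Lat d) : avg (fun _ => c) x = c := by
  have : (d : ℝ) ≠ 0 := NeZero.ne _
  simp [avg]; field_simp

theorem avg_eNorm_sq [NeZero d] (a x : Lat d) :
    avg (fun z => eNorm (z - a) ^ 2) x = eNorm (x - a) ^ 2 + 1 := by
  have hd : (d : ℝ) ≠ 0 := NeZero.ne _
  have h : ∀ i : Fin d, eNorm (x + dirVec (i, true) - a) ^ 2 + eNorm (x + dirVec (i, false) - a) ^ 2
      = 2 * eNorm (x - a) ^ 2 + 2 := by
    intro i
    simp only [eNorm_sq, ← Finset.sum_add_distrib, Finset.mul_sum]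
    have : (2 : ℝ) = ∑ j, if j = i then 2 else 0 := by simp
    conv_rhs => rw [this]
    rw [← Finset.sum_add_distrib]
    refine Finset.sum_congr rfl fun j _ => ?_
    by_cases hj : j = i
    · subst hj; simp [dirVec]; ring
    · simp [dirVec, hj]; ring
  unfold avg
  rw [Fintype.sum_prod_type]
  simp only [Fintype.sum_bool, h]
  simp
  field_simp

theorem kAct_srw [NeZero d] (u : Lat d → ℝ≥0∞) (x : Lat d) :
    kAct (stepKern (envStep (srwEnv d))) u x
      = ENNReal.ofReal (1 / (2 * d)) * ∑ e : Fin d × Bool, u (x + dirVec e) := by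
  rw [kAct_envStep, Finset.mul_sum]
  refine Finset.sum_congr rfl fun e _ => ?_
  congr 1
  have hd : (0 : ℝ) < d := Nat.cast_pos.2 (Nat.pos_of_ne_zero (NeZero.ne d))
  simp only [srwEnv, PMF.uniformOfFintype_apply, Fintype.card_prod, Fintype.card_fin,
    Fintype.card_bool, one_div]
  rw [ENNReal.ofReal_inv_of_pos (by positivity), mul_comm]
  congr 1
  rw [show (2 * (d : ℝ)) = ((2 * d : ℕ) : ℝ) by push_cast; ring, ENNReal.ofReal_natCast]

theorem kAct_srw_ofReal [NeZero d] {f : Lat d → ℝ} {x : Lat d}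
    (hf : ∀ e : Fin d × Bool, 0 ≤ f (x + dirVec e)) :
    kAct (stepKern (envStep (srwEnv d))) (fun z => ENNReal.ofReal (f z)) x
      = ENNReal.ofReal (avg f x) := by
  rw [kAct_srw, avg, ENNReal.ofReal_mul (by positivity), ENNReal.ofReal_sum_of_nonneg]
  exact fun e _ => hf e

/-! ### Exit distributions of nearest neighbour walks from balls -/

theorem exitDist_support {t : ℝ} (ht : 0 ≤ t) {W : Set (Lat d)} (ω : Env d) {x z : Lat d}
    (h : exitDist (ballAt t x ∩ W) (envStep ω) x z ≠ 0) : eNorm (z - x) ≤ t + 1 := by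
  by_contra hz
  refine h (exitDist_eq_zero_of_step (B := ballAt (t + 1) x) ?_ ?_ hz)
  · intro y hy w hw
    have h1 := eNorm_of_envStep_ne_zero hw
    have h2 : eNorm (y - x) ≤ t := hy.1
    have := eNorm_sub_le w y x
    exact mem_ballAt.2 (by linarith)
  · refine mem_ballAt.2 ?_
    rw [sub_self, eNorm_zero]; linarith

theorem exitDist_support_ball {V : Set (Lat d)} {ρ : ℝ} (hV : V ⊆ ball0 d ρ) (ω : Env d)
    {x z : Lat d} (hx : x ∈ V) (h : exitDist V (envStep ω) x z ≠ 0) : eNorm z ≤ ρ + 1 := by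
  by_contra hz
  refine h (exitDist_eq_zero_of_step (B := ball0 d (ρ + 1)) ?_ ?_ hz)
  · intro y hy w hw
    have h1 := eNorm_of_envStep_ne_zero hw
    have h2 : eNorm y ≤ ρ := hV hy
    have := eNorm_le_add w y
    exact mem_ball0.2 (by linarith)
  · exact ball0_mono (by linarith) (hV hx)

theorem lt_eNorm_of_exitDist_ne_zero {t : ℝ} {W : Set (Lat d)} {p : Lat d → PMF (Lat d)}
    {x z : Lat d} (hz : z ∈ W) (h : exitDist (ballAt t x ∩ W) p x z ≠ 0) : t < eNorm (z - x) := by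
  by_contra hc
  exact h (exitDist_eq_zero_of_mem p x ⟨not_lt.1 hc, hz⟩)

/-- Simple random walk leaves finite sets almost surely. -/
theorem tsum_exitDist_srw [NeZero d] {V : Set (Lat d)} (hV : V.Finite) (x : Lat d) :
    ∑' z, exitDist V (envStep (srwEnv d)) x z = 1 := by
  classical
  set m : Lat d → ℝ≥0∞ := fun x => ∑' z, exitDist V (envStep (srwEnv d)) x z with hm
  have hm1 : ∀ x, m x ≤ 1 := fun x => tsum_exitDist_le_one _ _ _
  have hpot : ∀ x, m x = potential (killed V (stepKern (envStep (srwEnv d))))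
      (fun w => if w ∈ V then 0 else 1) x := fun x => by
    rw [← tsum_exitDist_mul V _ (fun _ => 1) x]; simp [hm]
  have hout : ∀ x, x ∉ V → m x = 1 := fun x hx => by
    rw [hpot, potential_eq, kAct_killed_of_notMem hx, if_neg hx, add_zero]
  have hin : ∀ x, x ∈ V → m x = kAct (stepKern (envStep (srwEnv d))) m x := fun x hx => by
    rw [hpot, potential_eq, kAct_killed_of_mem hx, if_pos hx, zero_add]
    congr 1
    funext w
    exact (hpot w).symm
  let D : Lat d → ℝ := fun x => (m x).toReal
  have hD : ∀ x, m x = ENNReal.ofReal (D x) := fun x =>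
    (ENNReal.ofReal_toReal ((hm1 x).trans_lt ENNReal.one_lt_top).ne).symm
  have hDavg : ∀ x ∈ V, D x = avg D x := fun x hx => by
    have h := hin x hx
    have h2 : m = fun z => ENNReal.ofReal (D z) := funext hD
    rw [h2, kAct_srw_ofReal (fun _ => ENNReal.toReal_nonneg)] at h
    rwa [ENNReal.ofReal_eq_ofReal_iff ENNReal.toReal_nonneg] at h
    exact mul_nonneg (by positivity) (Finset.sum_nonneg fun _ _ => ENNReal.toReal_nonneg)
  have hD1 : ∀ x, D x ≤ 1 := fun x => ENNReal.toReal_le_of_le_ofReal zero_le_one (by simpa using hm1 x)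
  by_contra hx1
  have hxV : x ∈ V := by
    by_contra h; exact hx1 (hout x h)
  -- Minimum principle for the exit probability D. Among the minimisers of D in V, the lexicographic
  -- order selects one with the largest 0-th coordinate. Averaging makes its neighbour in that
  -- direction a minimiser too, which is impossible both inside V and outside, where D = 1.
  obtain ⟨y, hyV, hy⟩ := hV.toFinset.exists_min_image
    (fun z => toLex (D z, - z 0)) ⟨x, hV.mem_toFinset.2 hxV⟩
  rw [hV.mem_toFinset] at hyV
  have hDx : D x < 1 := by
    refine lt_of_le_of_ne (hD1 x) fun h => hx1 ?_
    change m x = 1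
    rw [hD, h, ENNReal.ofReal_one]
  have hle : ∀ z ∈ V, D y ≤ D z := fun z hz => by
    have := hy z (hV.mem_toFinset.2 hz)
    rw [Prod.Lex.toLex_le_toLex] at this
    rcases this with h | h
    · exact h.le
    · exact h.1.le
  have hDy : D y < 1 := (hle x hxV).trans_lt hDx
  have hall : ∀ z, D y ≤ D z := fun z => by
    by_cases hz : z ∈ V
    · exact hle z hz
    · have : D z = 1 := by simp [D, hout z hz]
      rw [this]; exact hDy.le
  have hd : (0 : ℝ) < d := Nat.cast_pos.2 (Nat.pos_of_ne_zero (NeZero.ne d))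
  have hsum : ∑ e : Fin d × Bool, (D (y + dirVec e) - D y) = 0 := by
    have h1 := hDavg y hyV
    unfold avg at h1
    rw [Finset.sum_sub_distrib, sub_eq_zero]
    simp only [Finset.sum_const, Finset.card_univ, Fintype.card_prod, Fintype.card_fin,
      Fintype.card_bool, nsmul_eq_mul]
    push_cast
    field_simp at h1
    linarith
  have hz := (Finset.sum_eq_zero_iff_of_nonneg
    (fun e _ => sub_nonneg.2 (hall (y + dirVec e)))).1 hsum (0, true) (Finset.mem_univ _)
  have hz' : D (y + dirVec (0, true)) = D y := by linarith
  have hmem : y + dirVec (0, true) ∈ V := by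
    by_contra h
    have : D (y + dirVec (0, true)) = 1 := by simp [D, hout _ h]
    linarith
  have := hy _ (hV.mem_toFinset.2 hmem)
  rw [Prod.Lex.toLex_le_toLex] at this
  rcases this with h | ⟨-, h⟩
  · simp only at h; linarith
  · simp [dirVec] at h

/-- Supermartingale inequality for the exit distribution of simple random walk. -/
theorem exitDist_srw_le [NeZero d] {V : Set (Lat d)} {f : Lat d → ℝ}
    (hf : ∀ y ∈ V, ∀ e : Fin d × Bool, 0 ≤ f (y + dirVec e)) (h : ∀ y ∈ V, avg f y ≤ f y)
    (x : Lat d) :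
    ∑' z, exitDist V (envStep (srwEnv d)) x z * ENNReal.ofReal (f z) ≤ ENNReal.ofReal (f x) := by
  refine exitDist_supermartingale (u := fun z => ENNReal.ofReal (f z)) (fun y hy => ?_) x
  rw [kAct_srw_ofReal (hf y hy)]
  exact ENNReal.ofReal_le_ofReal (h y hy)

end RWRE

namespace RWRE

variable {d : ℕ}

/-! ### Averaging exit distributions over the radius -/

/-- Squared lattice distances are integers, so the ball depends on t only through ⌊t²⌋. This makes
exit distributions measurable in the radius. -/
theorem ballAt_eq_of_floor {t : ℝ} (ht : 0 ≤ t) (x : Lat d) :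
    ballAt t x = {y | eNorm (y - x) ^ 2 ≤ (⌊t ^ 2⌋₊ : ℝ)} := by
  ext y
  change eNorm (y - x) ≤ t ↔ eNorm (y - x) ^ 2 ≤ (⌊t ^ 2⌋₊ : ℝ)
  have h : eNorm (y - x) ^ 2 = ((∑ i, ((y - x) i).natAbs ^ 2 : ℕ) : ℝ) := by
    rw [eNorm_sq]
    push_cast
    refine Finset.sum_congr rfl fun i _ => ?_
    rw [Nat.cast_natAbs, Int.cast_abs, sq_abs]
  rw [← pow_le_pow_iff_left₀ (eNorm_nonneg _) ht two_ne_zero, h, Nat.cast_le,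
    Nat.le_floor_iff (by positivity)]

theorem aemeasurable_exitDist (W : Set (Lat d)) (p : Lat d → PMF (Lat d)) (x z : Lat d) :
    AEMeasurable (fun t => exitDist (ballAt t x ∩ W) p x z) (volume.restrict (Set.Ici (0 : ℝ))) := by
  let F : ℕ → ℝ≥0∞ := fun n => exitDist ({y | eNorm (y - x) ^ 2 ≤ (n : ℝ)} ∩ W) p x z
  have hF : Measurable fun t : ℝ => F ⌊t ^ 2⌋₊ :=
    (measurable_from_nat (f := F)).comp (Nat.measurable_floor.comp (by fun_prop))
  refine hF.aemeasurable.congr ?_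
  filter_upwards [ae_restrict_mem measurableSet_Ici] with t ht
  rw [ballAt_eq_of_floor ht]

/-- The weight with which radius `t` is chosen. -/
noncomputable def radWeight (φ : ℝ → ℝ) (m t : ℝ) : ℝ≥0∞ := ENNReal.ofReal (1 / m * φ (t / m))

section

variable {φ : ℝ → ℝ} (hφ : IsCGDensity φ) {m : ℝ} (hm : 0 < m)

include hφ in
theorem IsCGDensity.measurable_radWeight : Measurable (radWeight φ m) := by
  have : Measurable φ := hφ.smooth.continuous.measurable
  unfold radWeight
  fun_prop

include hφ hm in
theorem IsCGDensity.radWeight_eq_zero {t : ℝ} (ht : t ∉ Set.Ioo m (2 * m)) :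
    radWeight φ m t = 0 := by
  have : φ (t / m) = 0 := by
    by_contra h
    have h1 := hφ.support (subset_tsupport φ h)
    exact ht ⟨(one_lt_div hm).1 h1.1, (div_lt_iff₀ hm).1 h1.2⟩
  simp [radWeight, this]

include hφ hm in
theorem IsCGDensity.lintegral_radWeight : ∫⁻ t in Set.Ici (0 : ℝ), radWeight φ m t = 1 := by
  have hcomp : HasCompactSupport φ :=
    HasCompactSupport.of_support_subset_isCompact (isCompact_Icc (a := (1 : ℝ)) (b := 2))
      fun t ht => Set.Ioo_subset_Icc_self (hφ.support (subset_tsupport φ ht))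
  have hint : Integrable φ := hφ.smooth.continuous.integrable_of_hasCompactSupport hcomp
  have hint2 : Integrable fun t => 1 / m * φ (t / m) := (hint.comp_div hm.ne').const_mul _
  have e1 : ∫⁻ t in Set.Ici (0 : ℝ), radWeight φ m t = ∫⁻ t, radWeight φ m t := by
    rw [← lintegral_indicator measurableSet_Ici]
    refine lintegral_congr fun t => ?_
    by_cases ht : t ∈ Set.Ici (0 : ℝ)
    · rw [Set.indicator_of_mem ht]
    · rw [Set.indicator_of_notMem ht, hφ.radWeight_eq_zero hm]
      intro h
      exact ht (hm.le.trans h.1.le)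
  rw [e1]
  unfold radWeight
  rw [← ofReal_integral_eq_lintegral_ofReal hint2
    (Filter.Eventually.of_forall fun t => mul_nonneg (by positivity) (hφ.nonneg _)),
    integral_const_mul, Measure.integral_comp_div, hφ.mass, abs_of_pos hm]
  simp [hm.ne']

variable {W W' : Set (Lat d)} {mf : Lat d → ℝ} {p p' : Lat d → PMF (Lat d)} {x : Lat d}

include hφ in
theorem tsum_cgKern_mul (u : Lat d → ℝ≥0∞) :
    ∑' z, cgKern φ W mf p x z * u z = ∫⁻ t in Set.Ici (0 : ℝ),
      radWeight φ (mf x) t * ∑' z, exitDist (ballAt t x ∩ W) p x z * u z := by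
  have hmeas : ∀ z, AEMeasurable (fun t => radWeight φ (mf x) t * exitDist (ballAt t x ∩ W) p x z)
      (volume.restrict (Set.Ici (0 : ℝ))) := fun z =>
    hφ.measurable_radWeight.aemeasurable.mul (aemeasurable_exitDist W p x z)
  have e : ∀ z, cgKern φ W mf p x z * u z = ∫⁻ t in Set.Ici (0 : ℝ),
      radWeight φ (mf x) t * exitDist (ballAt t x ∩ W) p x z * u z := fun z => by
    rw [lintegral_mul_const'' _ (hmeas z)]
    rfl
  simp_rw [e]
  rw [← lintegral_tsum fun z => (hmeas z).mul_const _]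
  refine lintegral_congr fun t => ?_
  rw [← ENNReal.tsum_mul_left]
  exact tsum_congr fun z => mul_assoc _ _ _

include hφ in
theorem tsum_cgKern_mul_le (hm : 0 < mf x) {u : Lat d → ℝ≥0∞} {c : ℝ≥0∞}
    (h : ∀ t ∈ Set.Ioo (mf x) (2 * mf x), ∑' z, exitDist (ballAt t x ∩ W) p x z * u z ≤ c) :
    ∑' z, cgKern φ W mf p x z * u z ≤ c := by
  rw [tsum_cgKern_mul hφ]
  calc _ ≤ ∫⁻ t in Set.Ici (0 : ℝ), radWeight φ (mf x) t * c := by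
        refine lintegral_mono fun t => ?_
        by_cases ht : t ∈ Set.Ioo (mf x) (2 * mf x)
        · exact mul_le_mul_right (h t ht) _
        · simp [hφ.radWeight_eq_zero hm ht]
    _ = c := by
        rw [lintegral_mul_const _ hφ.measurable_radWeight, hφ.lintegral_radWeight hm, one_mul]

include hφ in
theorem le_tsum_cgKern_mul (hm : 0 < mf x) {u : Lat d → ℝ≥0∞} {c : ℝ≥0∞}
    (h : ∀ t ∈ Set.Ioo (mf x) (2 * mf x), c ≤ ∑' z, exitDist (ballAt t x ∩ W) p x z * u z) :
    c ≤ ∑' z, cgKern φ W mf p x z * u z := by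
  rw [tsum_cgKern_mul hφ]
  calc c = ∫⁻ t in Set.Ici (0 : ℝ), radWeight φ (mf x) t * c := by
        rw [lintegral_mul_const _ hφ.measurable_radWeight, hφ.lintegral_radWeight hm, one_mul]
    _ ≤ _ := by
        refine lintegral_mono fun t => ?_
        by_cases ht : t ∈ Set.Ioo (mf x) (2 * mf x)
        · exact mul_le_mul_right (h t ht) _
        · simp [hφ.radWeight_eq_zero hm ht]

include hφ in
theorem tsum_cgKern_le_one (hm : 0 < mf x) : ∑' z, cgKern φ W mf p x z ≤ 1 := by
  have := tsum_cgKern_mul_le hφ (W := W) (p := p) hm (u := fun _ => 1) (c := 1)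
    (fun t _ => by simpa using tsum_exitDist_le_one _ p x)
  simpa using this

include hφ in
theorem cgKern_le_one (hm : 0 < mf x) (z : Lat d) : cgKern φ W mf p x z ≤ 1 :=
  (ENNReal.le_tsum z).trans (tsum_cgKern_le_one hφ hm)

include hφ in
theorem cgKern_mono (hm : 0 < mf x) {z : Lat d} (h : ∀ t ∈ Set.Ioo (mf x) (2 * mf x),
    exitDist (ballAt t x ∩ W) p x z ≤ exitDist (ballAt t x ∩ W') p' x z) :
    cgKern φ W mf p x z ≤ cgKern φ W' mf p' x z := by
  unfold cgKern
  refine lintegral_mono fun t => ?_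
  by_cases ht : t ∈ Set.Ioo (mf x) (2 * mf x)
  · exact mul_le_mul_right (h t ht) _
  · have := hφ.radWeight_eq_zero hm ht
    unfold radWeight at this
    rw [this, zero_mul]
    exact zero_le

include hφ in
theorem cgKern_congr_set (hm : 0 < mf x) (h : ∀ t ∈ Set.Ioo (mf x) (2 * mf x),
    ballAt t x ∩ W = ballAt t x ∩ W') : cgKern φ W mf p x = cgKern φ W' mf p x :=
  funext fun _ => le_antisymm (cgKern_mono hφ hm fun t ht => (by rw [h t ht]))
    (cgKern_mono hφ hm fun t ht => (by rw [h t ht]))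

include hφ in
theorem exists_of_cgKern_ne_zero (hm : 0 < mf x) {z : Lat d} (h : cgKern φ W mf p x z ≠ 0) :
    ∃ t ∈ Set.Ioo (mf x) (2 * mf x), exitDist (ballAt t x ∩ W) p x z ≠ 0 := by
  by_contra! hc
  refine h (le_antisymm ?_ zero_le)
  unfold cgKern
  rw [nonpos_iff_eq_zero, ← lintegral_zero (μ := volume.restrict (Set.Ici (0 : ℝ)))]
  refine lintegral_congr fun t => ?_
  by_cases ht : t ∈ Set.Ioo (mf x) (2 * mf x)
  · simp [hc t ht]
  · have := hφ.radWeight_eq_zero hm ht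
    unfold radWeight at this
    rw [this, zero_mul]

theorem enorm_toReal_sub {a b : ℝ≥0∞} (ha : a ≠ ⊤) (hb : b ≠ ⊤) :
    ‖a.toReal - b.toReal‖ₑ = (a - b) + (b - a) := by
  rcases le_total a b with h | h
  · rw [tsub_eq_zero_of_le h, zero_add, ← neg_sub, enorm_neg, ← ENNReal.toReal_sub_of_le h hb,
      Real.enorm_eq_ofReal ENNReal.toReal_nonneg, ENNReal.ofReal_toReal (ENNReal.sub_ne_top hb)]
  · rw [tsub_eq_zero_of_le h, add_zero, ← ENNReal.toReal_sub_of_le h ha,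
      Real.enorm_eq_ofReal ENNReal.toReal_nonneg, ENNReal.ofReal_toReal (ENNReal.sub_ne_top ha)]

include hφ in
-- Goodness bounds the difference at each fixed radius; convexity of the norm passes the bound to
-- the average over radii. Absolute differences are written as sums of two truncated differences so
-- that all integrals stay in [0,∞].
theorem l1norm_cgKern_sub_le (hm : 0 < mf x) {δ : ℝ≥0∞} (h : ∀ t ∈ Set.Ioo (mf x) (2 * mf x),
    l1norm (kernDiff (exitDist (ballAt t x ∩ W) p) (exitDist (ballAt t x ∩ W') p') x) ≤ δ) :
    l1norm (kernDiff (cgKern φ W mf p) (cgKern φ W' mf p') x) ≤ δ := by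
  set a : ℝ → Lat d → ℝ≥0∞ := fun t z => exitDist (ballAt t x ∩ W) p x z
  set b : ℝ → Lat d → ℝ≥0∞ := fun t z => exitDist (ballAt t x ∩ W') p' x z
  set w := radWeight φ (mf x)
  have hw : Measurable w := hφ.measurable_radWeight
  have ha : ∀ z, AEMeasurable (fun t => a t z) (volume.restrict (Set.Ici (0 : ℝ))) :=
    fun z => aemeasurable_exitDist W p x z
  have hb : ∀ z, AEMeasurable (fun t => b t z) (volume.restrict (Set.Ici (0 : ℝ))) :=
    fun z => aemeasurable_exitDist W' p' x z
  have hwa : ∀ z, AEMeasurable (fun t => w t * a t z) (volume.restrict (Set.Ici (0 : ℝ))) :=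
    fun z => hw.aemeasurable.mul (ha z)
  have hwb : ∀ z, AEMeasurable (fun t => w t * b t z) (volume.restrict (Set.Ici (0 : ℝ))) :=
    fun z => hw.aemeasurable.mul (hb z)
  have hsub : ∀ z, AEMeasurable (fun t => w t * a t z - w t * b t z)
      (volume.restrict (Set.Ici (0 : ℝ))) := fun z => (hwa z).sub (hwb z)
  have hall : ∀ z, AEMeasurable (fun t => w t * ((a t z - b t z) + (b t z - a t z)))
      (volume.restrict (Set.Ici (0 : ℝ))) := fun z =>
    hw.aemeasurable.mul (((ha z).sub (hb z)).add ((hb z).sub (ha z)))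
  have hwt : ∀ t, w t ≠ ⊤ := fun t => ENNReal.ofReal_ne_top
  have key : ∀ z, ‖kernDiff (cgKern φ W mf p) (cgKern φ W' mf p') x z‖ₑ
      ≤ ∫⁻ t in Set.Ici (0 : ℝ), w t * ((a t z - b t z) + (b t z - a t z)) := by
    intro z
    unfold kernDiff
    rw [enorm_toReal_sub ((cgKern_le_one hφ hm z).trans_lt ENNReal.one_lt_top).ne
      ((cgKern_le_one hφ hm z).trans_lt ENNReal.one_lt_top).ne]
    have e1 : cgKern φ W mf p x z = ∫⁻ t in Set.Ici (0 : ℝ), w t * a t z := rfl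
    have e2 : cgKern φ W' mf p' x z = ∫⁻ t in Set.Ici (0 : ℝ), w t * b t z := rfl
    rw [e1, e2]
    refine (add_le_add (lintegral_sub_le' _ _ (hwb z))
      (lintegral_sub_le' _ _ (hwa z))).trans (le_of_eq ?_)
    rw [← lintegral_add_left' (hsub z)]
    refine lintegral_congr fun t => ?_
    rw [← ENNReal.mul_sub fun _ _ => hwt t, ← ENNReal.mul_sub fun _ _ => hwt t, ← mul_add]
  unfold l1norm
  refine (ENNReal.tsum_le_tsum key).trans ?_
  rw [← lintegral_tsum hall]
  calc _ ≤ ∫⁻ t in Set.Ici (0 : ℝ), w t * δ := by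
        refine lintegral_mono fun t => ?_
        simp only
        rw [ENNReal.tsum_mul_left]
        by_cases ht : t ∈ Set.Ioo (mf x) (2 * mf x)
        · refine mul_le_mul_right ?_ _
          refine le_trans (le_of_eq ?_) (h t ht)
          unfold l1norm
          refine tsum_congr fun z => ?_
          unfold kernDiff
          rw [enorm_toReal_sub ((exitDist_le_one _ _ _ _).trans_lt ENNReal.one_lt_top).ne
            ((exitDist_le_one _ _ _ _).trans_lt ENNReal.one_lt_top).ne]
        · simp [w, hφ.radWeight_eq_zero hm ht]
    _ = δ := by
        rw [lintegral_mul_const _ hw, hφ.lintegral_radWeight hm, one_mul]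

end

end RWRE

namespace RWRE

variable {d : ℕ}

/-! ### The step size field -/

theorem IsCGProfile.continuousOn {h : ℝ → ℝ} (hh : IsCGProfile h) : ContinuousOn h (Set.Ici 0) :=
  hh.smooth.continuousOn

theorem IsCGProfile.monotoneOn_Icc {h : ℝ → ℝ} (hh : IsCGProfile h) :
    MonotoneOn h (Set.Icc (1 / 2) 2) := by
  have hc : ContinuousOn h (Set.Icc (1 / 2) 2) :=
    hh.continuousOn.mono fun x hx => le_trans (by norm_num) hx.1
  refine monotoneOn_of_deriv_nonneg (convex_Icc _ _) hc ?_ ?_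
  · rw [interior_Icc]
    intro x hx
    exact ((hh.smooth.contDiffAt (Ici_mem_nhds (by linarith [hx.1]))).differentiableAt
      (by simp)).differentiableWithinAt
  · rw [interior_Icc]
    intro x hx
    have := (hh.strictMono.monotoneOn).derivWithin_nonneg (x := x)
    rwa [derivWithin_of_isOpen isOpen_Ioo hx] at this

theorem IsCGProfile.half_le {h : ℝ → ℝ} (hh : IsCGProfile h) {x : ℝ} (hx : 1 / 2 ≤ x) :
    1 / 2 ≤ h x := by
  have h1 : h (1 / 2) = 1 / 2 := hh.eq_self _ (by norm_num) le_rfl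
  rcases le_total x 2 with h2 | h2
  · have := hh.monotoneOn_Icc (Set.left_mem_Icc.2 (by norm_num)) ⟨hx, h2⟩ hx
    linarith
  · rw [hh.eq_one x h2]; norm_num

theorem IsCGProfile.le_one {h : ℝ → ℝ} (hh : IsCGProfile h) {x : ℝ} (hx : 0 ≤ x) : h x ≤ 1 := by
  rcases le_total x (1 / 2) with h1 | h1
  · rw [hh.eq_self x hx h1]; linarith
  rcases le_total x 2 with h2 | h2
  · have := hh.monotoneOn_Icc ⟨h1, h2⟩ (Set.right_mem_Icc.2 (by norm_num)) h2
    rwa [hh.eq_one 2 le_rfl] at this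
  · exact (hh.eq_one x h2).le

theorem IsCGProfile.le_self {h : ℝ → ℝ} (hh : IsCGProfile h) {x : ℝ} (hx : 0 ≤ x) : h x ≤ x := by
  rcases le_total x (1 / 2) with h1 | h1
  · exact (hh.eq_self x hx h1).le
  have hc : ContinuousOn h (Set.Icc (1 / 2) x) :=
    hh.continuousOn.mono fun y hy => le_trans (by norm_num) hy.1
  have := (convex_Icc (1 / 2 : ℝ) x).image_sub_le_mul_sub_of_deriv_le hc (C := 1) ?_ ?_ (1 / 2)
    (Set.left_mem_Icc.2 h1) x (Set.right_mem_Icc.2 h1) h1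
  · rw [hh.eq_self (1 / 2) (by norm_num) le_rfl] at this; linarith
  · rw [interior_Icc]
    intro y hy
    exact ((hh.smooth.contDiffAt (Ici_mem_nhds (by linarith [hy.1]))).differentiableAt
      (by simp)).differentiableWithinAt
  · rw [interior_Icc]
    intro y hy
    exact (abs_le.1 (hh.deriv_le y (by linarith [hy.1]))).2

section

variable {h : ℝ → ℝ} (hh : IsCGProfile h) {L r : ℝ} (hs : 0 < sScale L)

theorem le_hField_of_radius (x : Lat d) : r / 20 ≤ hField h L r x := by
  unfold hField
  split_ifs
  · have := le_max_right (sScale L * h (bdist L x / sScale L)) r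
    linarith
  · linarith

include hh hs in
theorem le_hField (hr : 0 ≤ r) (x : Lat d) :
    min (bdist L x) (sScale L / 2) / 20 ≤ hField h L r x := by
  by_cases hx : eNorm x < L
  · have hD : 0 < bdist L x := sub_pos.2 hx
    unfold hField
    rw [if_pos hx]
    have h1 := le_max_left (sScale L * h (bdist L x / sScale L)) r
    have h2 : min (bdist L x) (sScale L / 2) ≤ sScale L * h (bdist L x / sScale L) := by
      rcases le_total (bdist L x / sScale L) (1 / 2) with h3 | h3
      · rw [hh.eq_self _ (by positivity) h3, mul_div_cancel₀ _ hs.ne']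
        exact min_le_left _ _
      · refine (min_le_right _ _).trans ?_
        have := mul_le_mul_of_nonneg_left (hh.half_le h3) hs.le
        linarith
    linarith
  · have hD : bdist L x ≤ 0 := sub_nonpos.2 (not_lt.1 hx)
    have := min_le_left (bdist L x) (sScale L / 2)
    have := le_hField_of_radius (h := h) (L := L) (r := r) x
    linarith

include hh hs in
theorem hField_le (x : Lat d) :
    hField h L r x ≤ max (min (bdist L x) (sScale L)) r / 20 := by
  unfold hField
  split_ifs with hx
  · have hD : 0 < bdist L x := sub_pos.2 hx
    have : max (sScale L * h (bdist L x / sScale L)) r ≤ max (min (bdist L x) (sScale L)) r := by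
      refine max_le_max (le_min ?_ ?_) le_rfl
      · have := mul_le_mul_of_nonneg_left (hh.le_self (div_pos hD hs).le) hs.le
        rwa [mul_div_cancel₀ _ hs.ne'] at this
      · have := mul_le_mul_of_nonneg_left (hh.le_one (div_pos hD hs).le) hs.le
        linarith
    linarith
  · have := le_max_right (min (bdist L x) (sScale L)) r
    linarith

theorem hField_pos (hr : 0 < r) (x : Lat d) : 0 < hField h L r x :=
  lt_of_lt_of_le (by positivity) (le_hField_of_radius x)

/-- Steps from `x` are cut neither by `V_{L+r}` ... -/
theorem ballAt_inter_enlarged (hh : IsCGProfile h) (hs : 0 < sScale L) (hr : 0 < r) {x : Lat d}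
    (hx : x ∈ ball0 d L) {t : ℝ} (ht : t < 2 * hField h L r x) :
    ballAt t x ∩ Set.univ = ballAt t x ∩ ball0 d (L + r) := by
  rw [Set.inter_univ, Set.inter_eq_left.2]
  intro z hz
  have h1 : eNorm (z - x) ≤ t := hz
  have h2 := eNorm_le_add z x
  have h3 := hField_le hh hs (r := r) x
  have hx' : eNorm x ≤ L := hx
  have h4 : max (min (bdist L x) (sScale L)) r ≤ bdist L x + r :=
    max_le ((min_le_left _ _).trans (by linarith)) (by unfold bdist; linarith)
  have h5 : bdist L x = L - eNorm x := rfl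
  exact mem_ball0.2 (by linarith)

/-- ... nor, further inside, by `V_L`. -/
theorem ballAt_inter_inner (hh : IsCGProfile h) (hs : 0 < sScale L) (hr : 0 < r) {x : Lat d}
    (hx : r ≤ bdist L x) {t : ℝ} (ht : t < 2 * hField h L r x) :
    ballAt t x ∩ Set.univ = ballAt t x ∩ ball0 d L := by
  rw [Set.inter_univ, Set.inter_eq_left.2]
  intro z hz
  have h1 : eNorm (z - x) ≤ t := hz
  have h2 := eNorm_le_add z x
  have h3 := hField_le hh hs (r := r) x
  have h4 : max (min (bdist L x) (sScale L)) r ≤ bdist L x :=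
    max_le (min_le_left _ _) hx
  have h5 : bdist L x = L - eNorm x := rfl
  exact mem_ball0.2 (by linarith)

variable {φ : ℝ → ℝ} (hφ : IsCGDensity φ)

include hφ in
theorem cgKern_univ_eq_enlarged (hh : IsCGProfile h) (hs : 0 < sScale L) (hr : 0 < r) {x : Lat d}
    (hx : x ∈ ball0 d L) (p : Lat d → PMF (Lat d)) :
    cgKern φ Set.univ (hField h L r) p x = cgKern φ (ball0 d (L + r)) (hField h L r) p x :=
  cgKern_congr_set hφ (hField_pos hr x) fun _ ht => ballAt_inter_enlarged hh hs hr hx ht.2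

include hφ in
theorem cgKern_univ_eq_inner (hh : IsCGProfile h) (hs : 0 < sScale L) (hr : 0 < r) {x : Lat d}
    (hx : r ≤ bdist L x) (p : Lat d → PMF (Lat d)) :
    cgKern φ Set.univ (hField h L r) p x = cgKern φ (ball0 d L) (hField h L r) p x :=
  cgKern_congr_set hφ (hField_pos hr x) fun _ ht => ballAt_inter_inner hh hs hr hx ht.2

include hφ in
theorem hatKern_eq_univ (hh : IsCGProfile h) (hs : 0 < sScale L) (hr : 0 < r) {x : Lat d}
    (hx : r ≤ bdist L x) (ω : Env d) :
    hatKern φ h L r ω x = cgKern φ Set.univ (hField h L r) (envStep ω) x := by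
  have hxL : x ∈ ball0 d L := by
    have : bdist L x = L - eNorm x := rfl
    exact mem_ball0.2 (by linarith)
  rw [hatKern, if_pos hxL, cgKern_univ_eq_inner hφ hh hs hr hx]

include hφ in
theorem tildePi_eq_univ [NeZero d] (hh : IsCGProfile h) (hs : 0 < sScale L) (hr : 0 < r)
    {x : Lat d} (hx : x ∈ ball0 d L) :
    tildePi φ h L r x = cgKern φ Set.univ (hField h L r) (envStep (srwEnv d)) x := by
  rw [tildePi, if_pos (ball0_mono (by linarith) hx), cgKern_univ_eq_enlarged hφ hh hs hr hx]

include hφ in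
-- For x in V_L the balls used are contained in V_{L+r}, so cut and uncut exit laws agree and
-- goodification has no effect. This reduces the statement on simple random walk to the one on
-- goodified kernels.
theorem tildeGood_srw [NeZero d] (hh : IsCGProfile h) (hs : 0 < sScale L) (hr : 0 < r) (δ : ℝ) :
    tildeGood φ h L r δ (srwEnv d) = tildePi φ h L r := by
  funext x
  unfold tildeGood
  split_ifs
  · rfl
  · unfold tildeBigPi
    split_ifs with hx
    · rw [tildePi_eq_univ hφ hh hs hr hx]
    · rfl

theorem hatGood_srw [NeZero d] (δ : ℝ) : hatGood φ h L r δ (srwEnv d) = hatPi φ h L r := by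
  funext x
  unfold hatGood
  split_ifs <;> rfl

include hφ in
/-- Coarse grained steps have length at most `2 h_{L,r}(x) + 1`. -/
theorem cgKern_support (hr : 0 < r) (W : Set (Lat d)) (ω : Env d) {x z : Lat d}
    (hz : cgKern φ W (hField h L r) (envStep ω) x z ≠ 0) :
    eNorm (z - x) ≤ 2 * hField h L r x + 1 := by
  obtain ⟨t, ht, h1⟩ := exists_of_cgKern_ne_zero hφ (hField_pos hr x) hz
  have := exitDist_support ((hField_pos hr x).le.trans ht.1.le) ω h1
  linarith [ht.2]

include hφ in
theorem tildeGood_support [NeZero d] (hr : 0 < r) (δ : ℝ) (ω : Env d) {x z : Lat d}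
    (hx : x ∈ ball0 d (L + r)) (hz : tildeGood φ h L r δ ω x z ≠ 0) :
    eNorm (z - x) ≤ 2 * hField h L r x + 1 := by
  unfold tildeGood tildeBigPi tildePi at hz
  rw [if_pos hx] at hz
  split_ifs at hz <;> exact cgKern_support hφ hr _ _ hz

theorem tildeGood_cases [NeZero d] (φ : ℝ → ℝ) (δ : ℝ)
    (ω : Env d) (x : Lat d) :
    tildeGood φ h L r δ ω x = tildePi φ h L r x ∨
      (x ∈ ball0 d L ∧ IsGood φ h L r δ ω x ∧
        tildeGood φ h L r δ ω x = cgKern φ Set.univ (hField h L r) (envStep ω) x) := by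
  unfold tildeGood
  split_ifs with h1
  · exact Or.inl rfl
  · by_cases hx : x ∈ ball0 d L
    · refine Or.inr ⟨hx, ?_, ?_⟩
      · by_contra hg; exact h1 (Or.inl ⟨hx, hg⟩)
      · rw [tildeBigPi, if_pos hx]
    · left; rw [tildeBigPi, if_neg hx]

include hφ in
-- A path that leaves V_t(x) ∩ V_L at a point of V_L leaves V_t(x) there. Cutting therefore only
-- removes mass inside V_L.
theorem hatGood_le_tildeGood [NeZero d] (hh : IsCGProfile h) (hs : 0 < sScale L) (hr : 0 < r)
    (δ : ℝ) (ω : Env d) {x z : Lat d} (hx : x ∈ ball0 d L) (hz : z ∈ ball0 d L) :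
    hatGood φ h L r δ ω x z ≤ tildeGood φ h L r δ ω x z := by
  have key : ∀ ω : Env d, cgKern φ (ball0 d L) (hField h L r) (envStep ω) x z
      ≤ cgKern φ Set.univ (hField h L r) (envStep ω) x z := fun ω =>
    cgKern_mono hφ (hField_pos hr x) fun t _ => by
      rw [Set.inter_univ]; exact exitDist_inter_le _ _ hz
  unfold hatGood tildeGood
  split_ifs
  · rw [tildePi_eq_univ hφ hh hs hr hx, hatPi, hatKern, if_pos hx]
    exact key _
  · rw [tildeBigPi, if_pos hx, hatKern, if_pos hx]
    exact key _

end

end RWRE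

namespace RWRE

variable {d : ℕ}

/-! ### Drift estimates for coarse grained simple random walk -/

section

variable [NeZero d] {φ : ℝ → ℝ} (hφ : IsCGDensity φ) {W : Set (Lat d)} {mf : Lat d → ℝ} {x : Lat d}

include hφ in
theorem tsum_cgKern_srw (hm : 0 < mf x) :
    ∑' z, cgKern φ W mf (envStep (srwEnv d)) x z = 1 := by
  refine le_antisymm (tsum_cgKern_le_one hφ hm) ?_
  have := le_tsum_cgKern_mul hφ (W := W) (p := envStep (srwEnv d)) hm (u := fun _ => 1) (c := 1)
    (fun t _ => by
      simp only [mul_one]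
      exact (tsum_exitDist_srw ((finite_ballAt t x).subset Set.inter_subset_left) x).ge)
  simpa using this

open Classical in
include hφ in
/-- A function with drift at least `m` along simple random walk decreases by `m · mf(x)²` in a
coarse grained step, the mass leaving `W` being discarded. -/
theorem srw_cg_drift (hm : 0 < mf x) {f : Lat d → ℝ} {m κ : ℝ} (hm0 : 0 ≤ m) (hκ0 : 0 ≤ κ)
    (hdrift : ∀ y ∈ W, eNorm (y - x) ≤ 2 * mf x → m ≤ f y - avg f y)
    (hnn : ∀ y ∈ W, eNorm (y - x) ≤ 2 * mf x → ∀ e, 0 ≤ f (y + dirVec e))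
    (h1 : κ ≤ m * mf x ^ 2)
    (h2 : ∀ t ∈ Set.Ioo (mf x) (2 * mf x), ∀ z,
      exitDist (ballAt t x ∩ W) (envStep (srwEnv d)) x z ≠ 0 →
      (z ∈ W → 0 ≤ f z) ∧ (z ∉ W → κ ≤ f z)) :
    ∑' z, cgKern φ W mf (envStep (srwEnv d)) x z * (if z ∈ W then ENNReal.ofReal (f z) else 0)
      + ENNReal.ofReal κ ≤ ENNReal.ofReal (f x) := by
  have key : ∑' z, cgKern φ W mf (envStep (srwEnv d)) x z *
      ((if z ∈ W then ENNReal.ofReal (f z) else 0) + ENNReal.ofReal κ) ≤ ENNReal.ofReal (f x) := by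
    refine tsum_cgKern_mul_le hφ hm fun t ht => ?_
    -- Since |z-x|² grows by exactly 1 in mean per step, f + m|z-x|² is still a supermartingale. At
    -- an exit inside W one has |z-x| > t > mf(x), which yields the gain; at an exit from W the
    -- discarded value of f is itself at least κ.
    have hg := exitDist_srw_le (V := ballAt t x ∩ W)
      (f := fun z => f z + m * eNorm (z - x) ^ 2) (fun y hy e => by
        have hyx : eNorm (y - x) ≤ 2 * mf x := le_trans hy.1 ht.2.le
        have := hnn y hy.2 hyx e
        positivity) (fun y hy => by
        have hyx : eNorm (y - x) ≤ 2 * mf x := le_trans hy.1 ht.2.le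
        have := hdrift y hy.2 hyx
        rw [avg_add, avg_const_mul, avg_eNorm_sq]
        linarith) x
    rw [sub_self, eNorm_zero] at hg
    refine le_trans (ENNReal.tsum_le_tsum fun z => ?_) (hg.trans (by simp))
    by_cases hz : exitDist (ballAt t x ∩ W) (envStep (srwEnv d)) x z = 0
    · simp [hz]
    refine mul_le_mul_right ?_ _
    obtain ⟨h3, h4⟩ := h2 t ht z hz
    by_cases hzW : z ∈ W
    · have h5 := lt_eNorm_of_exitDist_ne_zero hzW hz
      rw [if_pos hzW, ← ENNReal.ofReal_add (h3 hzW) hκ0]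
      refine ENNReal.ofReal_le_ofReal ?_
      have h6 : mf x ^ 2 ≤ eNorm (z - x) ^ 2 := pow_le_pow_left₀ hm.le (by linarith [ht.1]) 2
      have := mul_le_mul_of_nonneg_left h6 hm0
      linarith
    · rw [if_neg hzW, zero_add]
      refine ENNReal.ofReal_le_ofReal ?_
      have := h4 hzW
      have : 0 ≤ m * eNorm (z - x) ^ 2 := by positivity
      linarith
  simp_rw [mul_add] at key
  rw [ENNReal.tsum_add, ENNReal.tsum_mul_right, tsum_cgKern_srw hφ hm, one_mul] at key
  exact key

include hφ in
-- Counterpart of the drift bound: f + M|z-x|² is a submartingale. As optional stopping is available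
-- for nonnegative supermartingales only, it is applied to B - f - M|z-x|² with a large constant B,
-- which is cancelled at the end using that simple random walk exits almost surely. Exit points lie
-- within 2 mf(x) + 1 of x.
theorem srw_cg_upper (hm : 0 < mf x) {f : Lat d → ℝ} {M : ℝ} (hM : 0 ≤ M)
    (hup : ∀ y, eNorm (y - x) ≤ 2 * mf x → f y - avg f y ≤ M)
    (hnn : ∀ y, eNorm (y - x) ≤ 2 * mf x + 1 → 0 ≤ f y) :
    ENNReal.ofReal (f x) ≤
      ∑' z, cgKern φ Set.univ mf (envStep (srwEnv d)) x z * ENNReal.ofReal (f z)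
      + ENNReal.ofReal (M * (2 * mf x + 1) ^ 2) := by
  set N := (finite_ballAt (2 * mf x + 1) x).toFinset with hN
  have hmem : ∀ z, z ∈ N ↔ eNorm (z - x) ≤ 2 * mf x + 1 := fun z => by
    rw [hN, Set.Finite.mem_toFinset]; rfl
  set B : ℝ := ∑ z ∈ N, f z + M * (2 * mf x + 1) ^ 2 with hB
  have hfB : ∀ z, eNorm (z - x) ≤ 2 * mf x + 1 → f z + M * eNorm (z - x) ^ 2 ≤ B := fun z hz => by
    have h1 : f z ≤ ∑ z ∈ N, f z :=
      Finset.single_le_sum (f := f) (fun y hy => hnn y ((hmem y).1 hy)) ((hmem z).2 hz)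
    have h2 : eNorm (z - x) ^ 2 ≤ (2 * mf x + 1) ^ 2 := pow_le_pow_left₀ (eNorm_nonneg _) hz 2
    have := mul_le_mul_of_nonneg_left h2 hM
    linarith
  clear_value B
  have hx0 : eNorm (x - x) = 0 := by rw [sub_self, eNorm_zero]
  have hfx : 0 ≤ f x := hnn x (by rw [hx0]; positivity)
  have hfxB : f x ≤ B := by
    have := hfB x (by rw [hx0]; positivity)
    rw [hx0] at this; linarith
  have hstep : ∀ y, eNorm (y - x) ≤ 2 * mf x → ∀ e, eNorm (y + dirVec e - x) ≤ 2 * mf x + 1 := by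
    intro y hy e
    have h1 := eNorm_sub_le (y + dirVec e) y x
    rw [add_sub_cancel_left, eNorm_dirVec] at h1
    linarith
  have key : ENNReal.ofReal (f x) ≤ ∑' z, cgKern φ Set.univ mf (envStep (srwEnv d)) x z *
      (ENNReal.ofReal (f z) + ENNReal.ofReal (M * (2 * mf x + 1) ^ 2)) := by
    refine le_tsum_cgKern_mul hφ hm fun t ht => ?_
    have hmass := tsum_exitDist_srw (V := ballAt t x ∩ Set.univ)
      ((finite_ballAt t x).subset Set.inter_subset_left) x
    have hg := exitDist_srw_le (V := ballAt t x ∩ Set.univ)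
      (f := fun z => B + ((-1) * f z + (-M) * eNorm (z - x) ^ 2)) (fun y hy e => by
        have hyx : eNorm (y - x) ≤ 2 * mf x := le_trans hy.1 ht.2.le
        have := hfB _ (hstep y hyx e)
        linarith) (fun y hy => by
        have hyx : eNorm (y - x) ≤ 2 * mf x := le_trans hy.1 ht.2.le
        have := hup y hyx
        rw [avg_add, avg_add, avg_const_mul, avg_const_mul, avg_eNorm_sq, avg_const]
        linarith) x
    rw [hx0] at hg
    have h3 : ENNReal.ofReal B ≤ ENNReal.ofReal (B - f x) +
        ∑' z, exitDist (ballAt t x ∩ Set.univ) (envStep (srwEnv d)) x z *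
          (ENNReal.ofReal (f z) + ENNReal.ofReal (M * (2 * mf x + 1) ^ 2)) := by
      calc ENNReal.ofReal B
          = ∑' z, exitDist (ballAt t x ∩ Set.univ) (envStep (srwEnv d)) x z * ENNReal.ofReal B := by
            rw [ENNReal.tsum_mul_right, hmass, one_mul]
        _ ≤ ∑' z, (exitDist (ballAt t x ∩ Set.univ) (envStep (srwEnv d)) x z *
              ENNReal.ofReal (B + ((-1) * f z + (-M) * eNorm (z - x) ^ 2)) +
            exitDist (ballAt t x ∩ Set.univ) (envStep (srwEnv d)) x z *
          (ENNReal.ofReal (f z) + ENNReal.ofReal (M * (2 * mf x + 1) ^ 2))) := by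
            refine ENNReal.tsum_le_tsum fun z => ?_
            by_cases hz : exitDist (ballAt t x ∩ Set.univ) (envStep (srwEnv d)) x z = 0
            · rw [hz]; simp
            have hzx : eNorm (z - x) ≤ 2 * mf x + 1 :=
              (exitDist_support (hm.le.trans ht.1.le) _ hz).trans (by linarith [ht.2])
            have h4 := hfB z hzx
            have h5 := hnn z hzx
            have h2 : eNorm (z - x) ^ 2 ≤ (2 * mf x + 1) ^ 2 :=
              pow_le_pow_left₀ (eNorm_nonneg _) hzx 2
            have h6 := mul_le_mul_of_nonneg_left h2 hM
            rw [← mul_add]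
            refine mul_le_mul_right ?_ _
            rw [← ENNReal.ofReal_add h5 (by positivity), ← ENNReal.ofReal_add (by linarith)
              (by positivity)]
            exact ENNReal.ofReal_le_ofReal (by linarith)
        _ ≤ _ := by
            rw [ENNReal.tsum_add]
            refine add_le_add (hg.trans (ENNReal.ofReal_le_ofReal ?_)) le_rfl
            linarith
    have h7 : ENNReal.ofReal B = ENNReal.ofReal (B - f x) + ENNReal.ofReal (f x) := by
      rw [← ENNReal.ofReal_add (by linarith) hfx]; congr 1; ring
    rw [h7] at h3
    exact (ENNReal.add_le_add_iff_left ENNReal.ofReal_ne_top).1 h3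
  simp_rw [mul_add] at key
  rw [ENNReal.tsum_add, ENNReal.tsum_mul_right, tsum_cgKern_srw hφ hm, one_mul] at key
  exact key

end

/-! ### Perturbation of one coarse grained step -/

theorem tsum_mul_le_of_l1norm {A B : Lat d → ℝ≥0∞} (hA : ∀ z, A z ≤ 1) (hB : ∀ z, B z ≤ 1)
    {f : Lat d → ℝ} {M ε : ℝ} (hε : 0 ≤ ε) (hf : ∀ z, A z ≠ 0 → f z ≤ M)
    (h : l1norm (fun z => (A z).toReal - (B z).toReal) ≤ ENNReal.ofReal ε) :
    ∑' z, A z * ENNReal.ofReal (f z) ≤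
      ∑' z, B z * ENNReal.ofReal (f z) + ENNReal.ofReal (ε * M) := by
  have h1 : ∀ z, A z * ENNReal.ofReal (f z) ≤ B z * ENNReal.ofReal (f z) +
      ‖(A z).toReal - (B z).toReal‖ₑ * ENNReal.ofReal M := fun z => by
    rw [enorm_toReal_sub ((hA z).trans_lt ENNReal.one_lt_top).ne
      ((hB z).trans_lt ENNReal.one_lt_top).ne]
    by_cases hz : A z = 0
    · simp [hz]
    calc A z * ENNReal.ofReal (f z) ≤ (B z + (A z - B z)) * ENNReal.ofReal (f z) :=
          mul_le_mul_left le_add_tsub _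
      _ = B z * ENNReal.ofReal (f z) + (A z - B z) * ENNReal.ofReal (f z) := add_mul _ _ _
      _ ≤ _ := add_le_add le_rfl (mul_le_mul' le_self_add (ENNReal.ofReal_le_ofReal (hf z hz)))
  refine (ENNReal.tsum_le_tsum h1).trans ?_
  rw [ENNReal.tsum_add, ENNReal.tsum_mul_right, ENNReal.ofReal_mul hε]
  exact add_le_add le_rfl (mul_le_mul_left h _)

theorem sum_abs_le_of_l1norm {g : Lat d → ℝ} {ε : ℝ} (hε : 0 ≤ ε)
    (h : l1norm g ≤ ENNReal.ofReal ε) (N : Finset (Lat d)) : ∑ z ∈ N, |g z| ≤ ε := by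
  rw [← ENNReal.ofReal_le_ofReal_iff hε, ENNReal.ofReal_sum_of_nonneg fun _ _ => abs_nonneg _]
  refine le_trans ?_ h
  unfold l1norm
  refine le_trans (le_of_eq (Finset.sum_congr rfl fun z _ => ?_)) (ENNReal.sum_le_tsum N)
  rw [← Real.norm_eq_abs, ofReal_norm]

theorem tsum_mul_ofReal_eq {A : Lat d → ℝ≥0∞} (hA : ∀ z, A z ≤ 1) {N : Finset (Lat d)}
    (hN : ∀ z ∉ N, A z = 0) {f : Lat d → ℝ} (hf : ∀ z ∈ N, 0 ≤ f z) :
    ∑' z, A z * ENNReal.ofReal (f z) = ENNReal.ofReal (∑ z ∈ N, (A z).toReal * f z) := by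
  rw [tsum_eq_sum fun z hz => by rw [hN z hz, zero_mul], ENNReal.ofReal_sum_of_nonneg
    fun z hz => mul_nonneg ENNReal.toReal_nonneg (hf z hz)]
  refine Finset.sum_congr rfl fun z _ => ?_
  rw [ENNReal.ofReal_mul ENNReal.toReal_nonneg,
    ENNReal.ofReal_toReal ((hA z).trans_lt ENNReal.one_lt_top).ne]

/-- If the difference of two steps is small after smoothing by `Q`, and `f` is almost
`Q`-harmonic, then the two steps act on `f` in almost the same way. -/
theorem tsum_mul_le_of_smoothed {A B : Lat d → ℝ≥0∞} {Q : Kern d} {f : Lat d → ℝ}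
    {N N' : Finset (Lat d)} {M w δ ε : ℝ}
    (hA : ∀ z, A z ≤ 1) (hB : ∀ z, B z ≤ 1) (hAN : ∀ z ∉ N, A z = 0) (hBN : ∀ z ∉ N, B z = 0)
    (hfN : ∀ z ∈ N, 0 ≤ f z) (hfN' : ∀ u ∈ N', 0 ≤ f u ∧ f u ≤ M) (hM : 0 ≤ M) (hw : 0 ≤ w)
    (hδ : 0 ≤ δ) (hε : 0 ≤ ε)
    (hharm : ∀ z ∈ N, |f z - ∑ u ∈ N', (Q z u).toReal * f u| ≤ w)
    (h1 : l1norm (fun z => (A z).toReal - (B z).toReal) ≤ ENNReal.ofReal δ)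
    (h2 : l1norm (fun u => ∑' z, ((A z).toReal - (B z).toReal) * (Q z u).toReal)
      ≤ ENNReal.ofReal ε) :
    ∑' z, A z * ENNReal.ofReal (f z) ≤
      ∑' z, B z * ENNReal.ofReal (f z) + ENNReal.ofReal (ε * M + δ * w) := by
  have hD := sum_abs_le_of_l1norm hδ h1 N
  have hDQ := sum_abs_le_of_l1norm hε h2 N'
  have hts : ∀ u, ∑' z, ((A z).toReal - (B z).toReal) * (Q z u).toReal
      = ∑ z ∈ N, ((A z).toReal - (B z).toReal) * (Q z u).toReal := fun u =>
    tsum_eq_sum fun z hz => by rw [hAN z hz, hBN z hz]; simp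
  simp_rw [hts] at hDQ
  rw [tsum_mul_ofReal_eq hA hAN hfN, tsum_mul_ofReal_eq hB hBN hfN, ← ENNReal.ofReal_add
    (Finset.sum_nonneg fun z hz => mul_nonneg ENNReal.toReal_nonneg (hfN z hz)) (by positivity)]
  refine ENNReal.ofReal_le_ofReal ?_
  -- With D = A - B, split Df = (DQ)f + D(f - Qf): the first part sees only the smoothed difference,
  -- the second only the defect of harmonicity of f.
  have e1 : ∑ z ∈ N, (A z).toReal * f z = ∑ z ∈ N, (B z).toReal * f z +
      (∑ u ∈ N', (∑ z ∈ N, ((A z).toReal - (B z).toReal) * (Q z u).toReal) * f u +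
      ∑ z ∈ N, ((A z).toReal - (B z).toReal) * (f z - ∑ u ∈ N', (Q z u).toReal * f u)) := by
    have e2 : ∑ u ∈ N', (∑ z ∈ N, ((A z).toReal - (B z).toReal) * (Q z u).toReal) * f u
        = ∑ z ∈ N, ((A z).toReal - (B z).toReal) * ∑ u ∈ N', (Q z u).toReal * f u := by
      simp_rw [Finset.sum_mul, Finset.mul_sum]
      rw [Finset.sum_comm]
      exact Finset.sum_congr rfl fun _ _ => Finset.sum_congr rfl fun _ _ => by ring
    rw [e2, ← Finset.sum_add_distrib, ← Finset.sum_add_distrib]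
    exact Finset.sum_congr rfl fun _ _ => by ring
  rw [e1]
  have b1 : ∑ u ∈ N', (∑ z ∈ N, ((A z).toReal - (B z).toReal) * (Q z u).toReal) * f u ≤ ε * M := by
    refine le_trans (Finset.sum_le_sum fun u hu => ?_)
      ((Finset.sum_mul N' _ M).symm.le.trans (mul_le_mul_of_nonneg_right hDQ hM))
    exact (mul_le_mul_of_nonneg_right (le_abs_self _) (hfN' u hu).1).trans
      (mul_le_mul_of_nonneg_left (hfN' u hu).2 (abs_nonneg _))
  have b2 : ∑ z ∈ N, ((A z).toReal - (B z).toReal) * (f z - ∑ u ∈ N', (Q z u).toReal * f u)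
      ≤ δ * w := by
    refine le_trans (Finset.sum_le_sum fun z hz => ?_)
      ((Finset.sum_mul N _ w).symm.le.trans (mul_le_mul_of_nonneg_right hD hw))
    refine (le_abs_self _).trans ?_
    rw [abs_mul]
    exact mul_le_mul_of_nonneg_left (hharm z hz) (abs_nonneg _)
  linarith

end RWRE

namespace RWRE

variable {d : ℕ}

/-! ### Lyapunov functions for the goodified kernel -/

section Range

variable {h : ℝ → ℝ} (hh : IsCGProfile h) {L r R : ℝ} (hr : 100 ≤ r) (hrs : r ≤ sScale L)
  (hR : L + 10 * r ≤ R)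

include hh hr hrs hR in
theorem hField_le_range {x : Lat d} (hx : eNorm x ≤ L + r) :
    hField h L r x ≤ min (R - eNorm x) (sScale L) / 20 := by
  have hs : 0 < sScale L := by linarith
  have h1 := hField_le hh hs (r := r) x
  have hb : bdist L x = L - eNorm x := rfl
  have h2 : max (min (bdist L x) (sScale L)) r ≤ min (R - eNorm x) (sScale L) :=
    max_le (min_le_min (by linarith) le_rfl) (le_min (by linarith) hrs)
  linarith

include hr hrs hR in
theorem hundred_le_range {x : Lat d} (hx : eNorm x ≤ L + r) :
    100 ≤ min (R - eNorm x) (sScale L) := le_min (by linarith) (by linarith)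

include hh hr hrs hR in
theorem step_le_range {x : Lat d} (hx : eNorm x ≤ L + r) :
    2 * hField h L r x + 1 ≤ 0.11 * min (R - eNorm x) (sScale L) := by
  have h1 := hField_le_range hh hr hrs hR hx
  have h2 := hundred_le_range hr hrs hR hx
  linarith

include hh hr hrs in
/-- Two consecutive steps from a point far inside `V_L`. -/
theorem two_steps {x z : Lat d} (hx : 2 * r ≤ bdist L x)
    (hz : eNorm (z - x) ≤ 2 * hField h L r x + 1) :
    r ≤ bdist L z ∧ 2 * hField h L r z + 1 ≤ 5 * hField h L r x := by
  have hs : 0 < sScale L := by linarith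
  have h1 := hField_le hh hs (r := r) x
  have h2 := hField_le hh hs (r := r) z
  have h3 := le_hField hh hs (r := r) (by linarith) x
  have h3' := le_hField_of_radius (h := h) (L := L) (r := r) x
  have hb : bdist L x = L - eNorm x := rfl
  have hb' : bdist L z = L - eNorm z := rfl
  have h4 := eNorm_le_add z x
  have h4' := eNorm_le_add x z
  rw [eNorm_sub_comm x z] at h4'
  have h5 : max (min (bdist L x) (sScale L)) r ≤ bdist L x := max_le (min_le_left _ _) (by linarith)
  have h6 : r ≤ bdist L z := by linarith
  refine ⟨h6, ?_⟩
  have h7 : max (min (bdist L z) (sScale L)) r ≤ min (bdist L z) (sScale L) :=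
    max_le le_rfl (le_min h6 hrs)
  rcases le_total (bdist L x) (sScale L / 2) with h8 | h8
  · rw [min_eq_left h8] at h3
    have := min_le_left (bdist L z) (sScale L)
    linarith
  · rw [min_eq_right h8] at h3
    have := min_le_right (bdist L z) (sScale L)
    linarith

end Range

open Classical in
-- Within the range of a step μ stays at least μ(x)/C, so simple random walk has drift at least
-- μ(x)/C² there. A step leaving V_{L+r} loses f(z) ≥ f(x)/C ≥ h²μ(x)/C², so killing costs nothing.
theorem tildePi_drift [NeZero d] {φ h : ℝ → ℝ} (hφ : IsCGDensity φ) (hh : IsCGProfile h)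
    {L r R C : ℝ} (hr : 100 ≤ r) (hrs : r ≤ sScale L) (hR : L + 10 * r ≤ R) (hC : 1 ≤ C)
    {f μ : Lat d → ℝ} (hf : ∀ z, eNorm z ≤ L + r + 1 → 0 ≤ f z)
    (hμ : ∀ z, eNorm z ≤ L + r + 1 → 0 ≤ μ z)
    (hlow : ∀ z, eNorm z ≤ L + r → μ z ≤ C * (f z - avg f z))
    (hloc : ∀ x z, eNorm x ≤ L + r → eNorm z ≤ L + r + 1 →
      eNorm (z - x) ≤ min (R - eNorm x) (sScale L) / 4 → f x ≤ C * f z ∧ μ x ≤ C * μ z)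
    (hhμ : ∀ x, eNorm x ≤ L + r → hField h L r x ^ 2 * μ x ≤ C * f x)
    {x : Lat d} (hx : x ∈ ball0 d (L + r)) :
    ∑' z, tildePi φ h L r x z * (if z ∈ ball0 d (L + r) then ENNReal.ofReal (f z) else 0)
      + ENNReal.ofReal (hField h L r x ^ 2 * μ x / C ^ 2) ≤ ENNReal.ofReal (f x) := by
  have hm : 0 < hField h L r x := hField_pos (by linarith) x
  have hx' : eNorm x ≤ L + r := hx
  have hstep := step_le_range hh hr hrs hR hx'
  have hrange := hundred_le_range hr hrs hR hx'
  have hμx := hμ x (by linarith)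
  have hC0 : 0 < C := by linarith
  rw [tildePi, if_pos hx]
  refine srw_cg_drift hφ hm (m := μ x / C ^ 2) (by positivity) (by positivity) ?_ ?_
    (le_of_eq (by ring)) ?_
  · intro y hy hyx
    have hy' : eNorm y ≤ L + r := hy
    have h1 := (hloc x y hx' (by linarith) (by linarith)).2
    have h2 := hlow y hy
    rw [div_le_iff₀ (by positivity)]
    calc μ x ≤ C * (C * (f y - avg f y)) := h1.trans (mul_le_mul_of_nonneg_left h2 hC0.le)
      _ = _ := by ring
  · intro y hy _ e
    refine hf _ ?_
    have h1 := eNorm_le_add (y + dirVec e) y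
    rw [add_sub_cancel_left, eNorm_dirVec] at h1
    have hy' : eNorm y ≤ L + r := hy
    linarith
  · intro t ht z hz
    have h1 : eNorm z ≤ L + r + 1 := exitDist_support_ball Set.inter_subset_right _
      ⟨mem_ballAt.2 (by rw [sub_self, eNorm_zero]; linarith [ht.1]), hx⟩ hz
    have h2 := exitDist_support (by linarith [ht.1]) _ hz
    refine ⟨fun _ => hf z h1, fun _ => ?_⟩
    have h3 := (hloc x z hx' h1 (by linarith [ht.2])).1
    have h4 := hhμ x hx'
    rw [div_le_iff₀ (by positivity)]
    calc _ ≤ C * (C * f z) := h4.trans (mul_le_mul_of_nonneg_left h3 hC0.le)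
      _ = _ := by ring

open Classical in
/-- A function with controlled drift along simple random walk decreases along `Π̃^g`. -/
theorem tildeGood_drift [NeZero d] {φ h : ℝ → ℝ} (hφ : IsCGDensity φ) (hh : IsCGProfile h)
    {L r R δ η C K : ℝ} (hr : 100 ≤ r) (hrs : r ≤ sScale L) (hR : L + 10 * r ≤ R) (hC : 1 ≤ C)
    (hδ : 0 ≤ δ) (hK : 2 ≤ K) (hsmall : C * η + 25 * C ^ 2 * δ ≤ 1 / (2 * C ^ 2))
    {f μ : Lat d → ℝ} (hf : ∀ z, eNorm z ≤ L + r + 1 → 0 ≤ f z)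
    (hμ : ∀ z, eNorm z ≤ L + r + 1 → 0 ≤ μ z)
    (hlow : ∀ z, eNorm z ≤ L + r → μ z ≤ C * (f z - avg f z))
    (hup : ∀ z, eNorm z ≤ L + r → f z - avg f z ≤ C * μ z)
    (hloc : ∀ x z, eNorm x ≤ L + r → eNorm z ≤ L + r + 1 →
      eNorm (z - x) ≤ min (R - eNorm x) (sScale L) / 4 →
      (f x ≤ C * f z ∧ μ x ≤ C * μ z) ∧ (f z ≤ C * f x ∧ μ z ≤ C * μ x))
    (hhμ : ∀ x, eNorm x ≤ L + r → hField h L r x ^ 2 * μ x ≤ C * f x)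
    (hnear : ∀ x, eNorm x ≤ L → bdist L x ≤ K * r → δ * f x ≤ η * (hField h L r x ^ 2 * μ x))
    (hfar : ∀ x : Lat d, K * r < bdist L x →
      (Real.log (hField h L r x) ^ 9)⁻¹ * f x ≤ η * (hField h L r x ^ 2 * μ x))
    (ω : Env d) {x : Lat d} (hx : x ∈ ball0 d (L + r)) :
    ∑' z, tildeGood φ h L r δ ω x z * (if z ∈ ball0 d (L + r) then ENNReal.ofReal (f z) else 0)
      + ENNReal.ofReal (hField h L r x ^ 2 * μ x / (2 * C ^ 2)) ≤ ENNReal.ofReal (f x) := by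
  have hs : 0 < sScale L := by linarith
  have hr0 : 0 < r := by linarith
  have hC0 : 0 < C := by linarith
  have hm : ∀ x : Lat d, 0 < hField h L r x := fun x => hField_pos hr0 x
  have hdrift : ∀ {x : Lat d}, x ∈ ball0 d (L + r) →
      ∑' z, tildePi φ h L r x z * (if z ∈ ball0 d (L + r) then ENNReal.ofReal (f z) else 0)
      + ENNReal.ofReal (hField h L r x ^ 2 * μ x / C ^ 2) ≤ ENNReal.ofReal (f x) := fun hx =>
    tildePi_drift hφ hh hr hrs hR hC hf hμ hlow (fun x z h1 h2 h3 => (hloc x z h1 h2 h3).1) hhμ hx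
  have hx' : eNorm x ≤ L + r := hx
  have hμx := hμ x (by linarith)
  have hfx := hf x (by linarith)
  set E := hField h L r x ^ 2 * μ x with hE
  have hE0 : 0 ≤ E := by positivity
  -- One half of the gain of simple random walk is kept, the other half pays for the perturbation.
  have hhalf : ENNReal.ofReal (E / (2 * C ^ 2)) + ENNReal.ofReal (E / (2 * C ^ 2))
      = ENNReal.ofReal (E / C ^ 2) := by
    rw [← ENNReal.ofReal_add (by positivity) (by positivity)]; congr 1; field_simp; ring
  rcases tildeGood_cases (L := L) (r := r) (h := h) φ δ ω x with hcase | ⟨hxL, hgood, hcase⟩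
  · rw [hcase]
    refine le_trans (add_le_add le_rfl ?_) (hdrift hx)
    rw [← hhalf]; exact le_self_add
  have hxL' : eNorm x ≤ L := hxL
  set A := tildeGood φ h L r δ ω x with hAdef
  set B := tildePi φ h L r x with hBdef
  have hB : B = cgKern φ Set.univ (hField h L r) (envStep (srwEnv d)) x :=
    tildePi_eq_univ hφ hh hs hr0 hxL
  have hA1 : ∀ z, A z ≤ 1 := fun z => by rw [hcase]; exact cgKern_le_one hφ (hm x) z
  have hB1 : ∀ z, B z ≤ 1 := fun z => by rw [hB]; exact cgKern_le_one hφ (hm x) z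
  have hAs : ∀ z, A z ≠ 0 → eNorm (z - x) ≤ 2 * hField h L r x + 1 := fun z hz => by
    rw [hcase] at hz; exact cgKern_support hφ hr0 _ _ hz
  have hBs : ∀ z, B z ≠ 0 → eNorm (z - x) ≤ 2 * hField h L r x + 1 := fun z hz => by
    rw [hB] at hz; exact cgKern_support hφ hr0 _ _ hz
  have hstep := step_le_range hh hr hrs hR hx'
  have hrange := hundred_le_range hr hrs hR hx'
  have hnb : ∀ z, eNorm (z - x) ≤ 2 * hField h L r x + 1 → eNorm z ≤ L + r := fun z hz => by
    have h1 := eNorm_le_add z x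
    have h3 := hField_le hh hs (r := r) x
    have hb : bdist L x = L - eNorm x := rfl
    have h4 : max (min (bdist L x) (sScale L)) r ≤ bdist L x + r :=
      max_le ((min_le_left _ _).trans (by linarith)) (by linarith)
    linarith
  have hl1 : l1norm (fun z => (A z).toReal - (B z).toReal) ≤ ENNReal.ofReal δ := by
    rw [hcase, hB]
    refine l1norm_cgKern_sub_le hφ (hm x) (p := envStep ω) (p' := envStep (srwEnv d))
      (W := Set.univ) (W' := Set.univ) fun t ht => ?_
    rw [Set.inter_univ]
    exact hgood.1 t ⟨ht.1.le, ht.2.le⟩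
  have hif : ∀ D : Lat d → ℝ≥0∞, (∀ z, D z ≠ 0 → eNorm (z - x) ≤ 2 * hField h L r x + 1) →
      ∑' z, D z * (if z ∈ ball0 d (L + r) then ENNReal.ofReal (f z) else 0)
        = ∑' z, D z * ENNReal.ofReal (f z) := fun D hD => by
    refine tsum_congr fun z => ?_
    by_cases hz : D z = 0
    · rw [hz, zero_mul, zero_mul]
    · rw [if_pos (mem_ball0.2 (hnb z (hD z hz)))]
  have hBd := hdrift hx
  rw [← hBdef, hif B hBs, ← hE, ← hhalf, ← add_assoc] at hBd
  rw [hif A hAs]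
  have hfn : ∀ z, eNorm (z - x) ≤ 2 * hField h L r x + 1 → f z ≤ C * f x := fun z hz =>
    (hloc x z hx' (by linarith [hnb z hz]) (by linarith)).2.1
  -- Within Kr of the boundary the total variation bound δ suffices. Further inside, the smoothed
  -- bound (log h)^{-9} is used; there two consecutive steps stay in V_L, where cut and uncut
  -- kernels agree.
  rcases le_or_gt (bdist L x) (K * r) with hD | hD
  · have h1 := tsum_mul_le_of_l1norm hA1 hB1 hδ (fun z hz => hfn z (hAs z hz)) hl1
    refine le_trans (add_le_add (h1.trans (add_le_add le_rfl (ENNReal.ofReal_le_ofReal ?_))) le_rfl)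
      hBd
    have h2 := mul_le_mul_of_nonneg_left (hnear x hxL' hD) hC0.le
    have h3 : C * η * E ≤ 1 / (2 * C ^ 2) * E := mul_le_mul_of_nonneg_right
      (le_trans (by linarith [show 0 ≤ 25 * C ^ 2 * δ by positivity]) hsmall) hE0
    calc δ * (C * f x) = C * (δ * f x) := by ring
      _ ≤ C * (η * E) := h2
      _ = C * η * E := by ring
      _ ≤ _ := h3
      _ = _ := by ring
  · have hD2 : 2 * r ≤ bdist L x := by nlinarith
    have htwo := fun z (hz : eNorm (z - x) ≤ 2 * hField h L r x + 1) =>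
      two_steps hh hr hrs hD2 hz
    set N := (finite_ballAt (2 * hField h L r x + 1) x).toFinset with hN
    have hNmem : ∀ z, z ∈ N ↔ eNorm (z - x) ≤ 2 * hField h L r x + 1 := fun z => by
      rw [hN, Set.Finite.mem_toFinset]; rfl
    -- Reach of two steps: 2h(x)+1 for the first and at most 5h(x) for the second. The second entry
    -- of the minimum keeps N' in the range where f and μ are comparable with their values at x.
    set N' := (finite_ballAt (min (7 * hField h L r x + 1)
      (min (R - eNorm x) (sScale L) / 4)) x).toFinset with hN'
    have hN'mem : ∀ z, z ∈ N' ↔ eNorm (z - x) ≤ min (7 * hField h L r x + 1)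
        (min (R - eNorm x) (sScale L) / 4) := fun z => by
      rw [hN', Set.Finite.mem_toFinset]; rfl
    have hhx := hField_le_range hh hr hrs hR hx'
    have hh5 := le_hField_of_radius (h := h) (L := L) (r := r) x
    have hN'r : ∀ u ∈ N', eNorm (u - x) ≤ min (R - eNorm x) (sScale L) / 4 ∧ 0 ≤ f u ∧
        f u ≤ C * f x := fun u hu => by
      rw [hN'mem] at hu
      have hb : bdist L x = L - eNorm x := rfl
      have h1 : eNorm (u - x) ≤ min (R - eNorm x) (sScale L) / 4 := hu.trans (min_le_right _ _)
      have h2 := hu.trans (min_le_left _ _)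
      have h3 := hField_le hh hs (r := r) x
      have h4 : max (min (bdist L x) (sScale L)) r ≤ bdist L x :=
        max_le (min_le_left _ _) (by linarith)
      have h5 := eNorm_le_add u x
      have h6 : eNorm u ≤ L + r + 1 := by linarith
      exact ⟨h1, hf u h6, (hloc x u hx' h6 h1).2.1⟩
    have hQ : ∀ z ∈ N, hatPi φ h L r z = cgKern φ Set.univ (hField h L r) (envStep (srwEnv d)) z :=
      fun z hz => hatKern_eq_univ hφ hh hs hr0 (htwo z ((hNmem z).1 hz)).1 _
    have hQ' : ∀ z ∈ N, tildePi φ h L r z = cgKern φ Set.univ (hField h L r) (envStep (srwEnv d)) z :=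
      fun z hz => by
        have h1 := (htwo z ((hNmem z).1 hz)).1
        have hb : bdist L z = L - eNorm z := rfl
        exact tildePi_eq_univ hφ hh hs hr0 (mem_ball0.2 (by linarith))
    have hreach : ∀ z u, eNorm (z - x) ≤ 2 * hField h L r x + 1 →
        eNorm (u - z) ≤ 2 * hField h L r z + 1 → u ∈ N' := fun z u hz hu => by
      have h2 := (htwo z hz).2
      have h3 := eNorm_sub_le u z x
      have h4 := step_le_range hh hr hrs hR (hnb z hz)
      have h5 : min (R - eNorm z) (sScale L) ≤ 1.11 * min (R - eNorm x) (sScale L) := by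
        have h6 := eNorm_le_add x z
        rw [eNorm_sub_comm] at h6
        rcases min_cases (R - eNorm x) (sScale L) with ⟨h7, -⟩ | ⟨h7, -⟩
        · rw [h7] at hstep ⊢
          exact (min_le_left _ _).trans (by linarith)
        · rw [h7]
          exact (min_le_right _ _).trans (by linarith)
      exact (hN'mem u).2 (le_min (by linarith) (by linarith))
    have hQN' : ∀ z ∈ N, ∀ u ∉ N', hatPi φ h L r z u = 0 := fun z hz u hu => by
      by_contra hne
      rw [hQ z hz] at hne
      have h1 := cgKern_support hφ hr0 _ _ hne
      exact hu (hreach z u ((hNmem z).1 hz) h1)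
    have hQ1 : ∀ z ∈ N, ∀ u, hatPi φ h L r z u ≤ 1 := fun z hz u => by
      rw [hQ z hz]; exact cgKern_le_one hφ (hm z) u
    -- One side is the supersolution property of f at z. The other is the upper drift bound: a loss
    -- of at most C²μ(x)(2h(z)+1)², and 2h(z)+1 ≤ 5h(x) produces the 25.
    have hharm : ∀ z ∈ N, |f z - ∑ u ∈ N', (hatPi φ h L r z u).toReal * f u| ≤ 25 * C ^ 2 * E := by
      intro z hz
      have hzN := (hNmem z).1 hz
      have hzV := hnb z hzN
      have hzh := (htwo z hzN).2
      have hfz := hf z (by linarith)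
      have hreal := tsum_mul_ofReal_eq (hQ1 z hz) (hQN' z hz) (fun u hu => (hN'r u hu).2.1)
      have hle : ∑ u ∈ N', (hatPi φ h L r z u).toReal * f u ≤ f z := by
        rw [← ENNReal.ofReal_le_ofReal_iff hfz, ← hreal, hQ z hz, ← hQ' z hz]
        refine le_trans ?_ (le_self_add.trans (hdrift hzV))
        refine ENNReal.tsum_le_tsum fun u => ?_
        by_cases hu : tildePi φ h L r z u = 0
        · rw [hu, zero_mul, zero_mul]
        · rw [if_pos]
          rw [hQ' z hz] at hu
          have h1 := cgKern_support hφ hr0 _ _ hu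
          have h2 := hField_le hh hs (r := r) z
          have h3 := (htwo z hzN).1
          have hb : bdist L z = L - eNorm z := rfl
          have h4 : max (min (bdist L z) (sScale L)) r ≤ bdist L z :=
            max_le (min_le_left _ _) h3
          have h5 := eNorm_le_add u z
          exact mem_ball0.2 (by linarith)
      have hge : f z ≤ ∑ u ∈ N', (hatPi φ h L r z u).toReal * f u + 25 * C ^ 2 * E := by
        rw [← ENNReal.ofReal_le_ofReal_iff (add_nonneg (Finset.sum_nonneg fun u hu =>
          mul_nonneg ENNReal.toReal_nonneg (hN'r u hu).2.1) (by positivity)),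
          ENNReal.ofReal_add (Finset.sum_nonneg fun u hu =>
          mul_nonneg ENNReal.toReal_nonneg (hN'r u hu).2.1) (by positivity), ← hreal, hQ z hz]
        have hN'z : ∀ y, eNorm (y - z) ≤ 2 * hField h L r z + 1 → y ∈ N' :=
          fun y hy => hreach z y hzN hy
        refine (srw_cg_upper hφ (hm z) (M := C ^ 2 * μ x) (by positivity) (fun y hy => ?_)
          (fun y hy => (hN'r y (hN'z y hy)).2.1)).trans
          (add_le_add le_rfl (ENNReal.ofReal_le_ofReal ?_))
        · have h1 := (hN'r y (hN'z y (by linarith))).1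
          have h2 := hField_le hh hs (r := r) z
          have h3 := (htwo z hzN).1
          have hb : bdist L z = L - eNorm z := rfl
          have h4 : max (min (bdist L z) (sScale L)) r ≤ bdist L z :=
            max_le (min_le_left _ _) h3
          have h5 := eNorm_le_add y z
          have hyV : eNorm y ≤ L + r := by linarith
          have h6 := (hloc x y hx' (by linarith) h1).2.2
          calc f y - avg f y ≤ C * μ y := hup y hyV
            _ ≤ C * (C * μ x) := mul_le_mul_of_nonneg_left h6 hC0.le
            _ = _ := by ring
        · have h1 : (2 * hField h L r z + 1) ^ 2 ≤ (5 * hField h L r x) ^ 2 :=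
            pow_le_pow_left₀ (by linarith [hm z]) hzh 2
          calc C ^ 2 * μ x * (2 * hField h L r z + 1) ^ 2
              ≤ C ^ 2 * μ x * (5 * hField h L r x) ^ 2 :=
                mul_le_mul_of_nonneg_left h1 (by positivity)
            _ = _ := by rw [hE]; ring
      rw [abs_le]
      constructor <;> linarith [show 0 ≤ 25 * C ^ 2 * E by positivity]
    have hl2 : l1norm (fun u => ∑' z, ((A z).toReal - (B z).toReal) * (hatPi φ h L r z u).toReal)
        ≤ ENNReal.ofReal ((Real.log (hField h L r x) ^ 9)⁻¹) := by
      have h1 := hgood.2 (by nlinarith)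
      unfold kernDiff at h1
      have hb : r ≤ bdist L x := by linarith
      rw [hatKern_eq_univ hφ hh hs hr0 hb, ← hcase] at h1
      rw [show hatPi φ h L r x = B by
        rw [hB]; exact hatKern_eq_univ hφ hh hs hr0 hb _] at h1
      exact h1
    have hε : 0 ≤ (Real.log (hField h L r x) ^ 9)⁻¹ :=
      inv_nonneg.2 (pow_nonneg (Real.log_nonneg (by linarith)) 9)
    have h1 := tsum_mul_le_of_smoothed hA1 hB1 (N := N) (N' := N') (f := f)
      (fun z hz => by by_contra hne; exact hz ((hNmem z).2 (hAs z hne)))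
      (fun z hz => by by_contra hne; exact hz ((hNmem z).2 (hBs z hne)))
      (fun z hz => hf z (by linarith [hnb z ((hNmem z).1 hz)]))
      (fun u hu => (hN'r u hu).2) (by positivity) (by positivity) hδ hε hharm hl1 hl2
    refine le_trans (add_le_add (h1.trans (add_le_add le_rfl (ENNReal.ofReal_le_ofReal ?_))) le_rfl)
      hBd
    have h2 := mul_le_mul_of_nonneg_left (hfar x hD) hC0.le
    have h3 := mul_le_mul_of_nonneg_right hsmall hE0
    calc (Real.log (hField h L r x) ^ 9)⁻¹ * (C * f x) + δ * (25 * C ^ 2 * E)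
        = C * ((Real.log (hField h L r x) ^ 9)⁻¹ * f x) + δ * (25 * C ^ 2 * E) := by ring
      _ ≤ C * (η * E) + δ * (25 * C ^ 2 * E) := by linarith
      _ = (C * η + 25 * C ^ 2 * δ) * E := by ring
      _ ≤ 1 / (2 * C ^ 2) * E := h3
      _ = _ := by ring

end RWRE

namespace RWRE

variable {d : ℕ}

/-! ### Discrete Laplacians of explicit functions -/

/-- Symmetric second differences are close to second derivatives. -/
theorem abs_second_difference_le {g0 g1 g2 g3 : ℝ → ℝ} {M : ℝ}
    (h0 : ∀ t ∈ Set.Icc (-1 : ℝ) 1, HasDerivAt g0 (g1 t) t)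
    (h1 : ∀ t ∈ Set.Icc (-1 : ℝ) 1, HasDerivAt g1 (g2 t) t)
    (h2 : ∀ t ∈ Set.Icc (-1 : ℝ) 1, HasDerivAt g2 (g3 t) t)
    (hM : ∀ t ∈ Set.Icc (-1 : ℝ) 1, |g3 t| ≤ M) :
    |g0 1 + g0 (-1) - 2 * g0 0 - g2 0| ≤ 2 * M := by
  have hM0 : 0 ≤ M := (abs_nonneg _).trans (hM 0 (by norm_num))
  have b2 : ∀ t ∈ Set.Icc (-1 : ℝ) 1, |g2 t - g2 0| ≤ M := by
    intro t ht
    have := (convex_Icc (-1 : ℝ) 1).norm_image_sub_le_of_norm_hasDerivWithin_le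
      (fun s hs => (h2 s hs).hasDerivWithinAt) hM (x := 0) (y := t) (by norm_num) ht
    rw [Real.norm_eq_abs, Real.norm_eq_abs, sub_zero] at this
    refine this.trans (mul_le_of_le_one_right hM0 (abs_le.2 ⟨ht.1, ht.2⟩))
  have hmem : ∀ t ∈ Set.Icc (0 : ℝ) 1, t ∈ Set.Icc (-1 : ℝ) 1 ∧ -t ∈ Set.Icc (-1 : ℝ) 1 := by
    intro t ht
    refine ⟨⟨by linarith [ht.1], ht.2⟩, ⟨by linarith [ht.2], by linarith [ht.1]⟩⟩
  -- The even part minus its quadratic Taylor term: its second derivative g2(t) + g2(-t) - 2 g2(0)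
  -- is at most 2M, and integrating twice over [0,1] gives the claim.
  let k0 : ℝ → ℝ := fun t => g0 t + g0 (-t) - t ^ 2 * g2 0
  let k1 : ℝ → ℝ := fun t => g1 t - g1 (-t) - 2 * t * g2 0
  let k2 : ℝ → ℝ := fun t => g2 t + g2 (-t) - 2 * g2 0
  have hk1 : ∀ t ∈ Set.Icc (0 : ℝ) 1, HasDerivAt k1 (k2 t) t := by
    intro t ht
    have e2 := (h1 (-t) (hmem t ht).2).comp t (hasDerivAt_neg t)
    have e3 := ((hasDerivAt_id t).const_mul 2).mul_const (g2 0)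
    refine HasDerivAt.congr_deriv ((((h1 t (hmem t ht).1).sub e2).sub e3) :) ?_
    simp only [k2]; ring
  have hk0 : ∀ t ∈ Set.Icc (0 : ℝ) 1, HasDerivAt k0 (k1 t) t := by
    intro t ht
    have e2 := (h0 (-t) (hmem t ht).2).comp t (hasDerivAt_neg t)
    have e3 := ((hasDerivAt_id t).pow 2).mul_const (g2 0)
    refine HasDerivAt.congr_deriv ((((h0 t (hmem t ht).1).add e2).sub e3) :) ?_
    simp only [k1, id]; push_cast; ring
  have c1 : ∀ t ∈ Set.Icc (0 : ℝ) 1, |k1 t| ≤ 2 * M := by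
    intro t ht
    have := (convex_Icc (0 : ℝ) 1).norm_image_sub_le_of_norm_hasDerivWithin_le
      (C := 2 * M) (fun s hs => (hk1 s hs).hasDerivWithinAt) (fun s hs => by
        have e1 := b2 s (hmem s hs).1
        have e2 := b2 (-s) (hmem s hs).2
        rw [Real.norm_eq_abs]
        calc |k2 s| = |(g2 s - g2 0) + (g2 (-s) - g2 0)| := by simp only [k2]; congr 1; ring
          _ ≤ _ := (abs_add_le _ _).trans (by linarith)) (x := 0) (y := t) (by norm_num) ht
    have e0 : k1 0 = 0 := by simp [k1]
    rw [e0, Real.norm_eq_abs, Real.norm_eq_abs, sub_zero, sub_zero] at this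
    exact this.trans (mul_le_of_le_one_right (by positivity) (abs_le.2 ⟨by linarith [ht.1], ht.2⟩))
  have := (convex_Icc (0 : ℝ) 1).norm_image_sub_le_of_norm_hasDerivWithin_le
      (C := 2 * M) (fun s hs => (hk0 s hs).hasDerivWithinAt) c1 (x := 0) (y := 1)
      (by norm_num) (by norm_num)
  simp only [k0, Real.norm_eq_abs] at this
  norm_num at this
  convert this using 2
  ring

/-- `p0, …, p3` are successive derivatives near `s`, of size `P`, `P/ℓ`, `P/ℓ²`, `P/ℓ³`. -/
structure JetAt (p0 p1 p2 p3 : ℝ → ℝ) (P ℓ s : ℝ) : Prop where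
  d0 : HasDerivAt p0 (p1 s) s
  d1 : HasDerivAt p1 (p2 s) s
  d2 : HasDerivAt p2 (p3 s) s
  b0 : |p0 s| ≤ P
  b1 : |p1 s| ≤ P / ℓ
  b2 : |p2 s| ≤ P / ℓ ^ 2
  b3 : |p3 s| ≤ P / ℓ ^ 3

/-- `S = (R² - |X|²)/R`. -/
noncomputable def bndS (R : ℝ) (X : EuclideanSpace ℝ (Fin d)) : ℝ := (R ^ 2 - ‖X‖ ^ 2) / R

/-- The second derivative sum of `p(S) q(v)`, `v = b2 + |X - ζ|²`, `R σ = |ζ|² - R²`. -/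
noncomputable def lapFormula (d : ℕ) (R b2 σ S v p0 p1 p2 q0 q1 q2 : ℝ) : ℝ :=
  4 * (1 - S / R) * p2 * q0 - 2 * d / R * p1 * q0
    - 4 / R * p1 * q1 * (v - b2 - R * S - R * σ) + 4 * (v - b2) * p0 * q2 + 2 * d * p0 * q1

/-- Leibniz rule with weights sufficient for the chain rule along a unit lattice step, where |S'| ≤
2, |v'| ≤ 3n and 1/n ≤ 2/ℓ. The total is 45 + 198 + 396 + 360 = 999. -/
theorem abs_product_third_derivative_le {A0 A1 A2 A3 B0 B1 B2 B3 P Q ℓ : ℝ} (hP : 0 ≤ P)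
    (hQ : 0 ≤ Q) (hℓ : 0 < ℓ)
    (a0 : |A0| ≤ P) (a1 : |A1| ≤ 3 * P / ℓ) (a2 : |A2| ≤ 11 * P / ℓ ^ 2)
    (a3 : |A3| ≤ 45 * P / ℓ ^ 3)
    (b0 : |B0| ≤ Q) (b1 : |B1| ≤ 6 * Q / ℓ) (b2 : |B2| ≤ 44 * Q / ℓ ^ 2)
    (b3 : |B3| ≤ 360 * Q / ℓ ^ 3) :
    |A3 * B0 + 3 * (A2 * B1) + 3 * (A1 * B2) + A0 * B3| ≤ 1000 * P * Q / ℓ ^ 3 := by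
  have m1 : |A3 * B0| ≤ 45 * P / ℓ ^ 3 * Q := by
    rw [abs_mul]; exact mul_le_mul a3 b0 (abs_nonneg _) (by positivity)
  have m2 : |A2 * B1| ≤ 11 * P / ℓ ^ 2 * (6 * Q / ℓ) := by
    rw [abs_mul]; exact mul_le_mul a2 b1 (abs_nonneg _) (by positivity)
  have m3 : |A1 * B2| ≤ 3 * P / ℓ * (44 * Q / ℓ ^ 2) := by
    rw [abs_mul]; exact mul_le_mul a1 b2 (abs_nonneg _) (by positivity)
  have m4 : |A0 * B3| ≤ P * (360 * Q / ℓ ^ 3) := by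
    rw [abs_mul]; exact mul_le_mul a0 b3 (abs_nonneg _) (by positivity)
  have e : 45 * P / ℓ ^ 3 * Q + 3 * (11 * P / ℓ ^ 2 * (6 * Q / ℓ)) +
      3 * (3 * P / ℓ * (44 * Q / ℓ ^ 2)) + P * (360 * Q / ℓ ^ 3) = 999 * (P * Q / ℓ ^ 3) := by
    field_simp; ring
  have e' : 0 ≤ P * Q / ℓ ^ 3 := by positivity
  have e'' : 1000 * P * Q / ℓ ^ 3 = 1000 * (P * Q / ℓ ^ 3) := by ring
  rw [abs_le] at *
  rw [e'']
  constructor <;> linarith [m1.1, m1.2, m2.1, m2.2, m3.1, m3.2, m4.1, m4.2]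

section

variable {p0 p1 p2 p3 q0 q1 q2 q3 : ℝ → ℝ}

/-- Second differences of `p(S) q(v)` along one line. -/
theorem abs_second_difference_product_le {R ℓ n P Q S v a c : ℝ} (hℓ : 0 < ℓ) (hℓR : ℓ ≤ R)
    (hℓn : ℓ ≤ 2 * n) (hn : 2 ≤ n) (ha : |a| + 1 ≤ R) (hc : |c| ≤ n)
    (hp : ∀ s, |s - S| ≤ 3 → JetAt p0 p1 p2 p3 P ℓ s)
    (hq : ∀ w, |w - v| ≤ 3 * n → JetAt q0 q1 q2 q3 Q (n ^ 2) w) :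
    |p0 (S - (2 * a + 1) / R) * q0 (v + 2 * c + 1) + p0 (S + (2 * a - 1) / R) * q0 (v - 2 * c + 1)
      - 2 * (p0 S * q0 v)
      - ((p2 S * (2 * a / R) ^ 2 - p1 S * (2 / R)) * q0 v
        + 2 * (p1 S * (-(2 * a / R)) * (q1 v * (2 * c)))
        + p0 S * (q2 v * (2 * c) ^ 2 + q1 v * 2))| ≤ 2000 * P * Q / ℓ ^ 3 := by
  have hR : 0 < R := hℓ.trans_le hℓR
  have hP : 0 ≤ P := (abs_nonneg _).trans (hp S (by simp)).b0
  have hQ : 0 ≤ Q := (abs_nonneg _).trans (hq v (by simp; linarith)).b0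
  -- S and v along the segment t ↦ x + t e_i, where a = x_i and c = x_i - ζ_i.
  let Sf : ℝ → ℝ := fun t => S - (2 * a * t + t ^ 2) / R
  let S1 : ℝ → ℝ := fun t => -((2 * a + 2 * t) / R)
  let vf : ℝ → ℝ := fun t => v + 2 * c * t + t ^ 2
  let v1 : ℝ → ℝ := fun t => 2 * c + 2 * t
  have dS : ∀ t, HasDerivAt Sf (S1 t) t := fun t => by
    have e := ((((hasDerivAt_id t).const_mul (2 * a)).add ((hasDerivAt_id t).pow 2)).div_const
      R).const_sub S
    refine HasDerivAt.congr_deriv ((e) :) ?_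
    simp only [S1, id]; push_cast; ring
  have dS1 : ∀ t, HasDerivAt S1 (-(2 / R)) t := fun t => by
    have e := ((((hasDerivAt_id t).const_mul 2).const_add (2 * a)).div_const R).neg
    refine HasDerivAt.congr_deriv ((e) :) ?_
    ring
  have dv : ∀ t, HasDerivAt vf (v1 t) t := fun t => by
    have e := (((hasDerivAt_id t).const_mul (2 * c)).const_add v).add ((hasDerivAt_id t).pow 2)
    refine HasDerivAt.congr_deriv ((e) :) ?_
    simp only [v1, id]; push_cast; ring
  have dv1 : ∀ t, HasDerivAt v1 2 t := fun t => by
    have e := ((hasDerivAt_id t).const_mul 2).const_add (2 * c)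
    refine HasDerivAt.congr_deriv ((e) :) ?_
    ring
  have ha' := abs_le.1 (show |a| ≤ R - 1 by linarith)
  have hc' := abs_le.1 hc
  have bS1 : ∀ t ∈ Set.Icc (-1 : ℝ) 1, |S1 t| ≤ 2 := fun t ht => by
    simp only [S1, abs_neg]
    rw [abs_div, abs_of_pos hR, div_le_iff₀ hR, abs_le]
    constructor <;> linarith [ht.1, ht.2]
  have bv1 : ∀ t ∈ Set.Icc (-1 : ℝ) 1, |v1 t| ≤ 3 * n := fun t ht => by
    simp only [v1]
    rw [abs_le]
    constructor <;> linarith [ht.1, ht.2]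
  have rS : ∀ t ∈ Set.Icc (-1 : ℝ) 1, |Sf t - S| ≤ 3 := fun t ht => by
    have e : Sf t - S = -(t * (2 * a + t)) / R := by simp only [Sf]; ring
    have e1 : |t| ≤ 1 := abs_le.2 ⟨ht.1, ht.2⟩
    have e2 : |2 * a + t| ≤ 2 * R := by rw [abs_le]; constructor <;> linarith [ht.1, ht.2]
    rw [e, abs_div, abs_of_pos hR, div_le_iff₀ hR, abs_neg, abs_mul]
    have := mul_le_mul e1 e2 (abs_nonneg _) zero_le_one
    linarith
  have rv : ∀ t ∈ Set.Icc (-1 : ℝ) 1, |vf t - v| ≤ 3 * n := fun t ht => by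
    have e : vf t - v = t * (2 * c + t) := by simp only [vf]; ring
    have e1 : |t| ≤ 1 := abs_le.2 ⟨ht.1, ht.2⟩
    have e2 : |2 * c + t| ≤ 3 * n := by rw [abs_le]; constructor <;> linarith [ht.1, ht.2]
    rw [e, abs_mul]
    have := mul_le_mul e1 e2 (abs_nonneg _) zero_le_one
    linarith
  let A0 : ℝ → ℝ := fun t => p0 (Sf t)
  let A1 : ℝ → ℝ := fun t => p1 (Sf t) * S1 t
  let A2 : ℝ → ℝ := fun t => p2 (Sf t) * S1 t ^ 2 + p1 (Sf t) * -(2 / R)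
  let A3 : ℝ → ℝ := fun t => p3 (Sf t) * S1 t ^ 3 + 3 * (p2 (Sf t) * S1 t * -(2 / R))
  let B0 : ℝ → ℝ := fun t => q0 (vf t)
  let B1 : ℝ → ℝ := fun t => q1 (vf t) * v1 t
  let B2 : ℝ → ℝ := fun t => q2 (vf t) * v1 t ^ 2 + q1 (vf t) * 2
  let B3 : ℝ → ℝ := fun t => q3 (vf t) * v1 t ^ 3 + 3 * (q2 (vf t) * v1 t * 2)
  have dA0 : ∀ t ∈ Set.Icc (-1 : ℝ) 1, HasDerivAt A0 (A1 t) t := fun t ht =>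
    (hp _ (rS t ht)).d0.comp t (dS t)
  have dA1 : ∀ t ∈ Set.Icc (-1 : ℝ) 1, HasDerivAt A1 (A2 t) t := fun t ht => by
    refine HasDerivAt.congr_deriv ((((hp _ (rS t ht)).d1.comp t (dS t)).mul (dS1 t)) :) ?_
    simp only [A2, Function.comp]; ring
  have dA2 : ∀ t ∈ Set.Icc (-1 : ℝ) 1, HasDerivAt A2 (A3 t) t := fun t ht => by
    refine HasDerivAt.congr_deriv (((((hp _ (rS t ht)).d2.comp t (dS t)).mul ((dS1 t).pow 2)).add
      (((hp _ (rS t ht)).d1.comp t (dS t)).mul_const (-(2 / R)))) :) ?_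
    simp only [A3, Function.comp, Pi.pow_apply]; push_cast; ring
  have dB0 : ∀ t ∈ Set.Icc (-1 : ℝ) 1, HasDerivAt B0 (B1 t) t := fun t ht =>
    (hq _ (rv t ht)).d0.comp t (dv t)
  have dB1 : ∀ t ∈ Set.Icc (-1 : ℝ) 1, HasDerivAt B1 (B2 t) t := fun t ht => by
    refine HasDerivAt.congr_deriv ((((hq _ (rv t ht)).d1.comp t (dv t)).mul (dv1 t)) :) ?_
    simp only [B2, Function.comp]; ring
  have dB2 : ∀ t ∈ Set.Icc (-1 : ℝ) 1, HasDerivAt B2 (B3 t) t := fun t ht => by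
    refine HasDerivAt.congr_deriv (((((hq _ (rv t ht)).d2.comp t (dv t)).mul ((dv1 t).pow 2)).add
      (((hq _ (rv t ht)).d1.comp t (dv t)).mul_const 2)) :) ?_
    simp only [B3, Function.comp, Pi.pow_apply]; push_cast; ring
  have hinvR : |(-(2 / R))| ≤ 2 / ℓ := by
    rw [abs_neg, abs_of_pos (by positivity)]
    exact div_le_div_of_nonneg_left (by norm_num) hℓ hℓR
  have hn0 : 0 < n := by linarith
  have hnℓ : 1 / n ≤ 2 / ℓ := by
    rw [div_le_div_iff₀ hn0 hℓ]; linarith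
  have key := abs_second_difference_le (g0 := fun t => A0 t * B0 t)
    (g1 := fun t => A1 t * B0 t + A0 t * B1 t)
    (g2 := fun t => A2 t * B0 t + 2 * (A1 t * B1 t) + A0 t * B2 t)
    (g3 := fun t => A3 t * B0 t + 3 * (A2 t * B1 t) + 3 * (A1 t * B2 t) + A0 t * B3 t)
    (M := 1000 * P * Q / ℓ ^ 3)
    (fun t ht => (dA0 t ht).mul (dB0 t ht))
    (fun t ht => by
      refine HasDerivAt.congr_deriv ((((dA1 t ht).mul (dB0 t ht)).add ((dA0 t ht).mul (dB1 t ht))) :) ?_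
      ring)
    (fun t ht => by
      refine HasDerivAt.congr_deriv (((((dA2 t ht).mul (dB0 t ht)).add (((dA1 t ht).mul (dB1 t ht)).const_mul 2)).add
        ((dA0 t ht).mul (dB2 t ht))) :) ?_
      ring)
    (fun t ht => by
      have jp := hp _ (rS t ht)
      have jq := hq _ (rv t ht)
      have s1 := bS1 t ht
      have w1 := bv1 t ht
      have s2 : |S1 t| ^ 2 ≤ 2 ^ 2 := pow_le_pow_left₀ (abs_nonneg _) s1 2
      have s3 : |S1 t| ^ 3 ≤ 2 ^ 3 := pow_le_pow_left₀ (abs_nonneg _) s1 3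
      have w2 : |v1 t| ^ 2 ≤ (3 * n) ^ 2 := pow_le_pow_left₀ (abs_nonneg _) w1 2
      have w3 : |v1 t| ^ 3 ≤ (3 * n) ^ 3 := pow_le_pow_left₀ (abs_nonneg _) w1 3
      have hi2 : (1 / n) ^ 2 ≤ (2 / ℓ) ^ 2 := pow_le_pow_left₀ (by positivity) hnℓ 2
      have hi3 : (1 / n) ^ 3 ≤ (2 / ℓ) ^ 3 := pow_le_pow_left₀ (by positivity) hnℓ 3
      refine abs_product_third_derivative_le hP hQ hℓ jp.b0 ?_ ?_ ?_ jq.b0 ?_ ?_ ?_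
      · rw [abs_mul]
        calc _ ≤ P / ℓ * 2 := mul_le_mul jp.b1 s1 (abs_nonneg _) (by positivity)
          _ ≤ _ := by
            have : 0 ≤ P / ℓ := by positivity
            rw [mul_div_assoc]; linarith
      · have e1 : |p2 (Sf t) * S1 t ^ 2| ≤ P / ℓ ^ 2 * 2 ^ 2 := by
          rw [abs_mul, abs_pow]; exact mul_le_mul jp.b2 s2 (by positivity) (by positivity)
        have e2 : |p1 (Sf t) * -(2 / R)| ≤ P / ℓ * (2 / ℓ) := by
          rw [abs_mul]; exact mul_le_mul jp.b1 hinvR (abs_nonneg _) (by positivity)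
        refine (abs_add_le _ _).trans ((add_le_add e1 e2).trans ?_)
        have : 0 ≤ P / ℓ ^ 2 := by positivity
        have e3 : P / ℓ * (2 / ℓ) = 2 * (P / ℓ ^ 2) := by field_simp
        rw [mul_div_assoc, e3]; linarith
      · have e1 : |p3 (Sf t) * S1 t ^ 3| ≤ P / ℓ ^ 3 * 2 ^ 3 := by
          rw [abs_mul, abs_pow]; exact mul_le_mul jp.b3 s3 (by positivity) (by positivity)
        have e2 : |p2 (Sf t) * S1 t * -(2 / R)| ≤ P / ℓ ^ 2 * 2 * (2 / ℓ) := by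
          rw [abs_mul, abs_mul]
          exact mul_le_mul (mul_le_mul jp.b2 s1 (abs_nonneg _) (by positivity)) hinvR
            (abs_nonneg _) (by positivity)
        refine (abs_add_le _ _).trans ?_
        rw [abs_mul 3, abs_of_pos (by norm_num : (0 : ℝ) < 3)]
        have : 0 ≤ P / ℓ ^ 3 := by positivity
        have e3 : P / ℓ ^ 2 * 2 * (2 / ℓ) = 4 * (P / ℓ ^ 3) := by field_simp; norm_num
        rw [mul_div_assoc]; linarith
      · rw [abs_mul]
        calc _ ≤ Q / n ^ 2 * (3 * n) := mul_le_mul jq.b1 w1 (abs_nonneg _) (by positivity)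
          _ = 3 * Q * (1 / n) := by field_simp
          _ ≤ 3 * Q * (2 / ℓ) := mul_le_mul_of_nonneg_left hnℓ (by positivity)
          _ = _ := by ring
      · have e1 : |q2 (vf t) * v1 t ^ 2| ≤ Q / (n ^ 2) ^ 2 * (3 * n) ^ 2 := by
          rw [abs_mul, abs_pow]; exact mul_le_mul jq.b2 w2 (by positivity) (by positivity)
        have e2 : |q1 (vf t) * 2| ≤ Q / n ^ 2 * 2 := by
          rw [abs_mul, abs_of_pos (by norm_num : (0 : ℝ) < 2)]
          exact mul_le_mul_of_nonneg_right jq.b1 (by norm_num)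
        refine (abs_add_le _ _).trans ((add_le_add e1 e2).trans ?_)
        calc _ = 11 * Q * (1 / n) ^ 2 := by field_simp; norm_num
          _ ≤ 11 * Q * (2 / ℓ) ^ 2 := mul_le_mul_of_nonneg_left hi2 (by positivity)
          _ = _ := by ring
      · have e1 : |q3 (vf t) * v1 t ^ 3| ≤ Q / (n ^ 2) ^ 3 * (3 * n) ^ 3 := by
          rw [abs_mul, abs_pow]; exact mul_le_mul jq.b3 w3 (by positivity) (by positivity)
        have e2 : |q2 (vf t) * v1 t * 2| ≤ Q / (n ^ 2) ^ 2 * (3 * n) * 2 := by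
          rw [abs_mul, abs_mul, abs_of_pos (by norm_num : (0 : ℝ) < 2)]
          exact mul_le_mul_of_nonneg_right (mul_le_mul jq.b2 w1 (abs_nonneg _) (by positivity))
            (by norm_num)
        refine (abs_add_le _ _).trans ?_
        rw [abs_mul 3, abs_of_pos (by norm_num : (0 : ℝ) < 3)]
        calc _ ≤ Q / (n ^ 2) ^ 3 * (3 * n) ^ 3 + 3 * (Q / (n ^ 2) ^ 2 * (3 * n) * 2) := by linarith
          _ = 45 * Q * (1 / n) ^ 3 := by field_simp; ring
          _ ≤ 45 * Q * (2 / ℓ) ^ 3 := mul_le_mul_of_nonneg_left hi3 (by positivity)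
          _ = _ := by ring)
  have e1 : Sf 1 = S - (2 * a + 1) / R := by simp only [Sf]; ring
  have e2 : Sf (-1) = S + (2 * a - 1) / R := by simp only [Sf]; ring
  have e3 : Sf 0 = S := by simp only [Sf]; ring
  have e4 : vf 1 = v + 2 * c + 1 := by simp only [vf]; ring
  have e5 : vf (-1) = v - 2 * c + 1 := by simp only [vf]; ring
  have e6 : vf 0 = v := by simp only [vf]; ring
  simp only [A0, A1, A2, B0, B1, B2, e1, e2, e3, e4, e5, e6, S1, v1] at key
  convert key using 2
  · ring
  · ring

/-- The discrete Laplacian of `p(S) q(v)`. -/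
theorem abs_avg_product_sub_le [NeZero d] {R b2 σ ℓ n P Q : ℝ} (x : Lat d)
    (ζ : EuclideanSpace ℝ (Fin d)) (hσ : ‖ζ‖ ^ 2 = R ^ 2 + R * σ)
    (hℓ : 0 < ℓ) (hℓR : ℓ ≤ R) (hℓn : ℓ ≤ 2 * n) (hn : 2 ≤ n) (hx : eNorm x + 1 ≤ R)
    (hxn : ‖emb x - ζ‖ ≤ n)
    (hp : ∀ s, |s - bndS R (emb x)| ≤ 3 → JetAt p0 p1 p2 p3 P ℓ s)
    (hq : ∀ w, |w - (b2 + ‖emb x - ζ‖ ^ 2)| ≤ 3 * n → JetAt q0 q1 q2 q3 Q (n ^ 2) w) :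
    |2 * d * (avg (fun z => p0 (bndS R (emb z)) * q0 (b2 + ‖emb z - ζ‖ ^ 2)) x
        - p0 (bndS R (emb x)) * q0 (b2 + ‖emb x - ζ‖ ^ 2))
      - lapFormula d R b2 σ (bndS R (emb x)) (b2 + ‖emb x - ζ‖ ^ 2) (p0 (bndS R (emb x)))
        (p1 (bndS R (emb x))) (p2 (bndS R (emb x))) (q0 (b2 + ‖emb x - ζ‖ ^ 2))
        (q1 (b2 + ‖emb x - ζ‖ ^ 2)) (q2 (b2 + ‖emb x - ζ‖ ^ 2))| ≤ 2000 * d * P * Q / ℓ ^ 3 := by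
  have hR : 0 < R := hℓ.trans_le hℓR
  set S := bndS R (emb x) with hS
  set v := b2 + ‖emb x - ζ‖ ^ 2 with hv
  set f : Lat d → ℝ := fun z => p0 (bndS R (emb z)) * q0 (b2 + ‖emb z - ζ‖ ^ 2) with hf
  have hd : (0 : ℝ) < d := Nat.cast_pos.2 (Nat.pos_of_ne_zero (NeZero.ne d))
  have hS' : R * S = R ^ 2 - ‖emb x‖ ^ 2 := by rw [hS, bndS]; field_simp
  have nsq : ∀ Y : EuclideanSpace ℝ (Fin d), ‖Y‖ ^ 2 = ∑ i, Y i ^ 2 := fun Y => by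
    rw [EuclideanSpace.norm_sq_eq]; simp
  have hup : ∀ (i : Fin d) (ξ : EuclideanSpace ℝ (Fin d)),
      ‖emb (x + dirVec (i, true)) - ξ‖ ^ 2 = ‖emb x - ξ‖ ^ 2 + 2 * (x i - ξ i) + 1 := by
    intro i ξ
    rw [nsq, nsq, ← Finset.sum_erase_add _ _ (Finset.mem_univ i),
      ← Finset.sum_erase_add Finset.univ (fun j => (emb x - ξ) j ^ 2) (Finset.mem_univ i)]
    have : ∑ j ∈ Finset.univ.erase i, (emb (x + dirVec (i, true)) - ξ) j ^ 2
        = ∑ j ∈ Finset.univ.erase i, (emb x - ξ) j ^ 2 :=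
      Finset.sum_congr rfl fun j hj => by simp [dirVec, (Finset.mem_erase.1 hj).1]
    rw [this]
    simp [dirVec]; ring
  have hdn : ∀ (i : Fin d) (ξ : EuclideanSpace ℝ (Fin d)),
      ‖emb (x + dirVec (i, false)) - ξ‖ ^ 2 = ‖emb x - ξ‖ ^ 2 - 2 * (x i - ξ i) + 1 := by
    intro i ξ
    rw [nsq, nsq, ← Finset.sum_erase_add _ _ (Finset.mem_univ i),
      ← Finset.sum_erase_add Finset.univ (fun j => (emb x - ξ) j ^ 2) (Finset.mem_univ i)]
    have : ∑ j ∈ Finset.univ.erase i, (emb (x + dirVec (i, false)) - ξ) j ^ 2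
        = ∑ j ∈ Finset.univ.erase i, (emb x - ξ) j ^ 2 :=
      Finset.sum_congr rfl fun j hj => by simp [dirVec, (Finset.mem_erase.1 hj).1]
    rw [this]
    simp [dirVec]; ring
  have hSup : ∀ i : Fin d, bndS R (emb (x + dirVec (i, true))) = S - (2 * (x i : ℝ) + 1) / R := by
    intro i
    have := hup i 0
    simp only [sub_zero, PiLp.zero_apply] at this
    rw [hS, bndS, bndS, this]; field_simp; ring
  have hSdn : ∀ i : Fin d, bndS R (emb (x + dirVec (i, false))) = S + (2 * (x i : ℝ) - 1) / R := by
    intro i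
    have := hdn i 0
    simp only [sub_zero, PiLp.zero_apply] at this
    rw [hS, bndS, bndS, this]; field_simp; ring
  let G : Fin d → ℝ := fun i => (p2 S * (2 * (x i : ℝ) / R) ^ 2 - p1 S * (2 / R)) * q0 v
        + 2 * (p1 S * (-(2 * (x i : ℝ) / R)) * (q1 v * (2 * (x i - ζ i))))
        + p0 S * (q2 v * (2 * (x i - ζ i)) ^ 2 + q1 v * 2)
  have hG : ∑ i, G i = lapFormula d R b2 σ S v (p0 S) (p1 S) (p2 S) (q0 v) (q1 v) (q2 v) := by
    have s1 : ∑ i, (x i : ℝ) ^ 2 = R ^ 2 - R * S := by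
      rw [hS', nsq]; simp
    have s2 : ∑ i, ((x i : ℝ) - ζ i) ^ 2 = v - b2 := by
      rw [hv, nsq]; simp
    have s3 : ∑ i, (ζ i) ^ 2 = R ^ 2 + R * σ := by rw [← hσ, nsq]
    -- Polarisation: 2 x·(x-ζ) = |x-ζ|² + |x|² - |ζ|². This is where σ, the position of ζ relative
    -- to the sphere, enters.
    have s4 : ∑ i, (x i : ℝ) * (x i - ζ i) = (v - b2 - R * S - R * σ) / 2 := by
      have : ∀ i, (x i : ℝ) * (x i - ζ i)
          = ((x i : ℝ) - ζ i) ^ 2 / 2 + (x i : ℝ) ^ 2 / 2 - ζ i ^ 2 / 2 := fun i => by ring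
      simp_rw [this]
      rw [Finset.sum_sub_distrib, Finset.sum_add_distrib, ← Finset.sum_div, ← Finset.sum_div,
        ← Finset.sum_div, s1, s2, s3]
      ring
    have e : ∀ i, G i = p2 S * q0 v * (4 / R ^ 2) * (x i : ℝ) ^ 2 - p1 S * (2 / R) * q0 v
        - 8 / R * (p1 S * q1 v) * ((x i : ℝ) * (x i - ζ i))
        + 4 * (p0 S * q2 v) * ((x i : ℝ) - ζ i) ^ 2 + 2 * (p0 S * q1 v) := fun i => by
      simp only [G]; ring
    simp_rw [e]
    rw [Finset.sum_add_distrib, Finset.sum_add_distrib, Finset.sum_sub_distrib,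
      Finset.sum_sub_distrib, ← Finset.mul_sum Finset.univ (fun i => (x i : ℝ) ^ 2),
      ← Finset.mul_sum Finset.univ (fun i => (x i : ℝ) * (x i - ζ i)),
      ← Finset.mul_sum Finset.univ (fun i => ((x i : ℝ) - ζ i) ^ 2), s1, s2, s4]
    simp only [Finset.sum_const, Finset.card_univ, Fintype.card_fin, nsmul_eq_mul]
    unfold lapFormula
    field_simp
    ring
  have hsum : 2 * d * (avg f x - f x)
      = ∑ i : Fin d, (f (x + dirVec (i, true)) + f (x + dirVec (i, false)) - 2 * f x) := by
    unfold avg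
    rw [Fintype.sum_prod_type, Finset.sum_sub_distrib]
    simp only [Fintype.sum_bool, Finset.sum_const, Finset.card_univ, Fintype.card_fin, nsmul_eq_mul]
    field_simp
  have hfx : p0 S * q0 v = f x := rfl
  rw [hfx, hsum, ← hG, ← Finset.sum_sub_distrib]
  refine (Finset.abs_sum_le_sum_abs _ _).trans ?_
  have hone : ∀ i ∈ (Finset.univ : Finset (Fin d)),
      |f (x + dirVec (i, true)) + f (x + dirVec (i, false)) - 2 * f x - G i|
        ≤ 2000 * P * Q / ℓ ^ 3 := by
    intro i _
    have ha : |(x i : ℝ)| + 1 ≤ R := by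
      have := abs_coord_le_eNorm x i; linarith
    have hc : |(x i : ℝ) - ζ i| ≤ n := by
      have := PiLp.norm_apply_le (emb x - ζ) i
      simp only [PiLp.sub_apply, emb_apply, Real.norm_eq_abs] at this
      linarith
    have key := abs_second_difference_product_le hℓ hℓR hℓn hn ha hc hp hq
    have e1 : f (x + dirVec (i, true)) = p0 (S - (2 * (x i : ℝ) + 1) / R)
        * q0 (v + 2 * (x i - ζ i) + 1) := by
      simp only [hf, hSup, hup, hv]; congr 2; ring
    have e2 : f (x + dirVec (i, false)) = p0 (S + (2 * (x i : ℝ) - 1) / R)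
        * q0 (v - 2 * (x i - ζ i) + 1) := by
      simp only [hf, hSdn, hdn, hv]; congr 2; ring
    rw [e1, e2]
    exact key
  refine (Finset.sum_le_card_nsmul _ _ _ hone).trans (le_of_eq ?_)
  simp only [Finset.card_univ, Fintype.card_fin, nsmul_eq_mul]
  ring

end

end RWRE

namespace RWRE

/-! ### Jets of powers and inverse logarithms -/

/-- Leibniz rule; 8 = 1+3+3+1 comes from the third derivative. -/
theorem JetAt.mul {p0 p1 p2 p3 q0 q1 q2 q3 : ℝ → ℝ} {P Q ℓ s : ℝ} (hℓ : 0 < ℓ)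
    (hp : JetAt p0 p1 p2 p3 P ℓ s) (hq : JetAt q0 q1 q2 q3 Q ℓ s) :
    JetAt (fun t => p0 t * q0 t) (fun t => p1 t * q0 t + p0 t * q1 t)
      (fun t => p2 t * q0 t + 2 * (p1 t * q1 t) + p0 t * q2 t)
      (fun t => p3 t * q0 t + 3 * (p2 t * q1 t) + 3 * (p1 t * q2 t) + p0 t * q3 t)
      (8 * (P * Q)) ℓ s := by
  have hP : 0 ≤ P := (abs_nonneg _).trans hp.b0
  have hQ : 0 ≤ Q := (abs_nonneg _).trans hq.b0
  have m : ∀ {a b A B : ℝ}, |a| ≤ A → |b| ≤ B → |a * b| ≤ A * B := fun {a b A B} ha hb => by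
    rw [abs_mul]; exact mul_le_mul ha hb (abs_nonneg _) ((abs_nonneg _).trans ha)
  refine ⟨hp.d0.mul hq.d0, ?_, ?_, ?_, ?_, ?_, ?_⟩
  · exact ((hp.d1.mul hq.d0).add (hp.d0.mul hq.d1)).congr_deriv (by ring)
  · exact (((hp.d2.mul hq.d0).add ((hp.d1.mul hq.d1).const_mul 2)).add
      (hp.d0.mul hq.d2)).congr_deriv (by ring)
  · exact (m hp.b0 hq.b0).trans (by nlinarith [mul_nonneg hP hQ])
  · refine (abs_add_le _ _).trans ((add_le_add (m hp.b1 hq.b0) (m hp.b0 hq.b1)).trans ?_)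
    have e : P / ℓ * Q + P * (Q / ℓ) = 2 * (P * Q / ℓ) := by ring
    have e' : 8 * (P * Q) / ℓ = 8 * (P * Q / ℓ) := by ring
    have : 0 ≤ P * Q / ℓ := by positivity
    rw [e, e']; linarith
  · have m1 := m hp.b2 hq.b0
    have m2 := m hp.b1 hq.b1
    have m3 := m hp.b0 hq.b2
    have e : P / ℓ ^ 2 * Q + 2 * (P / ℓ * (Q / ℓ)) + P * (Q / ℓ ^ 2) = 4 * (P * Q / ℓ ^ 2) := by
      field_simp; ring
    have e' : 8 * (P * Q) / ℓ ^ 2 = 8 * (P * Q / ℓ ^ 2) := by ring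
    have : 0 ≤ P * Q / ℓ ^ 2 := by positivity
    rw [e']
    rw [abs_le] at *
    constructor <;> linarith [m1.1, m1.2, m2.1, m2.2, m3.1, m3.2]
  · have m1 := m hp.b3 hq.b0
    have m2 := m hp.b2 hq.b1
    have m3 := m hp.b1 hq.b2
    have m4 := m hp.b0 hq.b3
    have e : P / ℓ ^ 3 * Q + 3 * (P / ℓ ^ 2 * (Q / ℓ)) + 3 * (P / ℓ * (Q / ℓ ^ 2)) +
        P * (Q / ℓ ^ 3) = 8 * (P * Q) / ℓ ^ 3 := by
      field_simp; ring
    rw [abs_le] at *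
    constructor <;> linarith [m1.1, m1.2, m2.1, m2.2, m3.1, m3.2, m4.1, m4.2]

theorem JetAt.const (c ℓ s : ℝ) (hℓ : 0 < ℓ) :
    JetAt (fun _ => c) (fun _ => 0) (fun _ => 0) (fun _ => 0) |c| ℓ s :=
  ⟨hasDerivAt_const _ _, hasDerivAt_const _ _, hasDerivAt_const _ _, le_rfl,
    by simp; positivity, by simp; positivity, by simp; positivity⟩

theorem JetAt.const_add {p0 p1 p2 p3 : ℝ → ℝ} {P ℓ s : ℝ} (h : JetAt p0 p1 p2 p3 P ℓ s)
    (hℓ : 0 < ℓ) (c : ℝ) : JetAt (fun t => c + p0 t) p1 p2 p3 (|c| + P) ℓ s := by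
  have hP : P ≤ |c| + P := by linarith [abs_nonneg c]
  exact ⟨h.d0.const_add c, h.d1, h.d2, (abs_add_le _ _).trans (by linarith [h.b0]),
    h.b1.trans (by gcongr), h.b2.trans (by gcongr), h.b3.trans (by gcongr)⟩

theorem JetAt.const_mul {p0 p1 p2 p3 : ℝ → ℝ} {P ℓ s : ℝ} (h : JetAt p0 p1 p2 p3 P ℓ s) (c : ℝ) :
    JetAt (fun t => c * p0 t) (fun t => c * p1 t) (fun t => c * p2 t) (fun t => c * p3 t)
      (|c| * P) ℓ s := by
  have m : ∀ {a A : ℝ}, |a| ≤ A → |c * a| ≤ |c| * A := fun {a A} ha => by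
    rw [abs_mul]; exact mul_le_mul_of_nonneg_left ha (abs_nonneg _)
  refine ⟨h.d0.const_mul c, h.d1.const_mul c, h.d2.const_mul c, m h.b0, ?_, ?_, ?_⟩
  · rw [mul_div_assoc]; exact m h.b1
  · rw [mul_div_assoc]; exact m h.b2
  · rw [mul_div_assoc]; exact m h.b3

theorem JetAt.id {ℓ s : ℝ} (hℓ : 0 < ℓ) (h : |s| ≤ 2 * ℓ) :
    JetAt (fun t => t) (fun _ => 1) (fun _ => 0) (fun _ => 0) (2 * ℓ) ℓ s :=
  ⟨hasDerivAt_id _, hasDerivAt_const _ _, hasDerivAt_const _ _, h,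
    by rw [mul_div_assoc, div_self hℓ.ne']; norm_num, by simp; positivity, by simp; positivity⟩

/-- The inverse logarithm `1 / log (s/c)`. -/
noncomputable def invLog (c s : ℝ) : ℝ := (Real.log (s / c))⁻¹
/-- Its first derivative. -/
noncomputable def invLog1 (c s : ℝ) : ℝ := -(invLog c s ^ 2 / s)
/-- Its second derivative. -/
noncomputable def invLog2 (c s : ℝ) : ℝ := (invLog c s ^ 2 + 2 * invLog c s ^ 3) / s ^ 2
/-- Its third derivative. -/
noncomputable def invLog3 (c s : ℝ) : ℝ :=
  -((2 * invLog c s ^ 2 + 6 * invLog c s ^ 3 + 6 * invLog c s ^ 4) / s ^ 3)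

theorem hasDerivAt_invLog {c s : ℝ} (hc : 0 < c) (hs : 0 < s) (h : 1 ≤ Real.log (s / c)) :
    HasDerivAt (invLog c) (invLog1 c s) s := by
  have h1 : HasDerivAt (fun t => Real.log (t / c)) (1 / s) s := by
    have := ((hasDerivAt_id s).div_const c).log (by simp; constructor <;> positivity)
    exact this.congr_deriv (by simp; field_simp)
  have h2 := h1.inv (by linarith)
  exact h2.congr_deriv (by unfold invLog1 invLog; field_simp)

/-- With Y = 1/log(s/c) one has Y' = -Y²/s, so every derivative costs 1/s times a polynomial in Y ∈
[0,1]. The constant is (2+6+6)·2³, the cube coming from s ≥ ℓ/2. -/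
theorem jetAt_invLog {c s ℓ : ℝ} (hc : 0 < c) (hℓ : 0 < ℓ) (hs : ℓ / 2 ≤ s)
    (h : 1 ≤ Real.log (s / c)) :
    JetAt (invLog c) (invLog1 c) (invLog2 c) (invLog3 c) 112 ℓ s := by
  have hs0 : 0 < s := by linarith
  have d0 := hasDerivAt_invLog hc hs0 h
  have y0 : 0 ≤ invLog c s := inv_nonneg.2 (by linarith)
  have y1 : invLog c s ≤ 1 := inv_le_one_of_one_le₀ h
  have y2 : invLog c s ^ 2 ≤ 1 := pow_le_one₀ y0 y1
  have y3 : invLog c s ^ 3 ≤ 1 := pow_le_one₀ y0 y1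
  have y4 : invLog c s ^ 4 ≤ 1 := pow_le_one₀ y0 y1
  have is1 : 1 / s ≤ 2 / ℓ := by rw [div_le_div_iff₀ hs0 hℓ]; linarith
  have is2 : (1 / s) ^ 2 ≤ (2 / ℓ) ^ 2 := pow_le_pow_left₀ (by positivity) is1 2
  have is3 : (1 / s) ^ 3 ≤ (2 / ℓ) ^ 3 := pow_le_pow_left₀ (by positivity) is1 3
  refine ⟨d0, ?_, ?_, ?_, ?_, ?_, ?_⟩
  · have := ((d0.pow 2).div (hasDerivAt_id s) hs0.ne').neg
    refine this.congr_deriv ?_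
    unfold invLog1 invLog2
    simp
    field_simp
    ring
  · have := ((d0.pow 2).add ((d0.pow 3).const_mul 2)).div ((hasDerivAt_id s).pow 2)
      (by simp; positivity)
    refine this.congr_deriv ?_
    unfold invLog1 invLog3
    simp
    field_simp
    ring
  · rw [abs_of_nonneg y0]; linarith
  · unfold invLog1
    rw [abs_neg, abs_of_nonneg (by positivity)]
    calc invLog c s ^ 2 / s ≤ 1 / s := by gcongr
      _ ≤ 2 / ℓ := is1
      _ ≤ _ := by gcongr; norm_num
  · unfold invLog2
    rw [abs_of_nonneg (by positivity)]
    calc _ ≤ 3 / s ^ 2 := by gcongr; linarith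
      _ = 3 * (1 / s) ^ 2 := by ring
      _ ≤ 3 * (2 / ℓ) ^ 2 := by gcongr
      _ = 12 / ℓ ^ 2 := by ring
      _ ≤ _ := by gcongr; norm_num
  · unfold invLog3
    rw [abs_neg, abs_of_nonneg (by positivity)]
    calc _ ≤ 14 / s ^ 3 := by gcongr; linarith
      _ = 14 * (1 / s) ^ 3 := by ring
      _ ≤ 14 * (2 / ℓ) ^ 3 := by gcongr
      _ = 112 / ℓ ^ 3 := by ring

theorem rpow_le_of_half_le {v w β : ℝ} (hv : 0 < v) (hw : v / 2 ≤ w) (hβ : 0 ≤ β) :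
    w ^ (-β) ≤ 2 ^ β * v ^ (-β) := by
  have h1 : w ^ (-β) ≤ (v / 2) ^ (-β) :=
    Real.rpow_le_rpow_of_nonpos (by linarith) hw (by linarith)
  refine h1.trans (le_of_eq ?_)
  rw [Real.div_rpow hv.le (by norm_num), Real.rpow_neg (by norm_num : (0 : ℝ) ≤ 2)]
  field_simp

theorem jetAt_rpow {α v w : ℝ} (hα : 0 ≤ α) (hv : 0 < v) (hw : v / 2 ≤ w) :
    JetAt (fun t => t ^ (-α)) (fun t => -α * t ^ (-α - 1)) (fun t => α * (α + 1) * t ^ (-α - 2))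
      (fun t => -(α * (α + 1) * (α + 2)) * t ^ (-α - 3))
      ((1 + α) * (1 + α) * (2 + α) * 2 ^ (α + 3) * v ^ (-α)) v w := by
  have hw0 : 0 < w := by linarith
  have dpow : ∀ β : ℝ, HasDerivAt (fun t : ℝ => t ^ β) (β * w ^ (β - 1)) w := fun β =>
    Real.hasDerivAt_rpow_const (Or.inl hw0.ne')
  have key : ∀ k : ℕ, k ≤ 3 → ∀ c : ℝ, |c| ≤ (1 + α) * (1 + α) * (2 + α) →
      |c * w ^ (-α - k)| ≤ (1 + α) * (1 + α) * (2 + α) * 2 ^ (α + 3) * v ^ (-α) / v ^ k := by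
    intro k hk c hc
    have h1 : w ^ (-α - k) ≤ 2 ^ (α + k) * v ^ (-(α + k)) := by
      have := rpow_le_of_half_le hv hw (β := α + k) (by positivity)
      rwa [neg_add, ← sub_eq_add_neg] at this ⊢
    have h2 : (2 : ℝ) ^ (α + k) ≤ 2 ^ (α + 3) :=
      Real.rpow_le_rpow_of_exponent_le (by norm_num) (by
        have : (k : ℝ) ≤ 3 := by exact_mod_cast hk
        linarith)
    have h3 : v ^ (-(α + k)) = v ^ (-α) / v ^ k := by
      rw [neg_add, ← sub_eq_add_neg, Real.rpow_sub hv, Real.rpow_natCast]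
    rw [abs_mul, abs_of_nonneg (Real.rpow_nonneg hw0.le _)]
    calc |c| * w ^ (-α - k) ≤ (1 + α) * (1 + α) * (2 + α) * (2 ^ (α + 3) * (v ^ (-α) / v ^ k)) := by
          refine mul_le_mul hc (h1.trans ?_) (Real.rpow_nonneg hw0.le _) (by positivity)
          rw [h3]
          gcongr
      _ = _ := by ring
  have ha1 : 1 ≤ (1 + α) * (1 + α) * (2 + α) := by nlinarith [mul_nonneg hα hα, mul_nonneg (mul_nonneg hα hα) hα]
  refine ⟨?_, ?_, ?_, ?_, ?_, ?_, ?_⟩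
  · exact dpow (-α)
  · refine ((dpow (-α - 1)).const_mul (-α)).congr_deriv ?_
    rw [show -α - 1 - 1 = -α - 2 by ring]; ring
  · refine ((dpow (-α - 2)).const_mul (α * (α + 1))).congr_deriv ?_
    rw [show -α - 2 - 1 = -α - 3 by ring]; ring
  · have := key 0 (by norm_num) 1 (by rw [abs_one]; exact ha1)
    simpa using this
  · have := key 1 (by norm_num) (-α) (by
      rw [abs_neg, abs_of_nonneg hα]; nlinarith [mul_nonneg hα hα, mul_nonneg (mul_nonneg hα hα) hα])
    simpa using this
  · have := key 2 (by norm_num) (α * (α + 1)) (by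
      rw [abs_of_nonneg (by positivity)]
      nlinarith [mul_nonneg hα hα, mul_nonneg (mul_nonneg hα hα) hα])
    simpa using this
  · have := key 3 (by norm_num) (-(α * (α + 1) * (α + 2))) (by
      rw [abs_neg, abs_of_nonneg (by positivity)]
      nlinarith [mul_nonneg hα hα, mul_nonneg (mul_nonneg hα hα) hα])
    simpa using this

end RWRE

namespace RWRE

variable {d : ℕ}

/-! ### The boundary function -/

/-- `b + |z - ζ|²`. -/
noncomputable def shiftSq (b : ℝ) (ζ : EuclideanSpace ℝ (Fin d)) (z : Lat d) : ℝ :=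
  b + ‖emb z - ζ‖ ^ 2

/-- A superharmonic function behaving like `S(z) / |z - ζ|^d`. -/
noncomputable def bdryFun (R r : ℝ) (ζ : EuclideanSpace ℝ (Fin d)) (z : Lat d) : ℝ :=
  bndS R (emb z) * (shiftSq 0 ζ z ^ (-(d / 2 : ℝ)) * (1 + -32 * invLog (r ^ 2) (shiftSq 0 ζ z)))
    + bndS R (emb z) * invLog r (bndS R (emb z)) * shiftSq 0 ζ z ^ (-(d / 2 : ℝ))

/-- The size of the drift of `bdryFun`. -/
noncomputable def bdryDrift (R r : ℝ) (ζ : EuclideanSpace ℝ (Fin d)) (z : Lat d) : ℝ :=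
  shiftSq 0 ζ z ^ (-(d / 2 : ℝ)) * ((‖ζ‖ ^ 2 - R ^ 2) / R / shiftSq 0 ζ z
    + invLog r (bndS R (emb z)) ^ 2 / bndS R (emb z))

theorem bndS_bounds {R : ℝ} {x : Lat d} (hx : eNorm x < R) :
    R - eNorm x ≤ bndS R (emb x) ∧ bndS R (emb x) ≤ 2 * (R - eNorm x) ∧ bndS R (emb x) ≤ R := by
  have h0 := eNorm_nonneg x
  have hR : 0 < R := by linarith
  rw [bndS, ← eNorm_eq]
  refine ⟨?_, ?_, ?_⟩
  · rw [le_div_iff₀ hR]; nlinarith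
  · rw [div_le_iff₀ hR]; nlinarith
  · rw [div_le_iff₀ hR]; nlinarith

/-- Geometric facts at a point well inside the ball of radius `R`. -/
structure BdryPoint (d : ℕ) (κ R r σ S v : ℝ) : Prop where
  hS : 0 < S
  hSR : S ≤ R
  hSv : S ^ 2 ≤ 4 * v
  hvR : v ≤ 9 * R ^ 2
  hσ : 0 ≤ σ
  hSr : Real.exp κ * r ≤ S
  hlog : κ ≤ Real.log (S / r)
  hlog' : Real.log (S / r) ≤ Real.log (v / r ^ 2)
  hcmp : v < 36 * d * S ^ 2 → Real.log (v / r ^ 2) ≤ 4 * Real.log (S / r)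

/-- Both |x-ζ| and S/2 compare with R - |x|, whence S² ≤ 4v. Therefore log(v/r²) ≥ 2 log(S/r) - log
4 ≥ log(S/r), and where v < 36dS² the term log(36d) ≤ κ ≤ log(S/r) is absorbed in the reverse
comparison. -/
theorem bdryPoint {κ R r : ℝ} {ζ : EuclideanSpace ℝ (Fin d)} {x : Lat d} (hd : 1 ≤ d)
    (hκ : 128 ≤ κ) (hκd : Real.log (36 * d) ≤ κ) (hr : 100 ≤ r) (hζ : R ≤ ‖ζ‖) (hζ' : ‖ζ‖ ≤ 2 * R)
    (hx : eNorm x + Real.exp κ * r ≤ R) :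
    BdryPoint d κ R r ((‖ζ‖ ^ 2 - R ^ 2) / R) (bndS R (emb x)) (shiftSq 0 ζ x) := by
  have hexp := Real.add_one_le_exp κ
  have her : 129 * 100 ≤ Real.exp κ * r := mul_le_mul (by linarith) hr (by norm_num) (by positivity)
  have h0 := eNorm_nonneg x
  have hR : 0 < R := by linarith
  have hr0 : 0 < r := by linarith
  obtain ⟨b1, b2, b3⟩ := bndS_bounds (R := R) (x := x) (by linarith)
  set S := bndS R (emb x)
  have hS : 0 < S := by linarith
  have hn1 : R - eNorm x ≤ ‖emb x - ζ‖ := by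
    have := norm_sub_norm_le ζ (emb x)
    rw [norm_sub_rev, ← eNorm_eq] at this; linarith
  have hn2 : ‖emb x - ζ‖ ≤ 3 * R := by
    have := norm_sub_le (emb x) ζ
    rw [← eNorm_eq] at this; linarith
  have hv : shiftSq 0 ζ x = ‖emb x - ζ‖ ^ 2 := by rw [shiftSq, zero_add]
  have hSv : S ^ 2 ≤ 4 * shiftSq 0 ζ x := by
    rw [hv]; nlinarith
  have hSr : Real.exp κ * r ≤ S := by linarith
  have hlog : κ ≤ Real.log (S / r) := by
    rw [Real.le_log_iff_exp_le (by positivity), le_div_iff₀ hr0]; exact hSr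
  have hd' : (1 : ℝ) ≤ d := by exact_mod_cast hd
  have hv0 : 0 < shiftSq 0 ζ x := by nlinarith
  have hl2 : Real.log (S ^ 2 / r ^ 2) = 2 * Real.log (S / r) := by
    rw [← div_pow, Real.log_pow]; norm_num
  refine ⟨hS, b3, hSv, ?_, ?_, hSr, hlog, ?_, fun h => ?_⟩
  · rw [hv]; nlinarith [norm_nonneg (emb x - ζ)]
  · apply div_nonneg _ hR.le; nlinarith
  · have h4 : Real.log (S ^ 2 / r ^ 2 / 4) ≤ Real.log (shiftSq 0 ζ x / r ^ 2) := by
      apply Real.log_le_log (by positivity)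
      rw [div_div, mul_comm, ← div_div]
      gcongr; linarith
    rw [Real.log_div (by positivity) (by norm_num), hl2] at h4
    have : Real.log 4 ≤ 4 := (Real.log_le_sub_one_of_pos (by norm_num)).trans (by norm_num)
    linarith
  · have h5 : Real.log (shiftSq 0 ζ x / r ^ 2) ≤ Real.log (36 * d * (S ^ 2 / r ^ 2)) := by
      apply Real.log_le_log (by positivity)
      rw [← mul_div_assoc]
      gcongr
    rw [Real.log_mul (by positivity) (by positivity), hl2] at h5
    linarith

/-- The drift of the boundary function in the continuum. -/
noncomputable def bdryLap (d : ℕ) (R σ S v a b : ℝ) : ℝ :=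
  σ / v * (2 * d * (1 - 32 * b) - 4 * 32 * b ^ 2) + 4 * 32 * b ^ 2 / R
    + S * 32 / v * b ^ 2 * (2 * d + 8 * b) + 4 * (1 - S / R) * (a ^ 2 - 2 * a ^ 3) / S
    - 2 * d / v * S * a ^ 2 + 2 * d * σ / v * (a - a ^ 2)

set_option maxHeartbeats 600000 in
-- Here a and b play the inverse logarithms of S/r and v/r². The correction S·a contributes the gain
-- 4(1-S/R)(a²-2a³)/S, which degenerates as S approaches R, and the loss 2dSa²/v from its
-- interaction with v^{-d/2}. The correction -32b contributes a gain of order Sb²/v. The σ-terms are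
-- positive because b is small.
theorem bdryLap_bounds (hd : 3 ≤ d) {R σ S v a b : ℝ} (hS : 0 < S) (hSR : S ≤ R)
    (hSv : S ^ 2 ≤ 4 * v) (hvR : v ≤ 9 * R ^ 2) (hσ : 0 ≤ σ) (hb : 0 < b) (hba : b ≤ a)
    (ha : a ≤ 1 / 128) (hcmp : v < 36 * d * S ^ 2 → a ≤ 4 * b) :
    1 / 18 * (σ / v + a ^ 2 / S) ≤ bdryLap d R σ S v a b ∧
      bdryLap d R σ S v a b ≤ 1000 * d * (σ / v + a ^ 2 / S) := by
  have hd' : (3 : ℝ) ≤ d := by exact_mod_cast hd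
  have hR : 0 < R := by linarith
  have hv : 0 < v := by nlinarith
  have ha0 : 0 < a := by linarith
  set X := σ / v with hX
  set Y := a ^ 2 / S with hY
  have hX0 : 0 ≤ X := by positivity
  have hY0 : 0 ≤ Y := by positivity
  have hb2 : b ^ 2 ≤ a ^ 2 := by gcongr
  have hb2' : b ^ 2 ≤ 1 / 128 ^ 2 := by
    rw [← one_div_pow]; gcongr; linarith
  have hSR1 : S / R ≤ 1 := (div_le_one hR).2 hSR
  have hSR0 : 0 ≤ S / R := by positivity
  have e1 : 4 * (1 - S / R) * (a ^ 2 - 2 * a ^ 3) / S = 4 * (1 - S / R) * (1 - 2 * a) * Y := by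
    rw [hY]; field_simp
  have e2 : 2 * d * σ / v * (a - a ^ 2) = X * (2 * d * (a - a ^ 2)) := by rw [hX]; field_simp
  have e3 : 2 * d / v * S * a ^ 2 = 2 * d * (S ^ 2 / v) * Y := by rw [hY]; field_simp
  have e4 : S * 32 / v * b ^ 2 * (2 * d + 8 * b) = (S ^ 2 / v) * (32 * (2 * d + 8 * b)) * (b ^ 2 / S) := by
    field_simp
  have ht0 : 0 ≤ S ^ 2 / v := by positivity
  have ht4 : S ^ 2 / v ≤ 4 := (div_le_iff₀ hv).2 hSv
  have hbS : b ^ 2 / S ≤ Y := by rw [hY]; gcongr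
  have hbS0 : 0 ≤ b ^ 2 / S := by positivity
  have hbR : 4 * 32 * b ^ 2 / R ≤ 128 * Y := by
    rw [hY, ← mul_div_assoc]
    exact div_le_div₀ (by positivity) (by linarith) hS hSR
  have hbR0 : 0 ≤ 4 * 32 * b ^ 2 / R := by positivity
  set t := S ^ 2 / v with ht
  clear_value X Y t
  have hXlow : X ≤ X * (2 * d * (1 - 32 * b) - 4 * 32 * b ^ 2) := by
    apply le_mul_of_one_le_right hX0
    have : 2 * d * ((3 : ℝ) / 4) ≤ 2 * d * (1 - 32 * b) := by gcongr; linarith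
    linarith
  have hXup : X * (2 * d * (1 - 32 * b) - 4 * 32 * b ^ 2) ≤ X * (2 * d) := by
    apply mul_le_mul_of_nonneg_left _ hX0
    have : 0 ≤ 2 * d * (32 * b) := by positivity
    linarith [sq_nonneg b]
  have hX2 : 0 ≤ X * (2 * d * (a - a ^ 2)) := by
    apply mul_nonneg hX0
    apply mul_nonneg (by positivity)
    have : a ^ 2 ≤ a := pow_le_of_le_one ha0.le (by linarith) (by norm_num)
    linarith
  have hX2up : X * (2 * d * (a - a ^ 2)) ≤ X * (2 * d) := by
    apply mul_le_mul_of_nonneg_left _ hX0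
    apply mul_le_of_le_one_right (by positivity)
    linarith [sq_nonneg a]
  have hY1 : 0 ≤ 4 * (1 - S / R) * (1 - 2 * a) * Y :=
    mul_nonneg (mul_nonneg (by linarith) (by linarith)) hY0
  have hY1up : 4 * (1 - S / R) * (1 - 2 * a) * Y ≤ 4 * Y := by
    apply mul_le_mul_of_nonneg_right _ hY0
    rw [mul_assoc]
    apply mul_le_of_le_one_right (by norm_num)
    exact mul_le_one₀ (by linarith) (by linarith) (by linarith)
  unfold bdryLap
  rw [e1, e2, e3, e4, ← hX]
  constructor
  -- For v below the threshold a ≤ 4b, so the b-gain is at least twice the loss and leaves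
  -- 2d(S²/v)a²/S ≥ a²/(18S). Above it the loss is at most a²/(18S), while v ≤ 9R² forces S ≤ R/2
  -- and keeps the first gain.
  · by_cases hc : v < 36 * d * S ^ 2
    · have hab := hcmp hc
      have ht1 : 1 ≤ 36 * d * t := by
        rw [ht, ← mul_div_assoc, le_div_iff₀ hv]; linarith
      have hbS' : Y / 16 ≤ b ^ 2 / S := by
        rw [hY, div_div, mul_comm S 16, ← div_div]
        gcongr
        have : a ^ 2 ≤ (4 * b) ^ 2 := by gcongr
        linarith
      have h1 : t * (32 * (2 * d)) * (Y / 16) ≤ t * (32 * (2 * d + 8 * b)) * (b ^ 2 / S) := by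
        gcongr; linarith
      have h2 : Y ≤ 36 * d * t * Y := le_mul_of_one_le_left hY0 ht1
      linarith
    · push Not at hc
      have ht1 : 36 * d * t ≤ 1 := by
        rw [ht, ← mul_div_assoc, div_le_iff₀ hv]; linarith
      have hSR3 : S / R ≤ 1 / 2 := by
        rw [div_le_iff₀ hR]
        have h108 : 36 * 3 * S ^ 2 ≤ 36 * d * S ^ 2 := by gcongr
        refine (pow_le_pow_iff_left₀ hS.le (by linarith) two_ne_zero).1 ?_
        linarith [mul_pow (1 / 2) R 2, sq_nonneg S]
      have h1 : (2 * (1 - 2 * a)) * Y ≤ 4 * (1 - S / R) * (1 - 2 * a) * Y := by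
        apply mul_le_mul_of_nonneg_right _ hY0
        apply mul_le_mul_of_nonneg_right _ (by linarith)
        linarith
      have h2 : 36 * d * t * Y ≤ Y := mul_le_of_le_one_left hY0 ht1
      have h3 : 0 ≤ t * (32 * (2 * d + 8 * b)) * (b ^ 2 / S) := by positivity
      have h4 : a * Y ≤ 1 / 128 * Y := by gcongr
      linarith
  · have h1 : t * (32 * (2 * d + 8 * b)) * (b ^ 2 / S) ≤ 4 * (32 * (2 * d + 8 * 1)) * Y := by
      gcongr; linarith
    have h2 : 0 ≤ 2 * d * t * Y := by positivity
    have h3 : 3 * X ≤ d * X := by gcongr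
    have h4 : 3 * Y ≤ d * Y := by gcongr
    linarith

end RWRE

/-! ### Discrete Laplacian of the boundary function. -/

namespace RWRE

variable {d : ℕ}

/-- For ζ on the sphere (σ = 0) the Poisson kernel S v^{-d/2} is harmonic and its terms cancel; for
ζ outside, -2dσ v^{-d/2-1} remains. Everything else comes from the two logarithmic corrections. -/
theorem lapFormula_bdry {R σ S v a b W : ℝ} (hR : 0 < R) (hS : 0 < S) (hv : 0 < v) :
    lapFormula d R 0 σ S v S 1 0 (W * (1 + -32 * b))
        (-(d / 2 : ℝ) * (W / v) * (1 + -32 * b) + W * (-32 * -(b ^ 2 / v)))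
        ((d / 2 : ℝ) * (d / 2 + 1) * (W / v ^ 2) * (1 + -32 * b)
          + 2 * (-(d / 2 : ℝ) * (W / v) * (-32 * -(b ^ 2 / v)))
          + W * (-32 * ((b ^ 2 + 2 * b ^ 3) / v ^ 2)))
      + lapFormula d R 0 σ S v (S * a) (1 * a + S * -(a ^ 2 / S))
        (0 * a + 2 * (1 * -(a ^ 2 / S)) + S * ((a ^ 2 + 2 * a ^ 3) / S ^ 2))
        W (-(d / 2 : ℝ) * (W / v)) ((d / 2 : ℝ) * (d / 2 + 1) * (W / v ^ 2))
      = -(W * bdryLap d R σ S v a b) := by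
  unfold lapFormula bdryLap
  field_simp
  ring

/-- The lattice error is a third derivative on the scale S, since S ≤ 2|x-ζ|: of order
S·v^{-d/2}/S³. -/
theorem avg_bdryFun [NeZero d] : ∃ E : ℝ, 0 ≤ E ∧ ∀ (κ R r : ℝ) (ζ : EuclideanSpace ℝ (Fin d))
    (x : Lat d), 128 ≤ κ → Real.log (36 * d) ≤ κ → 100 ≤ r → R ≤ ‖ζ‖ → ‖ζ‖ ≤ 2 * R →
    eNorm x + Real.exp κ * r ≤ R →
    |2 * d * (avg (bdryFun R r ζ) x - bdryFun R r ζ x) + shiftSq 0 ζ x ^ (-(d / 2 : ℝ)) *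
      bdryLap d R ((‖ζ‖ ^ 2 - R ^ 2) / R) (bndS R (emb x)) (shiftSq 0 ζ x)
        (invLog r (bndS R (emb x))) (invLog (r ^ 2) (shiftSq 0 ζ x))|
      ≤ E * (shiftSq 0 ζ x ^ (-(d / 2 : ℝ)) / bndS R (emb x) ^ 2) := by
  set c : ℝ := (1 + d / 2 : ℝ) * (1 + d / 2) * (2 + d / 2) * 2 ^ (d / 2 + 3 : ℝ) with hc
  have hc0 : 0 ≤ c := by positivity
  refine ⟨2000 * d * 2 * (8 * (c * (|1| + |(-32)| * 112))) + 2000 * d * (8 * (2 * 112)) * c,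
    by positivity, ?_⟩
  intro κ R r ζ x hκ hκd hr hζ hζ' hx
  have pt := bdryPoint (Nat.one_le_iff_ne_zero.2 (NeZero.ne d)) hκ hκd hr hζ hζ' hx
  set S := bndS R (emb x) with hSdef
  set v := shiftSq 0 ζ x with hvdef
  set n := ‖emb x - ζ‖ with hn
  set W := v ^ (-(d / 2 : ℝ)) with hW
  have hr0 : 0 < r := by linarith
  have hS := pt.hS
  have hR : 0 < R := hS.trans_le pt.hSR
  have hv : v = n ^ 2 := by rw [hvdef, shiftSq, zero_add]
  have hexp := Real.add_one_le_exp κ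
  have her : 129 * r ≤ S := (mul_le_mul_of_nonneg_right (by linarith) hr0.le).trans pt.hSr
  have hn0 : 0 ≤ n := norm_nonneg _
  have hSn : S ≤ 2 * n := by
    have := pt.hSv
    rw [hv] at this
    exact (pow_le_pow_iff_left₀ hS.le (by positivity) two_ne_zero).1 (by linarith [mul_pow 2 n 2])
  have hv0 : 0 < v := by have := pt.hSv; nlinarith
  have hW0 : 0 < W := Real.rpow_pos_of_pos hv0 _
  have hx1 : eNorm x + 1 ≤ R := by nlinarith
  have h6n : 3 * n ≤ v / 2 := by rw [hv]; nlinarith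
  have he3 : Real.exp 1 < 3 := Real.exp_one_lt_three
  have hrpow : ∀ w, |w - v| ≤ 3 * n → v / 2 ≤ w := fun w hw => by
    have := (abs_le.1 hw).1; linarith
  have hj1 : ∀ w, |w - v| ≤ 3 * n → _ := fun w hw =>
    jetAt_rpow (α := d / 2) (by positivity) hv0 (hrpow w hw)
  have hj2 : ∀ w, |w - v| ≤ 3 * n → _ := fun w hw =>
    jetAt_invLog (c := r ^ 2) (s := w) (ℓ := v) (by positivity) hv0 (hrpow w hw) (by
      have h1 := hrpow w hw
      rw [Real.le_log_iff_exp_le (by apply div_pos (by linarith); positivity),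
        le_div_iff₀ (by positivity)]
      have : (129 * r) ^ 2 ≤ S ^ 2 := by gcongr
      have := pt.hSv
      nlinarith)
  have hj3 : ∀ s, |s - S| ≤ 3 → _ := fun s hs =>
    jetAt_invLog (c := r) (s := s) (ℓ := S) hr0 hS (by have := (abs_le.1 hs).1; linarith) (by
      have h1 := (abs_le.1 hs).1
      rw [Real.le_log_iff_exp_le (by apply div_pos _ hr0; linarith), le_div_iff₀ hr0]
      nlinarith)
  have hj4 : ∀ s, |s - S| ≤ 3 → JetAt (fun t => t) (fun _ => 1) (fun _ => 0) (fun _ => 0)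
      (2 * S) S s := fun s hs => JetAt.id hS (by
    have := abs_le.1 hs; rw [abs_le]; constructor <;> linarith)
  have hσ : ‖ζ‖ ^ 2 = R ^ 2 + R * ((‖ζ‖ ^ 2 - R ^ 2) / R) := by field_simp; ring
  have hvn : v = 0 + ‖emb x - ζ‖ ^ 2 := rfl
  have A := abs_avg_product_sub_le (b2 := 0) (n := n) x ζ hσ hS pt.hSR hSn (by linarith) hx1 le_rfl
    (fun s hs => hj4 s hs)
    (fun w hw => by
      rw [← hv]
      exact (hj1 w hw).mul hv0 (((hj2 w hw).const_mul (-32)).const_add hv0 1))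
  have B := abs_avg_product_sub_le (b2 := 0) (n := n) x ζ hσ hS pt.hSR hSn (by linarith) hx1 le_rfl
    (fun s hs => (hj4 s hs).mul hS (hj3 s hs))
    (fun w hw => by rw [← hv]; exact hj1 w hw)
  rw [← hvn, ← hSdef] at A B
  have r1 : v ^ (-(d / 2 : ℝ) - 1) = W / v := by rw [Real.rpow_sub hv0, Real.rpow_one]
  have r2 : v ^ (-(d / 2 : ℝ) - 2) = W / v ^ 2 := by
    rw [Real.rpow_sub hv0, Real.rpow_two]
  have L := lapFormula_bdry (d := d) (σ := (‖ζ‖ ^ 2 - R ^ 2) / R) (a := invLog r S)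
    (b := invLog (r ^ 2) v) (W := W) hR hS hv0
  have havg : avg (bdryFun R r ζ) x = avg (fun z => bndS R (emb z) * ((0 + ‖emb z - ζ‖ ^ 2) ^
      (-(d / 2 : ℝ)) * (1 + -32 * invLog (r ^ 2) (0 + ‖emb z - ζ‖ ^ 2)))) x
      + avg (fun z => bndS R (emb z) * invLog r (bndS R (emb z)) * (0 + ‖emb z - ζ‖ ^ 2) ^
      (-(d / 2 : ℝ))) x := by
    rw [← avg_add]; rfl
  have hf : bdryFun R r ζ x = S * (W * (1 + -32 * invLog (r ^ 2) v)) + S * invLog r S * W := rfl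
  simp only [r1, r2, invLog1, invLog2] at A B
  rw [havg, hf]
  have e1 : 2000 * d * (2 * S) * (8 * (c * W * (|1| + |(-32)| * 112))) / S ^ 3
      = 2000 * d * 2 * (8 * (c * (|1| + |(-32)| * 112))) * (W / S ^ 2) := by field_simp
  have e2 : 2000 * d * (8 * (2 * S * 112)) * (c * W) / S ^ 3
      = 2000 * d * (8 * (2 * 112)) * c * (W / S ^ 2) := by field_simp
  rw [← hc, ← hW] at A B
  rw [e1] at A
  rw [e2] at B
  refine le_trans (le_of_eq ?_) ((abs_add_le _ _).trans ((add_le_add A B).trans (le_of_eq ?_)))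
  · congr 1
    linear_combination L
  · ring

end RWRE

/-! ### Drift, size and local comparison of the boundary function. -/

namespace RWRE

variable {d : ℕ}

theorem rpow_neg_le_of_le_four_mul {v w α : ℝ} (hw : 0 < w) (h : w ≤ 4 * v) (hα : 0 ≤ α) :
    v ^ (-α) ≤ 4 ^ α * w ^ (-α) := by
  have h1 : v ^ (-α) ≤ (w / 4) ^ (-α) :=
    Real.rpow_le_rpow_of_nonpos (by positivity) (by linarith) (by linarith)
  refine h1.trans (le_of_eq ?_)
  rw [Real.div_rpow hw.le (by norm_num), Real.rpow_neg (by norm_num : (0 : ℝ) ≤ 4)]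
  field_simp

/-- The square of the logarithm is negligible against the exponential. -/
theorem mul_le_of_log_le {M κ r S : ℝ} (hr : 100 ≤ r) (hS : 0 < S) (hκ : 1 ≤ κ)
    (hM : M ≤ κ) (hlog : κ ≤ Real.log (S / r)) : M ≤ invLog r S ^ 2 * S := by
  have hr0 : 0 < r := by linarith
  set τ := Real.log (S / r) with hτ
  have hτ0 : 0 < τ := by linarith
  have h1 : S = r * Real.exp τ := by rw [hτ, Real.exp_log (by positivity)]; field_simp
  have h2 := Real.pow_div_factorial_le_exp τ hτ0.le 3
  norm_num [Nat.factorial] at h2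
  have h3 : 100 * (τ ^ 3 / 6) ≤ S := by
    rw [h1]; exact mul_le_mul hr h2 (by positivity) hr0.le
  rw [invLog, ← hτ, inv_pow, inv_mul_eq_div, le_div_iff₀ (by positivity)]
  calc M * τ ^ 2 ≤ τ * τ ^ 2 := by gcongr; linarith
    _ ≤ S := by nlinarith [pow_pos hτ0 3]

theorem invLog_bounds {κ r S : ℝ} (hκ : 128 ≤ κ) (hlog : κ ≤ Real.log (S / r)) :
    0 < invLog r S ∧ invLog r S ≤ 1 / 128 := by
  refine ⟨inv_pos.2 (by linarith), ?_⟩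
  rw [invLog, one_div]
  exact inv_anti₀ (by norm_num) (by linarith)

/-- `bdryFun` is superharmonic, with drift of size `bdryDrift`. -/
theorem bdryFun_drift [NeZero d] (hd : 3 ≤ d) : ∃ κ₀ : ℝ, 128 ≤ κ₀ ∧ Real.log (36 * d) ≤ κ₀ ∧
    ∀ (κ R r : ℝ) (ζ : EuclideanSpace ℝ (Fin d)) (x : Lat d), κ₀ ≤ κ → 100 ≤ r → R ≤ ‖ζ‖ →
    ‖ζ‖ ≤ 2 * R → eNorm x + Real.exp κ * r ≤ R →
    bdryDrift R r ζ x ≤ 1000 * d * (bdryFun R r ζ x - avg (bdryFun R r ζ) x) ∧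
    bdryFun R r ζ x - avg (bdryFun R r ζ) x ≤ 1000 * d * bdryDrift R r ζ x := by
  obtain ⟨E, hE, H⟩ := avg_bdryFun (d := d)
  have hd' : (3 : ℝ) ≤ d := by exact_mod_cast hd
  refine ⟨max (max 128 (Real.log (36 * d))) (36 * E), le_max_of_le_left (le_max_left _ _),
    le_max_of_le_left (le_max_right _ _), ?_⟩
  intro κ R r ζ x hκ hr hζ hζ' hx
  have hκ1 : 128 ≤ κ := (le_max_of_le_left (le_max_left _ _)).trans hκ
  have hκ2 : Real.log (36 * d) ≤ κ := (le_max_of_le_left (le_max_right _ _)).trans hκ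
  have hκ3 : 36 * E ≤ κ := (le_max_right _ _).trans hκ
  have h1 := H κ R r ζ x hκ1 hκ2 hr hζ hζ' hx
  have pt := bdryPoint (by omega) hκ1 hκ2 hr hζ hζ' hx
  have hS := pt.hS
  have hv0 : 0 < shiftSq 0 ζ x := by have := pt.hSv; nlinarith
  have hM := mul_le_of_log_le hr hS (by linarith) hκ3 pt.hlog
  obtain ⟨ha0, ha1⟩ := invLog_bounds hκ1 pt.hlog
  have hτ0 : 0 < Real.log (bndS R (emb x) / r) := by linarith [pt.hlog]
  have hτ1 := pt.hlog'
  have hb0 : 0 < invLog (r ^ 2) (shiftSq 0 ζ x) := inv_pos.2 (by linarith)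
  have hba : invLog (r ^ 2) (shiftSq 0 ζ x) ≤ invLog r (bndS R (emb x)) := inv_anti₀ hτ0 hτ1
  obtain ⟨l1, l2⟩ := bdryLap_bounds hd hS pt.hSR pt.hSv pt.hvR pt.hσ hb0 hba ha1 (fun h => by
    have := pt.hcmp h
    rw [invLog, invLog, ← div_eq_mul_inv, le_div_iff₀ (by linarith), inv_mul_eq_div,
      div_le_iff₀ hτ0]
    exact this)
  unfold bdryDrift
  set W := shiftSq 0 ζ x ^ (-(d / 2 : ℝ))
  have hW0 : 0 < W := Real.rpow_pos_of_pos hv0 _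
  set S := bndS R (emb x)
  set a := invLog r S
  set X := (‖ζ‖ ^ 2 - R ^ 2) / R / shiftSq 0 ζ x
  have hX0 : 0 ≤ X := div_nonneg pt.hσ hv0.le
  set G := bdryLap d R ((‖ζ‖ ^ 2 - R ^ 2) / R) S (shiftSq 0 ζ x) a (invLog (r ^ 2) (shiftSq 0 ζ x))
  -- The lattice error uses up half of the lower bound a²/(18S). This needs 36E ≤ a²S, which holds
  -- because S/r ≥ e^κ with κ ≥ 36E.
  have herr : E * (W / S ^ 2) ≤ W * (1 / 36 * (a ^ 2 / S)) := by
    have e1 : E * (W / S ^ 2) = W / S ^ 2 * E := by ring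
    have e2 : W * (1 / 36 * (a ^ 2 / S)) = W / S ^ 2 * (1 / 36 * (a ^ 2 * S)) := by
      field_simp
    rw [e1, e2]
    gcongr
    linarith
  have hl1 := mul_le_mul_of_nonneg_left l1 hW0.le
  have hl2 := mul_le_mul_of_nonneg_left l2 hW0.le
  have h2 := abs_le.1 h1
  have hWX : 0 ≤ W * X := by positivity
  have hWY : 0 ≤ W * (a ^ 2 / S) := by positivity
  have hWXd : 3 * (W * X) ≤ d * (W * X) := by gcongr
  have hWYd : 3 * (W * (a ^ 2 / S)) ≤ d * (W * (a ^ 2 / S)) := by gcongr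
  constructor
  · linarith [h2.2]
  · have hpos : 0 ≤ 2 * d * (bdryFun R r ζ x - avg (bdryFun R r ζ) x) := by linarith [h2.2]
    have h3 : (bdryFun R r ζ x - avg (bdryFun R r ζ) x)
        ≤ 2 * d * (bdryFun R r ζ x - avg (bdryFun R r ζ) x) :=
      le_mul_of_one_le_left (by
        by_contra hneg
        push Not at hneg
        have := mul_neg_of_pos_of_neg (show (0 : ℝ) < 2 * d by linarith) hneg
        linarith) (by linarith)
    have h4 : W * (1000 * d * (X + a ^ 2 / S)) + W * (1 / 36 * (a ^ 2 / S))
        ≤ 2 * d * (1000 * d * (W * (X + a ^ 2 / S))) := by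
      have h5 : W * (1000 * d * (X + a ^ 2 / S)) + W * (1 / 36 * (a ^ 2 / S))
        ≤ 1001 * d * (W * (X + a ^ 2 / S)) := by linarith
      have h6 : 1001 * d * (W * (X + a ^ 2 / S)) ≤ (2 * d * 1000) * d * (W * (X + a ^ 2 / S)) := by
        gcongr; linarith
      linarith
    have h7 : 2 * d * (bdryFun R r ζ x - avg (bdryFun R r ζ) x)
        ≤ 2 * d * (1000 * d * (W * (X + a ^ 2 / S))) := by linarith [h2.1]
    exact le_of_mul_le_mul_left h7 (by linarith)

/-- Size of `bdryFun` and of its drift. -/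
theorem bdryFun_size {κ R r : ℝ} {ζ : EuclideanSpace ℝ (Fin d)} {x : Lat d} (hd : 1 ≤ d)
    (hκ : 128 ≤ κ) (hκd : Real.log (36 * d) ≤ κ) (hr : 100 ≤ r) (hζ : R ≤ ‖ζ‖) (hζ' : ‖ζ‖ ≤ 2 * R)
    (hx : eNorm x + Real.exp κ * r ≤ R) :
    shiftSq 0 ζ x ^ (-(d / 2 : ℝ)) * bndS R (emb x) / 2 ≤ bdryFun R r ζ x ∧
    bdryFun R r ζ x ≤ 2 * (shiftSq 0 ζ x ^ (-(d / 2 : ℝ)) * bndS R (emb x)) ∧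
    bndS R (emb x) ^ 2 * bdryDrift R r ζ x
      ≤ 7 * (shiftSq 0 ζ x ^ (-(d / 2 : ℝ)) * bndS R (emb x)) := by
  have pt := bdryPoint hd hκ hκd hr hζ hζ' hx
  have hS := pt.hS
  have hR : 0 < R := hS.trans_le pt.hSR
  have hv0 : 0 < shiftSq 0 ζ x := by have := pt.hSv; nlinarith
  obtain ⟨ha0, ha1⟩ := invLog_bounds hκ pt.hlog
  have hb0 : 0 < invLog (r ^ 2) (shiftSq 0 ζ x) := inv_pos.2 (by linarith [pt.hlog, pt.hlog'])
  have hb1 : invLog (r ^ 2) (shiftSq 0 ζ x) ≤ 1 / 128 :=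
    (inv_anti₀ (by linarith [pt.hlog]) pt.hlog').trans ha1
  -- S ≤ 2(R-|x|) ≤ 2|x-ζ|, and (‖ζ‖²-R²)/R ≤ 3(‖ζ‖-R) ≤ 3|x-ζ| as ‖ζ‖ ≤ 2R.
  have hσS : bndS R (emb x) * ((‖ζ‖ ^ 2 - R ^ 2) / R) ≤ 6 * shiftSq 0 ζ x := by
    have h1 : R - eNorm x ≤ ‖emb x - ζ‖ ∧ ‖ζ‖ - R ≤ ‖emb x - ζ‖ := by
      have := norm_sub_norm_le ζ (emb x)
      rw [norm_sub_rev, ← eNorm_eq] at this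
      have h2 := Real.exp_pos κ
      constructor
      · linarith
      · nlinarith
    have hxR : eNorm x < R := by nlinarith [Real.exp_pos κ]
    have h3 := (bndS_bounds hxR).2.1
    have h4 : (‖ζ‖ ^ 2 - R ^ 2) / R ≤ 3 * ‖emb x - ζ‖ := by
      rw [div_le_iff₀ hR]
      nlinarith
    rw [shiftSq, zero_add]
    calc _ ≤ (2 * ‖emb x - ζ‖) * (3 * ‖emb x - ζ‖) := by
          apply mul_le_mul (by linarith) h4 pt.hσ (by positivity)
      _ = _ := by ring
  unfold bdryFun bdryDrift
  set W := shiftSq 0 ζ x ^ (-(d / 2 : ℝ))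
  have hW0 : 0 < W := Real.rpow_pos_of_pos hv0 _
  set S := bndS R (emb x)
  set a := invLog r S
  set b := invLog (r ^ 2) (shiftSq 0 ζ x)
  have hWS : 0 < W * S := by positivity
  have e : S * (W * (1 + -32 * b)) + S * a * W = W * S * (1 - 32 * b + a) := by ring
  rw [e]
  refine ⟨?_, ?_, ?_⟩
  · nlinarith
  · nlinarith
  · have e1 : S ^ 2 * (W * ((‖ζ‖ ^ 2 - R ^ 2) / R / shiftSq 0 ζ x + a ^ 2 / S))
        = W * S * (S * ((‖ζ‖ ^ 2 - R ^ 2) / R) / shiftSq 0 ζ x + a ^ 2) := by field_simp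
    rw [e1]
    have h1 : S * ((‖ζ‖ ^ 2 - R ^ 2) / R) / shiftSq 0 ζ x ≤ 6 := (div_le_iff₀ hv0).2 hσS
    have h2 : a ^ 2 ≤ 1 := pow_le_one₀ ha0.le (by linarith)
    nlinarith

/-- Comparison of the logarithmic corrections at nearby points. -/
theorem near_bounds {κ R r : ℝ} {x z : Lat d} (hκ : 128 ≤ κ) (hr : 100 ≤ r)
    (hx : eNorm x + Real.exp κ * r ≤ R) (hz : eNorm z + Real.exp κ * r ≤ R)
    (hxz : eNorm (z - x) ≤ (R - eNorm x) / 3) :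
    bndS R (emb x) ≤ 3 * bndS R (emb z) ∧ bndS R (emb z) ≤ 3 * bndS R (emb x) ∧
      invLog r (bndS R (emb x)) ≤ 2 * invLog r (bndS R (emb z)) ∧
      R - eNorm x ≤ 3 / 2 * (R - eNorm z) := by
  have hexp := Real.add_one_le_exp κ
  have hr0 : 0 < r := by linarith
  have her : 0 < Real.exp κ * r := by positivity
  obtain ⟨x1, x2, -⟩ := bndS_bounds (R := R) (x := x) (by linarith)
  obtain ⟨z1, z2, -⟩ := bndS_bounds (R := R) (x := z) (by linarith)
  have t1 := eNorm_le_add z x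
  have t2 := eNorm_le_add x z
  rw [eNorm_sub_comm x z] at t2
  have s1 : bndS R (emb x) ≤ 3 * bndS R (emb z) := by linarith
  have s2 : bndS R (emb z) ≤ 3 * bndS R (emb x) := by linarith
  refine ⟨s1, s2, ?_, by linarith⟩
  have hlog : ∀ {S : ℝ}, Real.exp κ * r ≤ S → κ ≤ Real.log (S / r) := fun {S} hS => by
    rw [Real.le_log_iff_exp_le (by apply div_pos _ hr0; linarith), le_div_iff₀ hr0]; exact hS
  have lx := hlog (S := bndS R (emb x)) (by linarith)
  have lz := hlog (S := bndS R (emb z)) (by linarith)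
  have l3 : Real.log (bndS R (emb z) / r) ≤ Real.log (3 * (bndS R (emb x) / r)) := by
    apply Real.log_le_log
    · apply div_pos _ hr0; linarith
    · rw [← mul_div_assoc]; gcongr
  rw [Real.log_mul (by norm_num) (by
    have : 0 < bndS R (emb x) / r := by apply div_pos _ hr0; linarith
    exact this.ne')] at l3
  have : Real.log 3 ≤ 3 := (Real.log_le_sub_one_of_pos (by norm_num)).trans (by norm_num)
  rw [invLog, invLog, ← div_eq_mul_inv, le_div_iff₀ (by linarith), inv_mul_eq_div,
    div_le_iff₀ (by linarith)]
  linarith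

/-- A Harnack comparison read off from the explicit formula: over such a displacement S changes by a
factor at most 3, |·-ζ| by at most 2 and the inverse logarithm by at most 2. The 12 is 2·3·2 for the
function and 2²·3 for the drift. -/
theorem bdryFun_local {κ R r : ℝ} {ζ : EuclideanSpace ℝ (Fin d)} {x z : Lat d} (hd : 1 ≤ d)
    (hκ : 128 ≤ κ) (hκd : Real.log (36 * d) ≤ κ) (hr : 100 ≤ r) (hζ : R ≤ ‖ζ‖) (hζ' : ‖ζ‖ ≤ 2 * R)
    (hx : eNorm x + Real.exp κ * r ≤ R) (hz : eNorm z + Real.exp κ * r ≤ R)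
    (hxz : eNorm (z - x) ≤ (R - eNorm x) / 3) :
    bdryFun R r ζ x ≤ 12 * 4 ^ (d / 2 : ℝ) * bdryFun R r ζ z ∧
    bdryDrift R r ζ x ≤ 12 * 4 ^ (d / 2 : ℝ) * bdryDrift R r ζ z := by
  have px := bdryPoint hd hκ hκd hr hζ hζ' hx
  have pz := bdryPoint hd hκ hκd hr hζ hζ' hz
  obtain ⟨s1, s2, s3, s4⟩ := near_bounds hκ hr hx hz hxz
  have fx := (bdryFun_size hd hκ hκd hr hζ hζ' hx).2.1
  have fz := (bdryFun_size hd hκ hκd hr hζ hζ' hz).1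
  have hSx := px.hS
  have hSz := pz.hS
  have hvx : 0 < shiftSq 0 ζ x := by have := px.hSv; nlinarith
  have hvz : 0 < shiftSq 0 ζ z := by have := pz.hSv; nlinarith
  have hD : ∀ y : Lat d, R - eNorm y ≤ ‖emb y - ζ‖ := fun y => by
    have := norm_sub_norm_le ζ (emb y)
    rw [norm_sub_rev, ← eNorm_eq] at this; linarith
  have hdist : ‖emb z - emb x‖ = eNorm (z - x) := by rw [eNorm_sub_eq]
  have n1 : ‖emb z - ζ‖ ≤ 2 * ‖emb x - ζ‖ := by
    have := norm_sub_le_norm_sub_add_norm_sub (emb z) (emb x) ζ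
    have := hD x
    have := norm_nonneg (emb x - ζ)
    linarith
  have n2 : ‖emb x - ζ‖ ≤ 2 * ‖emb z - ζ‖ := by
    have := norm_sub_le_norm_sub_add_norm_sub (emb x) (emb z) ζ
    rw [norm_sub_rev (emb x) (emb z)] at this
    have := hD z
    have := norm_nonneg (emb z - ζ)
    linarith
  have v1 : shiftSq 0 ζ z ≤ 4 * shiftSq 0 ζ x := by
    rw [shiftSq, shiftSq]; nlinarith [norm_nonneg (emb z - ζ)]
  have v2 : shiftSq 0 ζ x ≤ 4 * shiftSq 0 ζ z := by
    rw [shiftSq, shiftSq]; nlinarith [norm_nonneg (emb x - ζ)]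
  have w1 := rpow_neg_le_of_le_four_mul (α := (d / 2 : ℝ)) hvz v1 (by positivity)
  obtain ⟨ax, -⟩ := invLog_bounds hκ px.hlog
  obtain ⟨az, -⟩ := invLog_bounds hκ pz.hlog
  unfold bdryDrift
  set Wx := shiftSq 0 ζ x ^ (-(d / 2 : ℝ))
  set Wz := shiftSq 0 ζ z ^ (-(d / 2 : ℝ))
  have hWx : 0 < Wx := Real.rpow_pos_of_pos hvx _
  have hWz : 0 < Wz := Real.rpow_pos_of_pos hvz _
  set c : ℝ := 4 ^ (d / 2 : ℝ)
  have hc : 0 < c := by positivity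
  constructor
  · calc bdryFun R r ζ x ≤ 2 * (Wx * bndS R (emb x)) := fx
      _ ≤ 2 * (c * Wz * (3 * bndS R (emb z))) := by gcongr
      _ = 12 * c * (Wz * bndS R (emb z) / 2) := by ring
      _ ≤ _ := by gcongr
  · have h1 : (‖ζ‖ ^ 2 - R ^ 2) / R / shiftSq 0 ζ x ≤ 12 * ((‖ζ‖ ^ 2 - R ^ 2) / R / shiftSq 0 ζ z) := by
      have h4 : (‖ζ‖ ^ 2 - R ^ 2) / R / shiftSq 0 ζ x ≤ 4 * ((‖ζ‖ ^ 2 - R ^ 2) / R / shiftSq 0 ζ z) := by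
        rw [← mul_div_assoc, div_le_div_iff₀ hvx hvz]
        have := mul_le_mul_of_nonneg_left v1 px.hσ
        linarith
      have : 0 ≤ (‖ζ‖ ^ 2 - R ^ 2) / R / shiftSq 0 ζ z := div_nonneg pz.hσ hvz.le
      linarith
    have h2 : invLog r (bndS R (emb x)) ^ 2 / bndS R (emb x)
        ≤ 12 * (invLog r (bndS R (emb z)) ^ 2 / bndS R (emb z)) := by
      rw [← mul_div_assoc, div_le_div_iff₀ hSx hSz]
      calc _ ≤ (2 * invLog r (bndS R (emb z))) ^ 2 * (3 * bndS R (emb x)) := by gcongr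
        _ = _ := by ring
    have h0 : 0 ≤ (‖ζ‖ ^ 2 - R ^ 2) / R / shiftSq 0 ζ x := div_nonneg px.hσ hvx.le
    calc _ ≤ c * Wz * (12 * ((‖ζ‖ ^ 2 - R ^ 2) / R / shiftSq 0 ζ z)
          + 12 * (invLog r (bndS R (emb z)) ^ 2 / bndS R (emb z))) := by gcongr
      _ = _ := by ring

end RWRE

namespace RWRE

variable {d : ℕ}

/-! ### The interior function -/

/-- A superharmonic function behaving like `(s + |z - y|)^(2-d) + c`. -/
noncomputable def intFun (R r s ϱ c : ℝ) (y z : Lat d) : ℝ :=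
  shiftSq (s ^ 2) (emb y) z ^ (-(d / 2 - 1 : ℝ))
    + ϱ * shiftSq (s ^ 2) (emb y) z ^ (-(d / 2 - 5 / 4 : ℝ))
    + c * (2 - invLog r (bndS R (emb z)))

/-- The size of the drift of `intFun`. -/
noncomputable def intDrift (R r s ϱ c : ℝ) (y z : Lat d) : ℝ :=
  shiftSq (s ^ 2) (emb y) z ^ (-(d / 2 - 1 : ℝ)) * (s ^ 2 / shiftSq (s ^ 2) (emb y) z ^ 2)
    + ϱ * (shiftSq (s ^ 2) (emb y) z ^ (-(d / 2 - 5 / 4 : ℝ)) / shiftSq (s ^ 2) (emb y) z)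
    + c * (invLog r (bndS R (emb z)) ^ 2 / bndS R (emb z) ^ 2)

theorem shiftSq_bounds {R s : ℝ} {x y : Lat d} (hs : 0 ≤ s) (hsR : s ≤ R) (hx : eNorm x ≤ R)
    (hy : eNorm y ≤ R) : s ≤ √(shiftSq (s ^ 2) (emb y) x) ∧ √(shiftSq (s ^ 2) (emb y) x) ≤ 3 * R ∧
      ‖emb x - emb y‖ ≤ √(shiftSq (s ^ 2) (emb y) x) := by
  have hR : 0 ≤ R := hs.trans hsR
  have h1 : ‖emb x - emb y‖ ≤ 2 * R := by
    have := norm_sub_le (emb x) (emb y)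
    rw [← eNorm_eq, ← eNorm_eq] at this; linarith
  refine ⟨Real.le_sqrt_of_sq_le ?_, Real.sqrt_le_iff.2 ⟨by linarith, ?_⟩, Real.le_sqrt_of_sq_le ?_⟩
  · rw [shiftSq]; nlinarith [sq_nonneg ‖emb x - emb y‖]
  · rw [shiftSq]; nlinarith [norm_nonneg (emb x - emb y)]
  · rw [shiftSq]; nlinarith

/-- For α = d/2-1 the coefficient 2dα - 4α(α+1) vanishes and only the term with s² remains: the
function is harmonic up to smoothing at its centre. For α = d/2-5/4 it equals α > 0, so there is
drift of order v^{-α-1} at every distance. -/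
theorem avg_rpow_shiftSq [NeZero d] {α : ℝ} (hα : 0 ≤ α) : ∃ E : ℝ, 0 ≤ E ∧
    ∀ (R s : ℝ) (x y : Lat d), 12 ≤ s → s ≤ R → eNorm x + 1 ≤ R → eNorm y ≤ R →
    |2 * d * (avg (fun z => shiftSq (s ^ 2) (emb y) z ^ (-α)) x - shiftSq (s ^ 2) (emb y) x ^ (-α))
      + shiftSq (s ^ 2) (emb y) x ^ (-α) / shiftSq (s ^ 2) (emb y) x *
        (2 * d * α - 4 * (α * (α + 1)) + 4 * (α * (α + 1)) * s ^ 2 / shiftSq (s ^ 2) (emb y) x)|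
      ≤ E * (shiftSq (s ^ 2) (emb y) x ^ (-α) / √(shiftSq (s ^ 2) (emb y) x) ^ 3) := by
  set c : ℝ := (1 + α) * (1 + α) * (2 + α) * 2 ^ (α + 3) with hc
  have hc0 : 0 ≤ c := by positivity
  refine ⟨54000 * d * c, by positivity, ?_⟩
  intro R s x y hs hsR hx hy
  obtain ⟨n1, n2, n3⟩ := shiftSq_bounds (by linarith) hsR (by linarith) hy (x := x) (y := y)
  have hR : 0 < R := by linarith
  set v := shiftSq (s ^ 2) (emb y) x with hv
  set n := √v with hn
  have hn0 : 0 < n := by linarith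
  have hv0 : 0 < v := Real.sqrt_pos.1 hn0
  have hvn : n ^ 2 = v := Real.sq_sqrt hv0.le
  have hσ : ‖emb y‖ ^ 2 = R ^ 2 + R * ((‖emb y‖ ^ 2 - R ^ 2) / R) := by field_simp; ring
  have hve : s ^ 2 + ‖emb x - emb y‖ ^ 2 = v := rfl
  have hrpow : ∀ w, |w - v| ≤ 3 * n → v / 2 ≤ w := fun w hw => by
    have := (abs_le.1 hw).1; nlinarith
  have hn3 : (0 : ℝ) < n / 3 := by positivity
  have A := abs_avg_product_sub_le (b2 := s ^ 2) (n := n) (ℓ := n / 3) x (emb y) hσ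
    hn3 (by linarith) (by linarith) (by linarith) hx n3
    (fun t _ => JetAt.const 1 (n / 3) t hn3)
    (fun w hw => by rw [hvn]; exact jetAt_rpow hα hv0 (hrpow w (by rwa [hve] at hw)))
  rw [hve] at A
  have r1 : v ^ (-α - 1) = v ^ (-α) / v := by rw [Real.rpow_sub hv0, Real.rpow_one]
  have r2 : v ^ (-α - 2) = v ^ (-α) / v ^ 2 := by rw [Real.rpow_sub hv0, Real.rpow_two]
  rw [r1, r2] at A
  have e1 : 2000 * d * |1| * (c * v ^ (-α)) / (n / 3) ^ 3 = 54000 * d * c * (v ^ (-α) / n ^ 3) := by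
    rw [abs_one]; field_simp; ring
  rw [← hc, e1] at A
  refine le_trans (le_of_eq ?_) A
  have e2 : (fun z : Lat d => 1 * (s ^ 2 + ‖emb z - emb y‖ ^ 2) ^ (-α))
      = fun z => shiftSq (s ^ 2) (emb y) z ^ (-α) := by
    funext z; rw [one_mul]; rfl
  rw [e2]
  congr 1
  unfold lapFormula
  field_simp
  ring

/-- The inverse logarithm of S is strictly subharmonic on the whole range, including the centre of
the ball, where the vanishing factor 1 - S/R is replaced by the term with 2d/R. Its negative
therefore supplies drift near the boundary. -/
theorem avg_invLog_bndS [NeZero d] : ∃ E : ℝ, 0 ≤ E ∧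
    ∀ (κ R r : ℝ) (x : Lat d), 128 ≤ κ → 100 ≤ r → eNorm x + Real.exp κ * r ≤ R →
    |2 * d * (avg (fun z => invLog r (bndS R (emb z))) x - invLog r (bndS R (emb x)))
      - (4 * (1 - bndS R (emb x) / R) * (invLog r (bndS R (emb x)) ^ 2
          + 2 * invLog r (bndS R (emb x)) ^ 3) / bndS R (emb x) ^ 2
        + 2 * d / R * (invLog r (bndS R (emb x)) ^ 2 / bndS R (emb x)))|
      ≤ E / bndS R (emb x) ^ 3 := by
  refine ⟨2000 * d * 112 * |1|, by positivity, ?_⟩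
  intro κ R r x hκ hr hx
  have hexp := Real.add_one_le_exp κ
  have hr0 : 0 < r := by linarith
  have her : 129 * r ≤ Real.exp κ * r := mul_le_mul_of_nonneg_right (by linarith) hr0.le
  have h0 := eNorm_nonneg x
  have hR : 0 < R := by linarith
  obtain ⟨b1, b2, b3⟩ := bndS_bounds (R := R) (x := x) (by linarith)
  set S := bndS R (emb x) with hSdef
  have hS : 129 * r ≤ S := by linarith
  have hS0 : 0 < S := by linarith
  have he3 : Real.exp 1 < 3 := Real.exp_one_lt_three
  have hj3 : ∀ s, |s - S| ≤ 3 → _ := fun s hs =>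
    jetAt_invLog (c := r) (s := s) (ℓ := S) hr0 hS0 (by have := (abs_le.1 hs).1; linarith) (by
      have h1 := (abs_le.1 hs).1
      rw [Real.le_log_iff_exp_le (by apply div_pos _ hr0; linarith), le_div_iff₀ hr0]
      nlinarith)
  -- The second factor is constant, so ζ is irrelevant and taken to be 0; then σ = -R.
  have A := abs_avg_product_sub_le (b2 := 0) (n := 2 * R) (σ := -R) (Q := |1|) x 0
    (by rw [norm_zero]; ring) hS0 b3 (by linarith) (by linarith) (by linarith)
    (by rw [sub_zero, ← eNorm_eq]; linarith) hj3
    (fun w _ => JetAt.const 1 ((2 * R) ^ 2) w (by positivity))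
  refine le_trans (le_of_eq ?_) A
  simp only [mul_one]
  congr 1
  unfold lapFormula invLog1 invLog2
  rw [← hSdef]
  field_simp
  ring

theorem rpow_quarter {v : ℝ} (hv : 0 < v) :
    v ^ (-(d / 2 - 5 / 4 : ℝ)) = v ^ (-(d / 2 - 1 : ℝ)) * √√v := by
  rw [Real.sqrt_eq_rpow, Real.sqrt_eq_rpow, ← Real.rpow_mul hv.le, ← Real.rpow_add hv]
  congr 1; ring

/-- X, ϱY and cZ are the drifts of the three terms of the interior function. The lattice errors of
the first two terms are both charged to ϱY. -/
theorem intFun_drift_arith {D X Y Z ϱ c T1 T2 T3 e1 e2 e3 k2 k3 : ℝ} (hd : 3 ≤ D)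
    (hX : 0 ≤ X) (hY : 0 ≤ Y) (hZ : 0 ≤ Z) (hϱ : 0 ≤ ϱ) (hc : 0 ≤ c)
    (h1 : |T1 + (D ^ 2 - 2 * D) * X| ≤ e1) (h2 : |T2 + k2| ≤ e2) (h3 : |T3 - k3| ≤ e3)
    (er1 : e1 ≤ 1 / 16 * (ϱ * Y)) (er2 : ϱ * e2 ≤ 1 / 16 * (ϱ * Y)) (er3 : c * e3 ≤ c * Z)
    (k2l : 1 / 4 * Y ≤ k2) (k2u : k2 ≤ 2 * D ^ 2 * Y) (k3l : 4 * Z ≤ k3)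
    (k3u : k3 ≤ 2 * D ^ 2 * Z) :
    1 / 8 * (X + ϱ * Y + c * Z) ≤ -T1 - ϱ * T2 + c * T3 ∧
      -T1 - ϱ * T2 + c * T3 ≤ 2 * D * (16 * D * (X + ϱ * Y + c * Z)) := by
  have h1' := abs_le.1 h1
  have h2a := mul_le_mul_of_nonneg_left (abs_le.1 h2).1 hϱ
  have h2b := mul_le_mul_of_nonneg_left (abs_le.1 h2).2 hϱ
  have h3a := mul_le_mul_of_nonneg_left (abs_le.1 h3).1 hc
  have h3b := mul_le_mul_of_nonneg_left (abs_le.1 h3).2 hc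
  have k2l' := mul_le_mul_of_nonneg_left k2l hϱ
  have k2u' := mul_le_mul_of_nonneg_left k2u hϱ
  have k3l' := mul_le_mul_of_nonneg_left k3l hc
  have k3u' := mul_le_mul_of_nonneg_left k3u hc
  have hdd : 3 * D ≤ D ^ 2 := by nlinarith
  have hXd : 3 * X ≤ (D ^ 2 - 2 * D) * X := by gcongr; linarith
  have hXu : (D ^ 2 - 2 * D) * X ≤ D ^ 2 * X := by gcongr; linarith
  have hϱY : 0 ≤ ϱ * Y := by positivity
  have hcZ : 0 ≤ c * Z := by positivity
  have hdd : (9 : ℝ) ≤ D ^ 2 := by linarith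
  have g1 := mul_le_mul_of_nonneg_right hdd hX
  have g2 := mul_le_mul_of_nonneg_right hdd hϱY
  have g3 := mul_le_mul_of_nonneg_right hdd hcZ
  constructor
  · linarith [h1'.2]
  · linarith [h1'.1]

set_option maxHeartbeats 600000 in
theorem intFun_drift [NeZero d] (hd : 3 ≤ d) : ∃ κ₀ : ℝ, 128 ≤ κ₀ ∧ ∃ M : ℝ, 12 ≤ M ∧
    ∀ (κ R r s ϱ c : ℝ) (x y : Lat d), κ₀ ≤ κ → 100 ≤ r → M ≤ s → s ≤ R → 0 ≤ ϱ → 0 ≤ c →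
    M ≤ ϱ * (s * √s) → eNorm x + Real.exp κ * r ≤ R → eNorm y ≤ R →
    intDrift R r s ϱ c y x ≤ 16 * d * (intFun R r s ϱ c y x - avg (intFun R r s ϱ c y) x) ∧
    intFun R r s ϱ c y x - avg (intFun R r s ϱ c y) x ≤ 16 * d * intDrift R r s ϱ c y x := by
  have hd' : (3 : ℝ) ≤ d := by exact_mod_cast hd
  obtain ⟨E1, hE1, H1⟩ := avg_rpow_shiftSq (d := d) (α := d / 2 - 1) (by linarith)
  obtain ⟨E2, hE2, H2⟩ := avg_rpow_shiftSq (d := d) (α := d / 2 - 5 / 4) (by linarith)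
  obtain ⟨E3, hE3, H3⟩ := avg_invLog_bndS (d := d)
  refine ⟨max 128 E3, le_max_left _ _, 12 + 16 * E1 + 16 * E2, by linarith, ?_⟩
  intro κ R r s ϱ c x y hκ hr hMs hsR hϱ hc hM hx hy
  have hκ1 : 128 ≤ κ := (le_max_left _ _).trans hκ
  have hκ3 : E3 ≤ κ := (le_max_right _ _).trans hκ
  have hexp := Real.add_one_le_exp κ
  have hr0 : 0 < r := by linarith
  have her : 129 * r ≤ Real.exp κ * r := mul_le_mul_of_nonneg_right (by linarith) hr0.le
  have hs0 : 0 < s := by linarith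
  have hR : 0 < R := by linarith
  have h1 := H1 R s x y (by linarith) hsR (by linarith) hy
  have h2 := H2 R s x y (by linarith) hsR (by linarith) hy
  have h3 := H3 κ R r x hκ1 hr hx
  obtain ⟨n1, n2, n3⟩ := shiftSq_bounds hs0.le hsR (by linarith) hy (x := x) (y := y)
  obtain ⟨b1, b2, b3⟩ := bndS_bounds (R := R) (x := x) (by linarith)
  have hS0 : 0 < bndS R (emb x) := by linarith
  have hlog : κ ≤ Real.log (bndS R (emb x) / r) := by
    rw [Real.le_log_iff_exp_le (by positivity), le_div_iff₀ hr0]; linarith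
  obtain ⟨a0, a1⟩ := invLog_bounds hκ1 hlog
  have hM3 := mul_le_of_log_le hr hS0 (by linarith) hκ3 hlog
  have havg : avg (intFun R r s ϱ c y) x
      = avg (fun z => shiftSq (s ^ 2) (emb y) z ^ (-(d / 2 - 1 : ℝ))) x
        + ϱ * avg (fun z => shiftSq (s ^ 2) (emb y) z ^ (-(d / 2 - 5 / 4 : ℝ))) x
        + c * (2 - avg (fun z => invLog r (bndS R (emb z))) x) := by
    have e : intFun R r s ϱ c y = fun z => (shiftSq (s ^ 2) (emb y) z ^ (-(d / 2 - 1 : ℝ))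
        + ϱ * shiftSq (s ^ 2) (emb y) z ^ (-(d / 2 - 5 / 4 : ℝ)))
        + (c * 2 + (-c) * invLog r (bndS R (emb z))) := by
      funext z; unfold intFun; ring
    rw [e, avg_add, avg_add, avg_const_mul, avg_add (fun _ => c * 2), avg_const, avg_const_mul]
    ring
  rw [havg]
  unfold intFun intDrift
  have hq := rpow_quarter (d := d) (v := shiftSq (s ^ 2) (emb y) x)
    (Real.sqrt_pos.1 (by linarith))
  set v := shiftSq (s ^ 2) (emb y) x
  set n := √v with hn
  have hn0 : 0 < n := by linarith
  have hv0 : 0 < v := Real.sqrt_pos.1 hn0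
  have hvn : v = n ^ 2 := (Real.sq_sqrt hv0.le).symm
  set W := v ^ (-(d / 2 - 1 : ℝ))
  set W' := v ^ (-(d / 2 - 5 / 4 : ℝ))
  have hW0 : 0 < W := Real.rpow_pos_of_pos hv0 _
  have hW'0 : 0 < W' := Real.rpow_pos_of_pos hv0 _
  set S := bndS R (emb x)
  set a := invLog r S
  set A1 := avg (fun z => shiftSq (s ^ 2) (emb y) z ^ (-(d / 2 - 1 : ℝ))) x
  set A2 := avg (fun z => shiftSq (s ^ 2) (emb y) z ^ (-(d / 2 - 5 / 4 : ℝ))) x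
  set A3 := avg (fun z => invLog r (bndS R (emb z))) x
  clear_value A1 A2 A3 S a W W'
  set X := W * (s ^ 2 / v ^ 2) with hX
  set Y := W' / v with hY
  set Z := a ^ 2 / S ^ 2 with hZ
  have hX0 : 0 ≤ X := by positivity
  have hY0 : 0 ≤ Y := by positivity
  have hZ0 : 0 ≤ Z := by positivity
  have hsv : s ^ 2 / v ≤ 1 := by
    rw [div_le_one hv0, hvn]; gcongr
  have hsv0 : 0 ≤ s ^ 2 / v := by positivity
  -- The main term's own drift decays too fast in n to absorb its lattice error W/n³. The second
  -- term gives W/n³ · ϱn^{3/2}, which is enough because ϱs^{3/2} is large and n ≥ s.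
  have er1 : E1 * (W / n ^ 3) ≤ 1 / 16 * (ϱ * Y) := by
    have e : ϱ * Y = W / n ^ 3 * (ϱ * (n * √n)) := by
      rw [hY, hq, hvn]; field_simp
    have h5 : 16 * E1 ≤ ϱ * (n * √n) := by
      calc 16 * E1 ≤ ϱ * (s * √s) := by linarith
        _ ≤ _ := by gcongr
    rw [e]
    have : 0 ≤ W / n ^ 3 := by positivity
    nlinarith
  have er2 : ϱ * (E2 * (W' / n ^ 3)) ≤ 1 / 16 * (ϱ * Y) := by
    have e : Y = W' / n ^ 3 * n := by rw [hY, hvn]; field_simp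
    rw [e]
    have : 0 ≤ ϱ * (W' / n ^ 3) := by positivity
    nlinarith
  have er3 : c * (E3 / S ^ 3) ≤ c * Z := by
    gcongr
    rw [hZ, div_le_div_iff₀ (by positivity) (by positivity)]
    nlinarith [pow_pos hS0 2]
  have m1 : W / v * (2 * d * (d / 2 - 1 : ℝ) - 4 * ((d / 2 - 1 : ℝ) * ((d / 2 - 1 : ℝ) + 1))
      + 4 * ((d / 2 - 1 : ℝ) * ((d / 2 - 1 : ℝ) + 1)) * s ^ 2 / v) = (d ^ 2 - 2 * d) * X := by
    rw [hX]; field_simp; ring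
  have m2 : W' / v * (2 * d * (d / 2 - 5 / 4 : ℝ) - 4 * ((d / 2 - 5 / 4 : ℝ) * ((d / 2 - 5 / 4 : ℝ) + 1))
      + 4 * ((d / 2 - 5 / 4 : ℝ) * ((d / 2 - 5 / 4 : ℝ) + 1)) * s ^ 2 / v)
      = Y * ((d / 2 - 5 / 4 : ℝ) + 4 * ((d / 2 - 5 / 4 : ℝ) * ((d / 2 - 5 / 4 : ℝ) + 1)) * (s ^ 2 / v)) := by
    rw [hY]; ring
  have m3 : 4 * (1 - S / R) * (a ^ 2 + 2 * a ^ 3) / S ^ 2 + 2 * d / R * (a ^ 2 / S)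
      = Z * (4 * (1 - S / R) * (1 + 2 * a) + 2 * d * (S / R)) := by
    rw [hZ]; field_simp
  rw [m1] at h1
  rw [m2] at h2
  rw [m3] at h3
  have hSR1 : S / R ≤ 1 := (div_le_one hR).2 b3
  have hSR0 : 0 ≤ S / R := by positivity
  have k2l : 1 / 4 * Y ≤ Y * ((d / 2 - 5 / 4 : ℝ) + 4 * ((d / 2 - 5 / 4 : ℝ) * ((d / 2 - 5 / 4 : ℝ) + 1)) * (s ^ 2 / v)) := by
    rw [mul_comm]
    gcongr
    have : 0 ≤ 4 * ((d / 2 - 5 / 4 : ℝ) * ((d / 2 - 5 / 4 : ℝ) + 1)) * (s ^ 2 / v) :=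
      mul_nonneg (mul_nonneg (by norm_num) (mul_nonneg (by linarith) (by linarith))) hsv0
    linarith
  have k2u : Y * ((d / 2 - 5 / 4 : ℝ) + 4 * ((d / 2 - 5 / 4 : ℝ) * ((d / 2 - 5 / 4 : ℝ) + 1)) * (s ^ 2 / v))
      ≤ 2 * d ^ 2 * Y := by
    rw [mul_comm]
    gcongr
    have : 4 * ((d / 2 - 5 / 4 : ℝ) * ((d / 2 - 5 / 4 : ℝ) + 1)) * (s ^ 2 / v)
        ≤ 4 * ((d / 2 - 5 / 4 : ℝ) * ((d / 2 - 5 / 4 : ℝ) + 1)) :=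
      mul_le_of_le_one_right (mul_nonneg (by norm_num) (mul_nonneg (by linarith) (by linarith))) hsv
    linarith [sq_nonneg (d : ℝ)]
  have k3l : 4 * Z ≤ Z * (4 * (1 - S / R) * (1 + 2 * a) + 2 * d * (S / R)) := by
    rw [mul_comm]
    gcongr
    have : 0 ≤ 4 * (1 - S / R) * (2 * a) := mul_nonneg (by linarith) (by linarith)
    have : 2 * 3 * (S / R) ≤ 2 * d * (S / R) := by gcongr
    linarith
  have k3u : Z * (4 * (1 - S / R) * (1 + 2 * a) + 2 * d * (S / R)) ≤ 2 * d ^ 2 * Z := by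
    rw [mul_comm]
    gcongr
    have : (1 - S / R) * (1 + 2 * a) ≤ 1 * (1 + 2 * a) := by gcongr; linarith
    have : 2 * d * (S / R) ≤ 2 * d * 1 := by gcongr
    have : 3 * (d : ℝ) ≤ d ^ 2 := by rw [pow_two]; gcongr
    linarith
  obtain ⟨q1, q2⟩ := intFun_drift_arith hd' hX0 hY0 hZ0 hϱ hc h1 h2 h3 er1 er2 er3 k2l k2u k3l k3u
  have e : -(2 * d * (A1 - W)) - ϱ * (2 * d * (A2 - W')) + c * (2 * d * (A3 - a))
      = 2 * d * ((W + ϱ * W' + c * (2 - a)) - (A1 + ϱ * A2 + c * (2 - A3))) := by ring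
  rw [e] at q1 q2
  exact ⟨by linarith, le_of_mul_le_mul_left q2 (by linarith)⟩

end RWRE

/-! ### Local comparison and size of the interior function. -/

namespace RWRE

variable {d : ℕ}

theorem shiftSq_le_four {s : ℝ} {x z y : Lat d} (h : eNorm (z - x) ≤ s / 3) :
    shiftSq (s ^ 2) (emb y) z ≤ 4 * shiftSq (s ^ 2) (emb y) x := by
  have h1 : ‖emb z - emb y‖ ≤ s / 3 + ‖emb x - emb y‖ := by
    have := norm_sub_le_norm_sub_add_norm_sub (emb z) (emb x) (emb y)
    rw [eNorm_sub_eq] at h; linarith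
  have h2 := norm_nonneg (emb z - emb y)
  have h3 := norm_nonneg (emb x - emb y)
  rw [shiftSq, shiftSq]
  nlinarith [sq_nonneg (s / 3 - ‖emb x - emb y‖)]

/-- Displacements are limited both by s, which controls the powers of s² + |·-y|², and by the
distance to the sphere, which controls the logarithmic term; 36 = 2²·3² comes from the latter's
drift. -/
theorem intFun_local {κ R r s ϱ c : ℝ} {x y z : Lat d} (hd : 3 ≤ d) (hκ : 128 ≤ κ)
    (hr : 100 ≤ r) (hs : 0 < s) (hϱ : 0 ≤ ϱ) (hc : 0 ≤ c)
    (hx : eNorm x + Real.exp κ * r ≤ R) (hz : eNorm z + Real.exp κ * r ≤ R)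
    (hxz : eNorm (z - x) ≤ (R - eNorm x) / 3) (hxs : eNorm (z - x) ≤ s / 3) :
    intFun R r s ϱ c y x ≤ 36 * 4 ^ (d / 2 - 1 : ℝ) * intFun R r s ϱ c y z ∧
    intDrift R r s ϱ c y x ≤ 36 * 4 ^ (d / 2 - 1 : ℝ) * intDrift R r s ϱ c y z := by
  have hd' : (3 : ℝ) ≤ d := by exact_mod_cast hd
  have hexp := Real.add_one_le_exp κ
  have hr0 : 0 < r := by linarith
  have her : 0 < Real.exp κ * r := by positivity
  obtain ⟨s1, s2, s3, s4⟩ := near_bounds hκ hr hx hz hxz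
  have hSx : Real.exp κ * r ≤ bndS R (emb x) := by
    linarith [(bndS_bounds (R := R) (x := x) (by linarith)).1]
  have hSz : Real.exp κ * r ≤ bndS R (emb z) := by
    linarith [(bndS_bounds (R := R) (x := z) (by linarith)).1]
  have hlog : ∀ {S : ℝ}, Real.exp κ * r ≤ S → κ ≤ Real.log (S / r) := fun {S} hS => by
    rw [Real.le_log_iff_exp_le (by apply div_pos _ hr0; linarith), le_div_iff₀ hr0]; exact hS
  obtain ⟨ax, ax1⟩ := invLog_bounds hκ (hlog hSx)
  obtain ⟨az, az1⟩ := invLog_bounds hκ (hlog hSz)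
  have v1 := shiftSq_le_four (y := y) hxs
  have v2 := shiftSq_le_four (y := y) (x := z) (z := x) (by rwa [eNorm_sub_comm])
  have pos : ∀ w : Lat d, 0 < shiftSq (s ^ 2) (emb y) w := fun w => by
    rw [shiftSq]; positivity
  have hvx := pos x
  have hvz := pos z
  have w1 := rpow_neg_le_of_le_four_mul (α := (d / 2 - 1 : ℝ)) hvz v1 (by linarith)
  have w2 : shiftSq (s ^ 2) (emb y) x ^ (-(d / 2 - 5 / 4 : ℝ))
      ≤ 4 ^ (d / 2 - 1 : ℝ) * shiftSq (s ^ 2) (emb y) z ^ (-(d / 2 - 5 / 4 : ℝ)) :=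
    (rpow_neg_le_of_le_four_mul (α := (d / 2 - 5 / 4 : ℝ)) hvz v1 (by linarith)).trans <| by
      gcongr ?_ * _
      exact Real.rpow_le_rpow_of_exponent_le (by norm_num) (by linarith)
  have hC1 : (1 : ℝ) ≤ 4 ^ (d / 2 - 1 : ℝ) := Real.one_le_rpow (by norm_num) (by linarith)
  unfold intFun intDrift
  set vx := shiftSq (s ^ 2) (emb y) x
  set vz := shiftSq (s ^ 2) (emb y) z
  set Wx := vx ^ (-(d / 2 - 1 : ℝ))
  set Wz := vz ^ (-(d / 2 - 1 : ℝ))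
  set Ux := vx ^ (-(d / 2 - 5 / 4 : ℝ))
  set Uz := vz ^ (-(d / 2 - 5 / 4 : ℝ))
  have hWx : 0 < Wx := Real.rpow_pos_of_pos hvx _
  have hWz : 0 < Wz := Real.rpow_pos_of_pos hvz _
  have hUx : 0 < Ux := Real.rpow_pos_of_pos hvx _
  have hUz : 0 < Uz := Real.rpow_pos_of_pos hvz _
  set C : ℝ := 4 ^ (d / 2 - 1 : ℝ)
  have hSx0 : 0 < bndS R (emb x) := by linarith
  have hSz0 : 0 < bndS R (emb z) := by linarith
  set Sx := bndS R (emb x)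
  set Sz := bndS R (emb z)
  set lx := invLog r Sx
  set lz := invLog r Sz
  clear_value Wx Wz Ux Uz C vx vz Sx Sz lx lz
  constructor
  · have h1 : Wx ≤ 36 * C * Wz := by
      have : 0 < C * Wz := by positivity
      linarith
    have h2 : ϱ * Ux ≤ 36 * C * (ϱ * Uz) := by
      have h3 := mul_le_mul_of_nonneg_left w2 hϱ
      have : 0 ≤ ϱ * (C * Uz) := by positivity
      linarith
    have h3 : c * (2 - lx) ≤ 36 * C * (c * (2 - lz)) := by
      have h4 : c * (2 - lx) ≤ c * (2 * (2 - lz)) := by gcongr; linarith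
      have h5 : 0 ≤ c * (2 - lz) := mul_nonneg hc (by linarith)
      have h6 : 1 * (c * (2 - lz)) ≤ C * (c * (2 - lz)) := by gcongr
      linarith
    linarith
  · have h1 : Wx * (s ^ 2 / vx ^ 2) ≤ 36 * C * (Wz * (s ^ 2 / vz ^ 2)) := by
      have h4 : s ^ 2 / vx ^ 2 ≤ 36 * (s ^ 2 / vz ^ 2) := by
        rw [← mul_div_assoc, div_le_div_iff₀ (by positivity) (by positivity)]
        have : vz ^ 2 ≤ (4 * vx) ^ 2 := by gcongr
        have h5 : vz ^ 2 ≤ 36 * vx ^ 2 := by linarith [sq_nonneg vx]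
        have := mul_le_mul_of_nonneg_left h5 (sq_nonneg s)
        linarith
      calc _ ≤ C * Wz * (36 * (s ^ 2 / vz ^ 2)) := by gcongr
        _ = _ := by ring
    have h2 : ϱ * (Ux / vx) ≤ 36 * C * (ϱ * (Uz / vz)) := by
      have h4 : 1 / vx ≤ 36 * (1 / vz) := by
        rw [← mul_div_assoc, div_le_div_iff₀ (by positivity) (by positivity)]
        linarith
      calc ϱ * (Ux / vx) = ϱ * (Ux * (1 / vx)) := by ring
        _ ≤ ϱ * (C * Uz * (36 * (1 / vz))) := by gcongr
        _ = _ := by ring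
    have h3 : c * (lx ^ 2 / Sx ^ 2) ≤ 36 * C * (c * (lz ^ 2 / Sz ^ 2)) := by
      have h4 : lx ^ 2 / Sx ^ 2 ≤ 36 * (lz ^ 2 / Sz ^ 2) := by
        rw [← mul_div_assoc, div_le_div_iff₀ (by positivity) (by positivity)]
        calc lx ^ 2 * Sz ^ 2 ≤ (2 * lz) ^ 2 * (3 * Sx) ^ 2 := by gcongr
          _ = _ := by ring
      calc _ ≤ c * (36 * (lz ^ 2 / Sz ^ 2)) := by gcongr
        _ = 36 * 1 * (c * (lz ^ 2 / Sz ^ 2)) := by ring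
        _ ≤ _ := by gcongr
    linarith

/-- Term by term: the first two because m² ≤ s² ≤ v, the third because m ≤ S and the inverse
logarithm is at most 1. -/
theorem sq_mul_intDrift_le {κ R r s ϱ c m : ℝ} {x y : Lat d} (hκ : 128 ≤ κ)
    (hr : 100 ≤ r) (hs : 0 < s) (hϱ : 0 ≤ ϱ) (hc : 0 ≤ c)
    (hx : eNorm x + Real.exp κ * r ≤ R) (hm : 0 ≤ m) (hms : m ≤ s) (hmx : m ≤ R - eNorm x) :
    m ^ 2 * intDrift R r s ϱ c y x ≤ intFun R r s ϱ c y x := by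
  have hr0 : 0 < r := by linarith
  have her : 0 < Real.exp κ * r := by positivity
  have hSx := (bndS_bounds (R := R) (x := x) (by linarith)).1
  have hlog : κ ≤ Real.log (bndS R (emb x) / r) := by
    rw [Real.le_log_iff_exp_le (by apply div_pos _ hr0; linarith), le_div_iff₀ hr0]; linarith
  obtain ⟨ax, ax1⟩ := invLog_bounds hκ hlog
  have hvx : 0 < shiftSq (s ^ 2) (emb y) x := by rw [shiftSq]; positivity
  have hsv : s ^ 2 ≤ shiftSq (s ^ 2) (emb y) x := by
    rw [shiftSq]; linarith [sq_nonneg ‖emb x - emb y‖]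
  unfold intFun intDrift
  set vx := shiftSq (s ^ 2) (emb y) x
  have hWx : 0 < vx ^ (-(d / 2 - 1 : ℝ)) := Real.rpow_pos_of_pos hvx _
  have hUx : 0 < vx ^ (-(d / 2 - 5 / 4 : ℝ)) := Real.rpow_pos_of_pos hvx _
  set Wx := vx ^ (-(d / 2 - 1 : ℝ))
  set Ux := vx ^ (-(d / 2 - 5 / 4 : ℝ))
  have hS0 : 0 < bndS R (emb x) := by linarith
  set S := bndS R (emb x)
  set l := invLog r S
  have hmv : m ^ 2 ≤ vx := (pow_le_pow_left₀ hm hms 2).trans hsv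
  have h1 : m ^ 2 * (Wx * (s ^ 2 / vx ^ 2)) ≤ Wx := by
    have : m ^ 2 * s ^ 2 / vx ^ 2 ≤ 1 := by
      rw [div_le_one (by positivity), pow_two vx]
      exact mul_le_mul hmv hsv (sq_nonneg _) hvx.le
    calc _ = Wx * (m ^ 2 * s ^ 2 / vx ^ 2) := by ring
      _ ≤ Wx * 1 := by gcongr
      _ = _ := mul_one _
  have h2 : m ^ 2 * (ϱ * (Ux / vx)) ≤ ϱ * Ux := by
    have : m ^ 2 / vx ≤ 1 := (div_le_one hvx).2 hmv
    calc _ = ϱ * Ux * (m ^ 2 / vx) := by ring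
      _ ≤ ϱ * Ux * 1 := by gcongr
      _ = _ := mul_one _
  have h3 : m ^ 2 * (c * (l ^ 2 / S ^ 2)) ≤ c * (2 - l) := by
    have h4 : m ^ 2 / S ^ 2 ≤ 1 := (div_le_one (by positivity)).2 (pow_le_pow_left₀ hm (by linarith) 2)
    have h5 : l ^ 2 ≤ 1 := pow_le_one₀ ax.le (by linarith)
    calc _ = c * (m ^ 2 / S ^ 2 * l ^ 2) := by ring
      _ ≤ c * (1 * 1) := by gcongr
      _ ≤ _ := by gcongr; linarith
  linarith

end RWRE

namespace RWRE

variable {d : ℕ}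

/-! ### Comparison of the scales -/

/-- `L` is large, in terms of `M`. -/
structure LargeScale (M L : ℝ) : Prop where
  log_le : M ≤ Real.log L
  pow_le : M * Real.log L ^ 20 ≤ L

theorem exists_largeScale (M : ℝ) : ∃ L₀ : ℝ, 0 < L₀ ∧ ∀ L, L₀ ≤ L → LargeScale M L := by
  have h1 := Real.tendsto_log_atTop.eventually_ge_atTop M
  have h2 := (Real.isLittleO_pow_log_id_atTop (n := 20)).bound
    (show (0 : ℝ) < 1 / (|M| + 1) by positivity)
  obtain ⟨L₀, h⟩ := Filter.eventually_atTop.1 (h1.and h2)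
  refine ⟨max L₀ 1, by positivity, fun L hL => ?_⟩
  obtain ⟨a, b⟩ := h L ((le_max_left _ _).trans hL)
  have hL1 : 1 ≤ L := (le_max_right _ _).trans hL
  refine ⟨a, ?_⟩
  rw [id, Real.norm_of_nonneg (by linarith : 0 ≤ L), one_div, inv_mul_eq_div,
    le_div_iff₀ (by positivity)] at b
  have h3 : ‖Real.log L ^ 20‖ = Real.log L ^ 20 :=
    Real.norm_of_nonneg (pow_nonneg (Real.log_nonneg hL1) _)
  rw [h3] at b
  have h4 : 0 ≤ Real.log L ^ 20 := pow_nonneg (Real.log_nonneg hL1) _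
  nlinarith [le_abs_self M]

namespace LargeScale

variable {M L : ℝ} (H : LargeScale M L)
include H

theorem mono {M' : ℝ} (h : M' ≤ M) (hM : 1 ≤ M) : LargeScale M' L :=
  ⟨h.trans H.log_le, (mul_le_mul_of_nonneg_right h
    (pow_nonneg (by linarith [H.log_le]) _)).trans H.pow_le⟩

theorem pow_log_le (hM : 1 ≤ M) {k : ℕ} (hk : k ≤ 20) : M * Real.log L ^ k ≤ L :=
  (mul_le_mul_of_nonneg_left (pow_le_pow_right₀ (hM.trans H.log_le) hk) (by linarith)).trans
    H.pow_le

theorem pos (hM : 1 ≤ M) : 0 < L := by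
  have := H.pow_log_le hM (k := 0) (by norm_num)
  rw [pow_zero] at this; linarith

theorem log_pos (hM : 1 ≤ M) : 0 < Real.log L := by linarith [H.log_le]

theorem le_sScale (hM : 1 ≤ M) : M ≤ sScale L := by
  have := H.log_pos hM
  rw [sScale, le_div_iff₀ (by positivity)]
  exact H.pow_log_le hM (by norm_num)

theorem mul_sScale_le (hM : 1 ≤ M) : M * sScale L ≤ L := by
  have h0 := H.log_pos hM
  have h1 := H.pos hM
  rw [sScale, ← mul_div_assoc, div_le_iff₀ (by positivity), mul_comm]
  have : M ≤ Real.log L ^ 3 := H.log_le.trans (le_self_pow₀ (hM.trans H.log_le) (by norm_num))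
  gcongr

theorem mul_le_sScale (hM : 1 ≤ M) {r : ℝ} (hr : r ≤ rScale L) : M * r ≤ sScale L := by
  have h0 := H.log_pos hM
  have h1 := H.pos hM
  have h2 : M ≤ Real.log L ^ 12 := H.log_le.trans (le_self_pow₀ (hM.trans H.log_le) (by norm_num))
  calc M * r ≤ Real.log L ^ 12 * rScale L := by
        have : 0 ≤ rScale L := by rw [rScale]; positivity
        calc M * r ≤ M * rScale L := by gcongr
          _ ≤ _ := by gcongr
    _ = sScale L := by rw [rScale, sScale]; field_simp

theorem mul_le (hM : 1 ≤ M) {r : ℝ} (hr : r ≤ rScale L) : M * r ≤ L := by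
  have h1 := H.mul_le_sScale hM hr
  have h2 := H.mul_sScale_le hM
  have h3 : 0 ≤ sScale L := by linarith [H.le_sScale hM]
  nlinarith

/-- `s_L` is much larger than the cube root of `L`. -/
theorem le_inv_sqrt_mul (hM : 2 ≤ M) {R : ℝ} (hR : 0 < R) (hRL : R ≤ 2 * L) :
    M ≤ (√R)⁻¹ * (sScale L * √(sScale L)) := by
  have h0 := H.log_pos (by linarith)
  have h1 := H.pos (by linarith)
  have hs : 0 < sScale L := by linarith [H.le_sScale (by linarith)]
  rw [inv_mul_eq_div, le_div_iff₀ (Real.sqrt_pos.2 hR)]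
  have h3 : sScale L = √(sScale L ^ 2) := (Real.sqrt_sq hs.le).symm
  have e : sScale L * √(sScale L) = √(sScale L ^ 2 * sScale L) := by
    rw [Real.sqrt_mul (sq_nonneg _), ← h3]
  rw [e]
  refine Real.le_sqrt_of_sq_le ?_
  rw [mul_pow, Real.sq_sqrt hR.le]
  have h2 := H.pow_log_le (by linarith) (k := 9) (by norm_num)
  have h4 : sScale L ^ 2 * sScale L = L ^ 3 / Real.log L ^ 9 := by
    rw [sScale]; field_simp
  rw [h4, le_div_iff₀ (by positivity)]
  have h5 : 1 ≤ Real.log L ^ 9 := one_le_pow₀ (by linarith [H.log_le])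
  calc M ^ 2 * R * Real.log L ^ 9 ≤ M ^ 2 * (2 * L) * Real.log L ^ 9 := by gcongr
    _ = 2 * L * M * (M * Real.log L ^ 9) := by ring
    _ ≤ 2 * L * M * L := by gcongr
    _ = L ^ 2 * (2 * M) := by ring
    _ ≤ L ^ 2 * L := by
      gcongr
      have : M * M ≤ L := by
        have h6 := H.pow_log_le (by linarith) (k := 1) (by norm_num)
        rw [pow_one] at h6
        exact (mul_le_mul_of_nonneg_left H.log_le (by linarith)).trans h6
      nlinarith
    _ = L ^ 3 := by ring

/-- (s_L/40)² = L²/(1600 (log L)⁶) ≥ L. -/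
theorem half_log_le (hM : 1600 ≤ M) {m : ℝ} (hm : sScale L / 40 ≤ m) :
    Real.log L / 2 ≤ Real.log m := by
  have h0 := H.log_pos (by linarith)
  have h1 := H.pos (by linarith)
  have hs : 0 < sScale L := by linarith [H.le_sScale (by linarith)]
  have hm0 : 0 < m := by linarith
  have h2 : L ≤ m ^ 2 := by
    have h3 : (sScale L / 40) ^ 2 ≤ m ^ 2 := by gcongr
    refine le_trans ?_ h3
    have e : (sScale L / 40) ^ 2 = L * L / (1600 * Real.log L ^ 6) := by
      rw [sScale]; field_simp; norm_num
    rw [e, le_div_iff₀ (by positivity)]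
    have h4 := H.pow_log_le (by linarith) (k := 6) (by norm_num)
    have : 1600 * Real.log L ^ 6 ≤ L := le_trans (by gcongr) h4
    gcongr
  have h5 := Real.log_le_log h1 h2
  rw [Real.log_pow] at h5
  push_cast at h5
  linarith

/-- Power counting: (R/s_L)² costs (log L)⁶ while (log m)⁹ ≥ (log L/2)⁹, so (log L)³ is left over to
beat η. -/
theorem mul_sq_le (hM : 2048 ≤ M) {η R m : ℝ} (hη : 0 ≤ η) (hηM : 2048 * η ≤ M) (hR : 0 ≤ R)
    (hRL : R ≤ 2 * L) (hm : sScale L / 40 ≤ m) : η * R ^ 2 ≤ sScale L ^ 2 * Real.log m ^ 9 := by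
  have h0 := H.log_pos (by linarith)
  have h1 := H.pos (by linarith)
  have h2 := H.half_log_le (by linarith) hm
  have h3 : (Real.log L / 2) ^ 9 ≤ Real.log m ^ 9 := by gcongr
  calc η * R ^ 2 ≤ η * (2 * L) ^ 2 := by gcongr
    _ = L ^ 2 * (4 * η) := by ring
    _ ≤ L ^ 2 * (Real.log L ^ 3 / 512) := by
      gcongr
      have : Real.log L ≤ Real.log L ^ 3 := le_self_pow₀ (by linarith [H.log_le]) (by norm_num)
      linarith [H.log_le]
    _ = sScale L ^ 2 * (Real.log L / 2) ^ 9 := by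
      rw [sScale]; field_simp; norm_num
    _ ≤ _ := by gcongr

end LargeScale

/-- Away from the boundary, the smoothing error is negligible against the drift. -/
theorem exists_inv_log_pow_le {A η : ℝ} (hA : 1 ≤ A) (hη : 0 < η) : ∃ K₀ M₀ : ℝ, 2 ≤ K₀ ∧ 1 ≤ M₀ ∧
    ∀ {h : ℝ → ℝ} {K L r : ℝ} {x : Lat d}, IsCGProfile h → K₀ ≤ K → LargeScale M₀ L → 100 ≤ r →
      r ≤ rScale L → K * r < bdist L x →
      2 * (Real.log (hField h L r x) ^ 9)⁻¹ ≤ η * (hField h L r x ^ 2 *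
        (invLog r (bndS (L + A * r) (emb x)) ^ 2 / bndS (L + A * r) (emb x) ^ 2)) := by
  refine ⟨max (max 80 A) (Real.exp (51200 / η + 1)), max 2048 (max A (32 * 819200 / η)), ?_, ?_, ?_⟩
  · exact le_max_of_le_left (le_max_of_le_left (by norm_num))
  · exact le_max_of_le_left (by norm_num)
  intro h K L r x hh hK H hr hrL hx
  have hK1 : 80 ≤ K := ((le_max_left _ _).trans (le_max_left _ _)).trans hK
  have hK2 : A ≤ K := ((le_max_right _ _).trans (le_max_left _ _)).trans hK
  have hK3 : Real.exp (51200 / η + 1) ≤ K := (le_max_right _ _).trans hK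
  set M := max 2048 (max A (32 * 819200 / η))
  have hM1 : 2048 ≤ M := le_max_left _ _
  have hM2 : A ≤ M := (le_max_left _ _).trans (le_max_right _ _)
  have hM3 : 32 * 819200 / η ≤ M := (le_max_right _ _).trans (le_max_right _ _)
  have hr0 : 0 < r := by linarith
  have hL := H.pos (by linarith)
  have hl := H.log_pos (by linarith)
  have hs : 0 < sScale L := by linarith [H.le_sScale (by linarith)]
  have hAr : A * r ≤ L :=
    (mul_le_mul_of_nonneg_right hM2 hr0.le).trans (H.mul_le (by linarith) hrL)
  have hMr : r ≤ sScale L := by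
    have := H.mul_le_sScale (by linarith) hrL; nlinarith
  have hb : bdist L x = L - eNorm x := rfl
  have h0 := eNorm_nonneg x
  have hAr0 : 0 < A * r := by positivity
  have hKr : A * r ≤ K * r := by gcongr
  have hrA : r ≤ A * r := le_mul_of_one_le_left hr0.le hA
  obtain ⟨b1, b2, b3⟩ := bndS_bounds (R := L + A * r) (x := x) (by linarith)
  set S := bndS (L + A * r) (emb x)
  have hS4 : S ≤ 4 * bdist L x := by linarith
  have hS0 : 0 < S := by linarith
  set τ := Real.log (S / r) with hτ
  have hτ1 : 0 < τ := by
    apply Real.log_pos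
    rw [lt_div_iff₀ hr0]; nlinarith
  have hτ2 : τ ≤ Real.log S := by
    apply Real.log_le_log (by positivity)
    exact div_le_self hS0.le (by linarith)
  have hm0 := hField_pos (h := h) (L := L) hr0 x
  set m := hField h L r x
  have hlow := le_hField hh hs (r := r) hr0.le x
  suffices hmain : 0 < Real.log m ∧ 2 * (τ ^ 2 * S ^ 2) ≤ η * m ^ 2 * Real.log m ^ 9 by
    obtain ⟨p1, p2⟩ := hmain
    have e : η * (m ^ 2 * (invLog r S ^ 2 / S ^ 2)) = η * m ^ 2 / (τ ^ 2 * S ^ 2) := by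
      rw [invLog, ← hτ]; field_simp
    rw [e, ← div_eq_mul_inv, div_le_div_iff₀ (by positivity) (by positivity)]
    exact p2
  -- For d_L(x) ≤ s_L/2 the step m is comparable to S, log(S/r) ≤ 2 log m, and seven powers of log m
  -- ≥ log K are left over. Deeper inside, m is only of order s_L: the quotient (S/m)² costs (log
  -- L)⁶ and log(S/r)² two more powers, leaving one of the nine, which a large L provides.
  rcases le_total (bdist L x) (sScale L / 2) with hc | hc
  · rw [min_eq_left hc] at hlow
    have hS80 : S ≤ 80 * m := by linarith
    have hmK : K ≤ m := by nlinarith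
    have hlm : 51200 / η + 1 ≤ Real.log m := by
      rw [Real.le_log_iff_exp_le hm0]; linarith
    have hq : 0 < 51200 / η := by positivity
    have hτ3 : τ ≤ 2 * Real.log m := by
      have h1 : Real.log S ≤ Real.log (80 * m) := Real.log_le_log hS0 hS80
      rw [Real.log_mul (by norm_num) hm0.ne'] at h1
      have h2 : Real.log 80 ≤ Real.log m := Real.log_le_log (by norm_num) (by linarith)
      linarith
    refine ⟨by linarith, ?_⟩
    have h7 : 51200 ≤ η * Real.log m ^ 7 := by
      have h8 : 51200 / η ≤ Real.log m ^ 7 :=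
        le_trans (by linarith) (le_self_pow₀ (by linarith : 1 ≤ Real.log m) (by norm_num))
      rw [div_le_iff₀ hη] at h8; linarith
    calc 2 * (τ ^ 2 * S ^ 2) ≤ 2 * ((2 * Real.log m) ^ 2 * (80 * m) ^ 2) := by gcongr
      _ = m ^ 2 * Real.log m ^ 2 * 51200 := by ring
      _ ≤ m ^ 2 * Real.log m ^ 2 * (η * Real.log m ^ 7) := by gcongr
      _ = _ := by ring
  · have hm : sScale L / 40 ≤ m := by
      have : sScale L / 2 ≤ min (bdist L x) (sScale L / 2) := le_min hc le_rfl
      linarith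
    have hlm := H.half_log_le (by linarith) hm
    refine ⟨by linarith, ?_⟩
    have hS2 : S ≤ 2 * L := by linarith
    have hτ3 : τ ≤ 2 * Real.log L := by
      have h1 : Real.log S ≤ Real.log (2 * L) := Real.log_le_log hS0 hS2
      rw [Real.log_mul (by norm_num) hL.ne'] at h1
      have h2 : Real.log 2 ≤ 1 := by
        have := Real.log_le_sub_one_of_pos (show (0 : ℝ) < 2 by norm_num); linarith
      linarith [H.log_le]
    have h8 : 32 * 819200 ≤ η * Real.log L := by
      have := hM3.trans H.log_le
      rw [div_le_iff₀ hη] at this; linarith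
    calc 2 * (τ ^ 2 * S ^ 2) ≤ 2 * ((2 * Real.log L) ^ 2 * (2 * L) ^ 2) := by gcongr
      _ = L ^ 2 * Real.log L ^ 2 * (32 * 819200) / 819200 := by ring
      _ ≤ L ^ 2 * Real.log L ^ 2 * (η * Real.log L) / 819200 := by gcongr
      _ = η * (sScale L / 40) ^ 2 * (Real.log L / 2) ^ 9 := by
        rw [sScale]; field_simp; norm_num
      _ ≤ _ := by gcongr

/-- Near the boundary, the drift is bounded below. -/
theorem le_drift_near {h : ℝ → ℝ} {A K η δ L r : ℝ} {x : Lat d} (hA : 1 ≤ A) (hK : 0 ≤ K)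
    (hη : 0 ≤ η) (hδ : 0 ≤ δ) (hδK : 800 * (2 * (A + K)) ^ 4 * δ ≤ η) (hr : 100 ≤ r)
    (hx : eNorm x ≤ L) (hxK : bdist L x ≤ K * r)
    (hlog : 1 ≤ Real.log (bndS (L + A * r) (emb x) / r)) :
    δ * 2 ≤ η * (hField h L r x ^ 2 *
        (invLog r (bndS (L + A * r) (emb x)) ^ 2 / bndS (L + A * r) (emb x) ^ 2)) := by
  have hr0 : 0 < r := by linarith
  have hb : bdist L x = L - eNorm x := rfl
  have hAr : 0 < A * r := by positivity
  obtain ⟨b1, b2, b3⟩ := bndS_bounds (R := L + A * r) (x := x) (by linarith)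
  set S := bndS (L + A * r) (emb x)
  have hS0 : 0 < S := by linarith
  set τ := Real.log (S / r) with hτ
  -- In the layer of width Kr, S and log(S/r) are bounded multiples of r and of 1, while h ≥ r/20;
  -- hence the factor 800 = 2·20².
  have hSr : S / r ≤ 2 * (A + K) := by
    rw [div_le_iff₀ hr0]; linarith
  have hSr0 : 0 < S / r := by positivity
  have hτ1 : τ ≤ 2 * (A + K) := by
    have := Real.log_le_sub_one_of_pos hSr0
    linarith
  have hm := le_hField_of_radius (h := h) (L := L) (r := r) x
  set m := hField h L r x
  have e : η * (m ^ 2 * (invLog r S ^ 2 / S ^ 2)) = η * m ^ 2 / (τ ^ 2 * S ^ 2) := by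
    rw [invLog, ← hτ]
    have : τ ≠ 0 := by linarith
    field_simp
  have hτ0 : 0 < τ := by linarith
  rw [e, le_div_iff₀ (by positivity)]
  calc δ * 2 * (τ ^ 2 * S ^ 2) = δ * 2 * (τ ^ 2 * ((S / r) ^ 2 * r ^ 2)) := by
        rw [div_pow, div_mul_cancel₀ _ (by positivity)]
    _ ≤ δ * 2 * ((2 * (A + K)) ^ 2 * ((2 * (A + K)) ^ 2 * r ^ 2)) := by gcongr
    _ = 800 * (2 * (A + K)) ^ 4 * δ * (r / 20) ^ 2 := by ring
    _ ≤ η * m ^ 2 := by gcongr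

end RWRE

namespace RWRE

variable {d : ℕ}

/-! ### Supersolutions for the goodified kernel -/

theorem bdryDrift_nonneg {R r : ℝ} {ζ : EuclideanSpace ℝ (Fin d)} {z : Lat d} (hR : 0 < R)
    (hζ : R ≤ ‖ζ‖) (hz : eNorm z < R) : 0 ≤ bdryDrift R r ζ z := by
  have hS := (bndS_bounds hz).1
  have hS0 : 0 < bndS R (emb z) := by linarith
  have hv : 0 ≤ shiftSq 0 ζ z := by rw [shiftSq]; positivity
  have hσ : 0 ≤ (‖ζ‖ ^ 2 - R ^ 2) / R := div_nonneg (by nlinarith) hR.le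
  exact mul_nonneg (Real.rpow_nonneg hv _) (by positivity)

theorem near_symm {R s : ℝ} {x z : Lat d} (hxz : eNorm (z - x) ≤ min (R - eNorm x) s / 4) :
    eNorm (z - x) ≤ (R - eNorm x) / 3 ∧ eNorm (x - z) ≤ (R - eNorm z) / 3 ∧
      eNorm (z - x) ≤ s / 3 ∧ eNorm (x - z) ≤ s / 3 := by
  have h1 := min_le_left (R - eNorm x) s
  have h2 := min_le_right (R - eNorm x) s
  have h3 := eNorm_nonneg (z - x)
  have h4 := eNorm_le_add z x
  rw [eNorm_sub_comm x z]
  refine ⟨by linarith, by linarith, by linarith, by linarith⟩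

/-- The constants in the drift inequality for the goodified kernel. -/
theorem small_constants {C η δ : ℝ} (hC : 1 ≤ C) (hη : η = 1 / (4 * C ^ 3))
    (hδ : δ ≤ 1 / (100 * C ^ 4)) : C * η + 25 * C ^ 2 * δ ≤ 1 / (2 * C ^ 2) := by
  have h1 : C * η = 1 / 4 * (1 / C ^ 2) := by rw [hη]; field_simp
  have h2 : 25 * C ^ 2 * δ ≤ 25 * C ^ 2 * (1 / (100 * C ^ 4)) := by gcongr
  have h3 : 25 * C ^ 2 * (1 / (100 * C ^ 4)) = 1 / 4 * (1 / C ^ 2) := by field_simp; norm_num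
  have h4 : 1 / (2 * C ^ 2) = 1 / 2 * (1 / C ^ 2) := by field_simp
  rw [h1, h4]; linarith

open Classical in
-- Checks the hypotheses of `tildeGood_drift` for the boundary function. The order of choices
-- matters: κ, then C and η, then K from the estimate away from the boundary, and only then δ₀,
-- which must be small relative to K. The margin e^κ r in R keeps log(S/r) ≥ κ at every point
-- reached from V_{L+r}.
theorem goodified_bdry [NeZero d] (hd : 3 ≤ d) : ∃ κ₀ : ℝ, 128 ≤ κ₀ ∧ Real.log (36 * d) ≤ κ₀ ∧
    ∀ κ, κ₀ ≤ κ → ∃ C δ₀ M : ℝ, 1 ≤ C ∧ 0 < δ₀ ∧ 1 ≤ M ∧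
    ∀ {φ h : ℝ → ℝ} {L r R δ : ℝ} {ω : Env d} {ζ : EuclideanSpace ℝ (Fin d)} {x : Lat d},
    IsCGDensity φ → IsCGProfile h → LargeScale M L → 100 ≤ r → r ≤ rScale L → 0 ≤ δ → δ ≤ δ₀ →
    R = L + (Real.exp κ + 2) * r → R ≤ ‖ζ‖ → ‖ζ‖ ≤ 2 * R → x ∈ ball0 d (L + r) →
    ∑' z, tildeGood φ h L r δ ω x z *
        (if z ∈ ball0 d (L + r) then ENNReal.ofReal (bdryFun R r ζ z) else 0)
      + ENNReal.ofReal (hField h L r x ^ 2 * bdryDrift R r ζ x / C)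
      ≤ ENNReal.ofReal (bdryFun R r ζ x) := by
  obtain ⟨κ₀, hκ1, hκ2, H⟩ := bdryFun_drift (d := d) hd
  refine ⟨κ₀, hκ1, hκ2, fun κ hκ => ?_⟩
  have hd' : (3 : ℝ) ≤ d := by exact_mod_cast hd
  have hp : (0 : ℝ) < 4 ^ (d / 2 : ℝ) := by positivity
  set C : ℝ := 1000 * d + 12 * 4 ^ (d / 2 : ℝ) with hC
  have hC1 : 1 ≤ C := by linarith
  set η : ℝ := 1 / (4 * C ^ 3) with hη
  have hη0 : 0 < η := by positivity
  have hexp := Real.add_one_le_exp κ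
  set A : ℝ := Real.exp κ + 2 with hA
  obtain ⟨K, M₀, hK, hM₀, N⟩ := exists_inv_log_pow_le (d := d) (A := A) (by linarith) hη0
  refine ⟨2 * C ^ 2, min (1 / (100 * C ^ 4)) (η / (800 * (2 * (A + K)) ^ 4)), M₀, by nlinarith,
    by positivity, hM₀, ?_⟩
  intro φ h L r R δ ω ζ x hφ hh hL hr hrL hδ hδ₀ hR hζ hζ' hx
  have hr0 : 0 < r := by linarith
  have hrs : r ≤ sScale L := by
    have := hL.mul_le_sScale hM₀ hrL; nlinarith
  have hL0 := hL.pos hM₀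
  have hAr : 131 * r ≤ A * r := by gcongr; linarith
  have hAe : A * r = Real.exp κ * r + 2 * r := by rw [hA]; ring
  have hrange : ∀ {z : Lat d}, eNorm z ≤ L + r + 1 → eNorm z + Real.exp κ * r ≤ R := fun hz => by
    linarith
  have her : 0 < Real.exp κ * r := by positivity
  have hR0 : 0 < R := by linarith
  have hκ1' : 128 ≤ κ := hκ1.trans hκ
  have hκ2' := hκ2.trans hκ
  have hsz : ∀ {z : Lat d}, eNorm z ≤ L + r + 1 → _ := fun hz =>
    bdryFun_size (by omega) hκ1' hκ2' hr hζ hζ' (hrange hz)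
  have hpt : ∀ {z : Lat d}, eNorm z ≤ L + r + 1 → _ := fun hz =>
    bdryPoint (by omega) hκ1' hκ2' hr hζ hζ' (hrange hz)
  have hW : ∀ {z : Lat d}, eNorm z ≤ L + r + 1 → 0 < shiftSq 0 ζ z ^ (-(d / 2 : ℝ)) := fun hz => by
    have h1 := (hpt hz).hSv
    have h2 := (hpt hz).hS
    exact Real.rpow_pos_of_pos (by nlinarith) _
  have hf0 : ∀ z : Lat d, eNorm z ≤ L + r + 1 → 0 ≤ bdryFun R r ζ z := fun z hz => by
    refine le_trans ?_ (hsz hz).1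
    have := mul_pos (hW hz) (hpt hz).hS
    linarith
  have hμ0 : ∀ z : Lat d, eNorm z ≤ L + r + 1 → 0 ≤ bdryDrift R r ζ z := fun z hz =>
    bdryDrift_nonneg hR0 hζ (by linarith [hrange hz])
  have hlocal : ∀ x z : Lat d, eNorm x ≤ L + r + 1 → eNorm z ≤ L + r + 1 →
      eNorm (z - x) ≤ (R - eNorm x) / 3 →
      bdryFun R r ζ x ≤ C * bdryFun R r ζ z ∧ bdryDrift R r ζ x ≤ C * bdryDrift R r ζ z := by
    intro x z h1 h2 h3
    obtain ⟨q1, q2⟩ := bdryFun_local (by omega) hκ1' hκ2' hr hζ hζ' (hrange h1) (hrange h2) h3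
    refine ⟨q1.trans ?_, q2.trans ?_⟩
    · exact mul_le_mul_of_nonneg_right (by linarith) (hf0 z h2)
    · exact mul_le_mul_of_nonneg_right (by linarith) (hμ0 z h2)
  -- The function is at most 2WS and its drift at least W·invLog²/S, with W = |z-ζ|^{-d}. After
  -- dividing by WS the requirement no longer involves ζ.
  have hdrift : ∀ {z : Lat d} {t : ℝ}, eNorm z ≤ L + r + 1 → 0 ≤ t →
      t * 2 ≤ η * (hField h L r z ^ 2 * (invLog r (bndS R (emb z)) ^ 2 / bndS R (emb z) ^ 2)) →
      t * bdryFun R r ζ z ≤ η * (hField h L r z ^ 2 * bdryDrift R r ζ z) := by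
    intro z t hz ht h1
    have hS := (hpt hz).hS
    have hWz := hW hz
    have hσ := (hpt hz).hσ
    calc t * bdryFun R r ζ z ≤ t * (2 * (shiftSq 0 ζ z ^ (-(d / 2 : ℝ)) * bndS R (emb z))) :=
          mul_le_mul_of_nonneg_left (hsz hz).2.1 ht
      _ = shiftSq 0 ζ z ^ (-(d / 2 : ℝ)) * bndS R (emb z) * (t * 2) := by ring
      _ ≤ shiftSq 0 ζ z ^ (-(d / 2 : ℝ)) * bndS R (emb z) * (η * (hField h L r z ^ 2 *
          (invLog r (bndS R (emb z)) ^ 2 / bndS R (emb z) ^ 2))) := by gcongr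
      _ = η * (hField h L r z ^ 2 * (shiftSq 0 ζ z ^ (-(d / 2 : ℝ)) *
          (invLog r (bndS R (emb z)) ^ 2 / bndS R (emb z)))) := by field_simp
      _ ≤ _ := by
        unfold bdryDrift
        gcongr
        have : 0 ≤ (‖ζ‖ ^ 2 - R ^ 2) / R / shiftSq 0 ζ z :=
          div_nonneg hσ (by rw [shiftSq]; positivity)
        linarith
  refine tildeGood_drift hφ hh hr hrs (R := R) (K := K) (η := η) (by linarith) hC1 hδ hK
    (small_constants hC1 hη (hδ₀.trans (min_le_left _ _))) hf0 hμ0 ?_ ?_ ?_ ?_ ?_ ?_ ω hx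
  · intro z hz
    obtain ⟨q1, -⟩ := H κ R r ζ z hκ hr hζ hζ' (hrange (by linarith))
    have := hμ0 z (by linarith)
    have h5 : 0 ≤ bdryFun R r ζ z - avg (bdryFun R r ζ) z := by
      by_contra hn
      push Not at hn
      have := mul_neg_of_pos_of_neg (show (0 : ℝ) < 1000 * d by linarith) hn
      linarith
    exact q1.trans (mul_le_mul_of_nonneg_right (by linarith) h5)
  · intro z hz
    obtain ⟨-, q2⟩ := H κ R r ζ z hκ hr hζ hζ' (hrange (by linarith))
    exact q2.trans (mul_le_mul_of_nonneg_right (by linarith) (hμ0 z (by linarith)))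
  · intro x z h1 h2 h3
    obtain ⟨n1, n2, -, -⟩ := near_symm h3
    exact ⟨hlocal x z (by linarith) h2 n1, hlocal z x h2 (by linarith) n2⟩
  · intro z hz
    have h1 := hField_le_range hh hr hrs (R := R) (by linarith) hz
    have h2 := hField_pos (h := h) (L := L) hr0 z
    obtain ⟨b1, -, -⟩ := bndS_bounds (R := R) (x := z) (by linarith)
    have h3 := min_le_left (R - eNorm z) (sScale L)
    have h4 : hField h L r z ≤ bndS R (emb z) := by linarith
    obtain ⟨z1, -, z3⟩ := hsz (z := z) (by linarith)
    have h5 : hField h L r z ^ 2 * bdryDrift R r ζ z ≤ bndS R (emb z) ^ 2 * bdryDrift R r ζ z := by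
      have := hμ0 z (by linarith)
      gcongr
    have h6 := hf0 z (by linarith)
    have h7 : 14 * bdryFun R r ζ z ≤ C * bdryFun R r ζ z := by gcongr; linarith
    linarith
  · intro z hz hzK
    refine hdrift (by linarith) hδ ?_
    rw [hR]
    have hk := (hpt (z := z) (by linarith)).hlog
    rw [hR] at hk
    refine le_drift_near (by linarith) (by linarith) hη0.le hδ ?_ hr hz hzK (by linarith)
    have := hδ₀.trans (min_le_right _ _)
    rwa [le_div_iff₀ (by positivity), mul_comm] at this
  · intro z hz
    have hz' : eNorm z ≤ L := by
      have : 0 ≤ K * r := by positivity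
      have hb : bdist L z = L - eNorm z := rfl
      linarith
    have h1 := N (h := h) hh le_rfl hL hr hrL hz
    rw [← hR, mul_comm] at h1
    have h2 : 0 ≤ (Real.log (hField h L r z) ^ 9)⁻¹ := by
      have h3 := hField_pos (h := h) (L := L) hr0 z
      have h4 := le_hField_of_radius (h := h) (L := L) (r := r) z
      have : 0 ≤ Real.log (hField h L r z) := Real.log_nonneg (by linarith)
      positivity
    exact hdrift (by linarith) h2 h1

end RWRE

/-! ### The supersolution for interior neighbourhoods. -/

namespace RWRE

variable {d : ℕ}

theorem intDrift_nonneg {R r s ϱ c : ℝ} {y z : Lat d} (hϱ : 0 ≤ ϱ) (hc : 0 ≤ c) :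
    0 ≤ intDrift R r s ϱ c y z := by
  have hv : 0 ≤ shiftSq (s ^ 2) (emb y) z := by rw [shiftSq]; positivity
  unfold intDrift
  have h1 := Real.rpow_nonneg hv (-(d / 2 - 1 : ℝ))
  have h2 := Real.rpow_nonneg hv (-(d / 2 - 5 / 4 : ℝ))
  positivity

section Size

variable {R r s c : ℝ} {x y : Lat d}

/-- With ϱ = R^{-1/2} the second term never exceeds twice the first, since v ≤ 9R² gives v^{1/4} ≤
2√R. -/
theorem inv_sqrt_mul_rpow_le (hs : 0 < s) (hsR : s ≤ R) (hx : eNorm x ≤ R) (hy : eNorm y ≤ R) :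
    (√R)⁻¹ * shiftSq (s ^ 2) (emb y) x ^ (-(d / 2 - 5 / 4 : ℝ))
      ≤ 2 * shiftSq (s ^ 2) (emb y) x ^ (-(d / 2 - 1 : ℝ)) := by
  have hR : 0 < R := by linarith
  obtain ⟨n1, n2, -⟩ := shiftSq_bounds hs.le hsR hx hy
  have hv : 0 < shiftSq (s ^ 2) (emb y) x := Real.sqrt_pos.1 (by linarith)
  have h1 : √√(shiftSq (s ^ 2) (emb y) x) ≤ 2 * √R := by
    rw [show (2 : ℝ) * √R = √(4 * R) by
      rw [Real.sqrt_mul (by norm_num), show (4 : ℝ) = 2 ^ 2 by norm_num,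
        Real.sqrt_sq (by norm_num)]]
    exact Real.sqrt_le_sqrt (by linarith)
  rw [rpow_quarter hv]
  have h2 : 0 < √R := Real.sqrt_pos.2 hR
  have h3 := Real.rpow_nonneg hv.le (-(d / 2 - 1 : ℝ))
  rw [inv_mul_eq_div, div_le_iff₀ h2]
  nlinarith

/-- `intFun` far from its centre. -/
theorem intFun_far_le (hd : 3 ≤ d) {D : ℝ} (hD : 0 < D) (hs : 0 < s) (hsR : s ≤ R)
    (hx : eNorm x ≤ R) (hy : eNorm y ≤ R) (hl : 0 ≤ invLog r (bndS R (emb x)))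
    (hxy : D / 2 ≤ eNorm (x - y)) :
    intFun R r s (√R)⁻¹ ((D ^ 2) ^ (-(d / 2 - 1 : ℝ))) y x
      ≤ 5 * 4 ^ (d / 2 - 1 : ℝ) * (D ^ 2) ^ (-(d / 2 - 1 : ℝ)) := by
  have hd' : (3 : ℝ) ≤ d := by exact_mod_cast hd
  have h1 := inv_sqrt_mul_rpow_le (d := d) hs hsR hx hy
  have hv : D ^ 2 ≤ 4 * shiftSq (s ^ 2) (emb y) x := by
    rw [shiftSq, ← eNorm_sub_eq]; nlinarith
  have h2 := rpow_neg_le_of_le_four_mul (α := (d / 2 - 1 : ℝ)) (by positivity) hv (by linarith)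
  have hC1 : (1 : ℝ) ≤ 4 ^ (d / 2 - 1 : ℝ) := Real.one_le_rpow (by norm_num) (by linarith)
  have hc : 0 < (D ^ 2) ^ (-(d / 2 - 1 : ℝ)) := by positivity
  unfold intFun
  set c := (D ^ 2) ^ (-(d / 2 - 1 : ℝ))
  have h3 : c * (2 - invLog r (bndS R (emb x))) ≤ c * 2 := by gcongr; linarith
  have h4 : 1 * c ≤ 4 ^ (d / 2 - 1 : ℝ) * c := by gcongr
  linarith

/-- `intFun` near its centre. -/
theorem intFun_near_le (hd : 3 ≤ d) {D : ℝ} (hD : 0 < D) (hs : 0 < s) (hsR : s ≤ R)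
    (hx : eNorm x ≤ R) (hy : eNorm y ≤ R) (hl : 0 ≤ invLog r (bndS R (emb x)))
    (hsD : 2 * s ≤ D) (hxy : eNorm (x - y) ≤ 3 / 4 * D) :
    intFun R r s (√R)⁻¹ ((D ^ 2) ^ (-(d / 2 - 1 : ℝ))) y x
      ≤ 5 * shiftSq (s ^ 2) (emb y) x ^ (-(d / 2 - 1 : ℝ)) := by
  have hd' : (3 : ℝ) ≤ d := by exact_mod_cast hd
  have h1 := inv_sqrt_mul_rpow_le (d := d) hs hsR hx hy
  have h0 := eNorm_nonneg (x - y)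
  have hv0 : 0 < shiftSq (s ^ 2) (emb y) x := by rw [shiftSq]; positivity
  have hv : shiftSq (s ^ 2) (emb y) x ≤ D ^ 2 := by
    rw [shiftSq, ← eNorm_sub_eq]; nlinarith
  have h2 : (D ^ 2) ^ (-(d / 2 - 1 : ℝ)) ≤ shiftSq (s ^ 2) (emb y) x ^ (-(d / 2 - 1 : ℝ)) :=
    Real.rpow_le_rpow_of_nonpos hv0 hv (by linarith)
  have hc : 0 < (D ^ 2) ^ (-(d / 2 - 1 : ℝ)) := by positivity
  unfold intFun
  set c := (D ^ 2) ^ (-(d / 2 - 1 : ℝ))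
  have h3 : c * (2 - invLog r (bndS R (emb x))) ≤ c * 2 := by gcongr; linarith
  linarith

theorem le_intDrift_log :
    c * (invLog r (bndS R (emb x)) ^ 2 / bndS R (emb x) ^ 2) ≤ intDrift R r s (√R)⁻¹ c y x := by
  have hv : 0 ≤ shiftSq (s ^ 2) (emb y) x := by rw [shiftSq]; positivity
  unfold intDrift
  have h1 := Real.rpow_nonneg hv (-(d / 2 - 1 : ℝ))
  have h2 := Real.rpow_nonneg hv (-(d / 2 - 5 / 4 : ℝ))
  have h3 : 0 ≤ shiftSq (s ^ 2) (emb y) x ^ (-(d / 2 - 1 : ℝ)) *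
    (s ^ 2 / shiftSq (s ^ 2) (emb y) x ^ 2) := by positivity
  have h4 : 0 ≤ (√R)⁻¹ * (shiftSq (s ^ 2) (emb y) x ^ (-(d / 2 - 5 / 4 : ℝ)) /
    shiftSq (s ^ 2) (emb y) x) := by positivity
  linarith

/-- The second term alone: ϱWv^{-3/4} with v ≤ 9R². -/
theorem le_intDrift_mid (hs : 0 < s) (hsR : s ≤ R) (hx : eNorm x ≤ R) (hy : eNorm y ≤ R)
    (hc : 0 ≤ c) :
    shiftSq (s ^ 2) (emb y) x ^ (-(d / 2 - 1 : ℝ)) / (6 * R ^ 2) ≤ intDrift R r s (√R)⁻¹ c y x := by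
  have hR : 0 < R := by linarith
  obtain ⟨n1, n2, -⟩ := shiftSq_bounds hs.le hsR hx hy
  have hv : 0 < shiftSq (s ^ 2) (emb y) x := Real.sqrt_pos.1 (by linarith)
  unfold intDrift
  rw [rpow_quarter hv]
  set v := shiftSq (s ^ 2) (emb y) x
  have h1 := Real.rpow_pos_of_pos hv (-(d / 2 - 1 : ℝ))
  have h3 : 0 ≤ v ^ (-(d / 2 - 1 : ℝ)) * (s ^ 2 / v ^ 2) := by positivity
  have h4 : 0 ≤ c * (invLog r (bndS R (emb x)) ^ 2 / bndS R (emb x) ^ 2) := by positivity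
  set W := v ^ (-(d / 2 - 1 : ℝ))
  set n := √v with hn
  have hn0 : 0 < n := Real.sqrt_pos.2 hv
  have hvn : v = n ^ 2 := (Real.sq_sqrt hv.le).symm
  have hq0 : 0 < √n := Real.sqrt_pos.2 hn0
  have hqn : √n ^ 2 = n := Real.sq_sqrt hn0.le
  have hR0 : 0 < √R := Real.sqrt_pos.2 hR
  have h5 : √R * √n ≤ 2 * R := by
    have h6 : √R * √n = √(R * n) := (Real.sqrt_mul hR.le _).symm
    rw [h6]
    refine Real.sqrt_le_iff.2 ⟨by positivity, ?_⟩
    nlinarith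
  have h6 : W / (6 * R ^ 2) ≤ (√R)⁻¹ * (W * √n / v) := by
    have e : (√R)⁻¹ * (W * √n / v) = W / (√R * √n * n) := by
      rw [hvn]; field_simp; rw [hqn]
    rw [e]
    apply div_le_div_of_nonneg_left h1.le (by positivity)
    calc √R * √n * n ≤ 2 * R * (3 * R) := by gcongr
      _ = _ := by ring
  linarith

theorem drift_mid_arith {W l m η : ℝ} (hW : 0 < W) (hR : 0 < R) (hη : 0 < η) (hl : 0 < l)
    (hs : 0 < s) (hm : s / 40 ≤ m) (h : 50000 / η * R ^ 2 ≤ s ^ 2 * l ^ 9) :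
    5 * W ≤ η * (m ^ 2 * (W / (6 * R ^ 2))) * l ^ 9 := by
  rw [div_mul_eq_mul_div, div_le_iff₀ hη] at h
  calc 5 * W = 50000 * R ^ 2 * W / (10000 * R ^ 2) := by field_simp; norm_num
    _ ≤ s ^ 2 * l ^ 9 * η * W / (10000 * R ^ 2) := by gcongr
    _ = η * ((s / 40) ^ 2 * (W / (6 * R ^ 2))) * l ^ 9 * (9600 / 10000) := by
      field_simp; norm_num
    _ ≤ η * ((s / 40) ^ 2 * (W / (6 * R ^ 2))) * l ^ 9 * 1 := by
      gcongr; norm_num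
    _ ≤ _ := by
      rw [mul_one]
      gcongr

end Size

open Classical in
set_option maxHeartbeats 600000 in
-- The drift terms are used in different regions. At distance at least half of D = R - |y| from y,
-- the choice c = D^{2-d} makes the whole function of order c, and the logarithmic term alone
-- supplies enough drift, both in the boundary layer and inside. Closer to y the steps have length
-- of order s_L and the term with ϱ does it.
theorem goodified_int [NeZero d] (hd : 3 ≤ d) : ∃ κ₀ : ℝ, 128 ≤ κ₀ ∧
    ∀ κ, κ₀ ≤ κ → ∃ C δ₀ M : ℝ, 1 ≤ C ∧ 0 < δ₀ ∧ 1 ≤ M ∧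
    ∀ {φ h : ℝ → ℝ} {L r R δ : ℝ} {ω : Env d} {x y : Lat d},
    IsCGDensity φ → IsCGProfile h → LargeScale M L → 100 ≤ r → r ≤ rScale L → 0 ≤ δ → δ ≤ δ₀ →
    R = L + (Real.exp κ + 2) * r → 2 * sScale L ≤ R - eNorm y → x ∈ ball0 d (L + r) →
    ∑' z, tildeGood φ h L r δ ω x z * (if z ∈ ball0 d (L + r) then ENNReal.ofReal
        (intFun R r (sScale L) (√R)⁻¹ (((R - eNorm y) ^ 2) ^ (-(d / 2 - 1 : ℝ))) y z) else 0)
      + ENNReal.ofReal (hField h L r x ^ 2 *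
        intDrift R r (sScale L) (√R)⁻¹ (((R - eNorm y) ^ 2) ^ (-(d / 2 - 1 : ℝ))) y x / C)
      ≤ ENNReal.ofReal
        (intFun R r (sScale L) (√R)⁻¹ (((R - eNorm y) ^ 2) ^ (-(d / 2 - 1 : ℝ))) y x) := by
  obtain ⟨κ₀, hκ1, M₁, hM₁, H⟩ := intFun_drift (d := d) hd
  refine ⟨κ₀, hκ1, fun κ hκ => ?_⟩
  have hd' : (3 : ℝ) ≤ d := by exact_mod_cast hd
  set p : ℝ := 4 ^ (d / 2 - 1 : ℝ) with hp
  have hp1 : 1 ≤ p := Real.one_le_rpow (by norm_num) (by linarith)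
  set C : ℝ := 16 * d + 36 * p with hC
  have hC1 : 1 ≤ C := by linarith
  set η : ℝ := 1 / (4 * C ^ 3) with hη
  have hη0 : 0 < η := by positivity
  have hexp := Real.add_one_le_exp κ
  set A : ℝ := Real.exp κ + 2 with hA
  obtain ⟨K, M₀, hK, hM₀, N⟩ := exists_inv_log_pow_le (d := d) (A := A) (η := η / (5 * p))
    (by linarith) (by positivity)
  refine ⟨2 * C ^ 2, min (1 / (100 * C ^ 4)) (η / (800 * (2 * (A + K)) ^ 4) / (5 * p)),
    max M₀ (max M₁ (max (2 * (A + K)) (2048 * (50000 / η) + 2048))), by nlinarith,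
    by positivity, hM₀.trans (le_max_left _ _), ?_⟩
  intro φ h L r R δ ω x y hφ hh hL hr hrL hδ hδ₀ hR hy hx
  have hM1 := hM₀.trans (le_max_left M₀ (max M₁ (max (2 * (A + K)) (2048 * (50000 / η) + 2048))))
  have hMa : M₁ ≤ max M₀ (max M₁ (max (2 * (A + K)) (2048 * (50000 / η) + 2048))) := by simp
  have hMb : 2 * (A + K) ≤ max M₀ (max M₁ (max (2 * (A + K)) (2048 * (50000 / η) + 2048))) := by simp
  have hMc : 2048 * (50000 / η) + 2048 ≤
    max M₀ (max M₁ (max (2 * (A + K)) (2048 * (50000 / η) + 2048))) := by simp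
  have hL₀ := hL.mono (le_max_left _ _) hM1
  set M := max M₀ (max M₁ (max (2 * (A + K)) (2048 * (50000 / η) + 2048)))
  have hq : 0 < 50000 / η := by positivity
  have hM2048 : 2048 ≤ M := by linarith
  have hr0 : 0 < r := by linarith
  have hMr := hL.mul_le_sScale hM1 hrL
  have hrs : r ≤ sScale L := by nlinarith
  have hL0 := hL.pos hM1
  have hMs := hL.le_sScale hM1
  set s := sScale L with hsdef
  have hs0 : 0 < s := by linarith
  have hsL : s ≤ L := by have := hL.mul_sScale_le hM1; nlinarith
  have hAr : 131 * r ≤ A * r := by gcongr; linarith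
  have hAe : A * r = Real.exp κ * r + 2 * r := by rw [hA]; ring
  have hAKr : 2 * (A * r + K * r) ≤ s := by
    calc 2 * (A * r + K * r) = 2 * (A + K) * r := by ring
      _ ≤ M * r := by gcongr
      _ ≤ s := hMr
  have hKr : 0 < K * r := by positivity
  have hrange : ∀ {z : Lat d}, eNorm z ≤ L + r + 1 → eNorm z + Real.exp κ * r ≤ R := fun hz => by
    linarith
  have her : 0 < Real.exp κ * r := by positivity
  have hR0 : 0 < R := by linarith
  have hsR : s ≤ R := by linarith
  have hR2 : R ≤ 2 * L := by linarith
  have hyR : eNorm y ≤ R := by linarith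
  have hκ1' : 128 ≤ κ := hκ1.trans hκ
  set D := R - eNorm y with hD
  have hD0 : 0 < D := by linarith
  set ϱ := (√R)⁻¹ with hϱ
  have hϱ0 : 0 ≤ ϱ := by positivity
  set c := (D ^ 2) ^ (-(d / 2 - 1 : ℝ)) with hc
  have hc0 : 0 < c := by positivity
  have hMϱ : M₁ ≤ ϱ * (s * √s) :=
    hMa.trans (hL.le_inv_sqrt_mul (by linarith) hR0 hR2)
  have hlog : ∀ {z : Lat d}, eNorm z ≤ L + r + 1 → κ ≤ Real.log (bndS R (emb z) / r) := fun {z} hz => by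
    have h1 := hrange hz
    have h2 := (bndS_bounds (R := R) (x := z) (by linarith)).1
    rw [Real.le_log_iff_exp_le (by apply div_pos _ hr0; linarith), le_div_iff₀ hr0]; linarith
  have hl0 : ∀ {z : Lat d}, eNorm z ≤ L + r + 1 → 0 ≤ invLog r (bndS R (emb z)) := fun hz =>
    (invLog_bounds hκ1' (hlog hz)).1.le
  have hμ0 : ∀ z : Lat d, 0 ≤ intDrift R r s ϱ c y z := fun z => intDrift_nonneg hϱ0 hc0.le
  have hf0 : ∀ z : Lat d, eNorm z ≤ L + r + 1 → 0 ≤ intFun R r s ϱ c y z := fun z hz => by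
    have hv : 0 ≤ shiftSq (s ^ 2) (emb y) z := by rw [shiftSq]; positivity
    have h1 := Real.rpow_nonneg hv (-(d / 2 - 1 : ℝ))
    have h2 := Real.rpow_nonneg hv (-(d / 2 - 5 / 4 : ℝ))
    have h3 : 0 ≤ 2 - invLog r (bndS R (emb z)) := by
      linarith [(invLog_bounds hκ1' (hlog hz)).2]
    unfold intFun
    positivity
  have hlocal : ∀ x z : Lat d, eNorm x ≤ L + r + 1 → eNorm z ≤ L + r + 1 →
      eNorm (z - x) ≤ (R - eNorm x) / 3 → eNorm (z - x) ≤ s / 3 →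
      intFun R r s ϱ c y x ≤ C * intFun R r s ϱ c y z ∧
        intDrift R r s ϱ c y x ≤ C * intDrift R r s ϱ c y z := by
    intro x z h1 h2 h3 h4
    obtain ⟨q1, q2⟩ := intFun_local (y := y) hd hκ1' hr hs0 hϱ0 hc0.le (hrange h1) (hrange h2) h3 h4
    refine ⟨q1.trans ?_, q2.trans ?_⟩
    · exact mul_le_mul_of_nonneg_right (by linarith) (hf0 z h2)
    · exact mul_le_mul_of_nonneg_right (by linarith) (hμ0 z)
  have hfar : ∀ {z : Lat d} {t : ℝ}, eNorm z ≤ L + r + 1 → 0 ≤ t → D / 2 ≤ eNorm (z - y) →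
      t * 2 ≤ η / (5 * p) *
        (hField h L r z ^ 2 * (invLog r (bndS R (emb z)) ^ 2 / bndS R (emb z) ^ 2)) →
      t * intFun R r s ϱ c y z ≤ η * (hField h L r z ^ 2 * intDrift R r s ϱ c y z) := by
    intro z t hz ht hzy h1
    have h2 := intFun_far_le (r := r) hd hD0 hs0 hsR (by linarith [hrange hz]) hyR (hl0 hz) hzy
    calc t * intFun R r s ϱ c y z ≤ t * (5 * p * c) := mul_le_mul_of_nonneg_left h2 ht
      _ ≤ 5 * p * c * (t * 2) := by
        have : 0 ≤ 5 * p * c * t := by positivity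
        linarith
      _ ≤ 5 * p * c * (η / (5 * p) * (hField h L r z ^ 2 *
          (invLog r (bndS R (emb z)) ^ 2 / bndS R (emb z) ^ 2))) := by gcongr
      _ = η * (hField h L r z ^ 2 * (c *
          (invLog r (bndS R (emb z)) ^ 2 / bndS R (emb z) ^ 2))) := by field_simp
      _ ≤ _ := by
        gcongr
        exact le_intDrift_log
  refine tildeGood_drift hφ hh hr hrs (R := R) (K := K) (η := η) (by linarith) hC1 hδ hK
    (small_constants hC1 hη (hδ₀.trans (min_le_left _ _))) hf0 (fun z _ => hμ0 z) ?_ ?_ ?_ ?_ ?_ ?_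
    ω hx
  · intro z hz
    obtain ⟨q1, -⟩ := H κ R r s ϱ c z y hκ hr (by linarith) hsR hϱ0 hc0.le hMϱ
      (hrange (by linarith)) hyR
    have := hμ0 z
    have h5 : 0 ≤ intFun R r s ϱ c y z - avg (intFun R r s ϱ c y) z := by
      by_contra hn
      push Not at hn
      have := mul_neg_of_pos_of_neg (show (0 : ℝ) < 16 * d by linarith) hn
      linarith
    exact q1.trans (mul_le_mul_of_nonneg_right (by linarith) h5)
  · intro z hz
    obtain ⟨-, q2⟩ := H κ R r s ϱ c z y hκ hr (by linarith) hsR hϱ0 hc0.le hMϱ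
      (hrange (by linarith)) hyR
    exact q2.trans (mul_le_mul_of_nonneg_right (by linarith) (hμ0 z))
  · intro x z h1 h2 h3
    obtain ⟨n1, n2, n3, n4⟩ := near_symm h3
    exact ⟨hlocal x z (by linarith) h2 n1 n3, hlocal z x h2 (by linarith) n2 n4⟩
  · intro z hz
    have h1 := hField_le_range hh hr hrs (R := R) (by linarith) hz
    have h2 := hField_pos (h := h) (L := L) hr0 z
    have h3 := min_le_left (R - eNorm z) s
    have h4 := min_le_right (R - eNorm z) s
    have h5 := sq_mul_intDrift_le (y := y) hκ1' hr hs0 hϱ0 hc0.le (hrange (z := z) (by linarith)) h2.le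
      (m := hField h L r z) (by linarith) (by linarith)
    have h6 := hf0 z (by linarith)
    nlinarith
  · intro z hz hzK
    have hb : bdist L z = L - eNorm z := rfl
    refine hfar (by linarith) hδ ?_ ?_
    -- A point within Kr of the boundary is automatically far from y, because D ≥ 2s_L while (A+K)r
    -- ≤ s_L/2.
    · have := eNorm_le_add z y
      linarith
    · have hk := hlog (z := z) (by linarith)
      rw [hR] at hk ⊢
      refine le_drift_near (by linarith) (by linarith) (by positivity) hδ ?_ hr hz hzK
        (by linarith)
      have := hδ₀.trans (min_le_right _ _)
      rwa [div_right_comm, le_div_iff₀ (by positivity), mul_comm] at this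
  · intro z hz
    have hb : bdist L z = L - eNorm z := rfl
    have hz' : eNorm z ≤ L := by linarith
    have h2 : 0 ≤ Real.log (hField h L r z) := by
      have h4 := le_hField_of_radius (h := h) (L := L) (r := r) z
      exact Real.log_nonneg (by linarith)
    -- In the second case d_L(z) exceeds s_L/2, so h ≥ s_L/40, and drift W/(6R²) against size 5W is
    -- the power counting of `mul_sq_le`.
    rcases le_total (D / 2) (eNorm (z - y)) with hzy | hzy
    · have h1 := N (h := h) hh le_rfl hL₀ hr hrL hz
      rw [← hR, mul_comm] at h1
      exact hfar (by linarith) (by positivity) hzy h1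
    · have h3 := intFun_near_le (r := r) hd hD0 hs0 hsR (by linarith [hrange (z := z) (by linarith)])
        hyR (hl0 (z := z) (by linarith)) hy (by linarith)
      have h4 := le_intDrift_mid (r := r) hs0 hsR (by linarith [hrange (z := z) (by linarith)])
        hyR hc0.le (x := z) (y := y)
      have hm : s / 40 ≤ hField h L r z := by
        have h5 := le_hField hh hs0 hr0.le z
        have h6 := eNorm_le_add z y
        rw [min_eq_right (by linarith)] at h5
        linarith
      have h7 := hL.mul_sq_le hM2048 (η := 50000 / η) hq.le (by linarith) hR0.le hR2 hm
      have h8 := hL.half_log_le (by linarith) hm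
      have h9 := hL.log_pos hM1
      have hlm : 0 < Real.log (hField h L r z) := by linarith
      have hv : 0 < shiftSq (s ^ 2) (emb y) z := by rw [shiftSq]; positivity
      have hW := Real.rpow_pos_of_pos hv (-(d / 2 - 1 : ℝ))
      set W := shiftSq (s ^ 2) (emb y) z ^ (-(d / 2 - 1 : ℝ))
      rw [inv_mul_eq_div, div_le_iff₀ (by positivity)]
      calc _ ≤ 5 * W := h3
        _ ≤ η * (hField h L r z ^ 2 * (W / (6 * R ^ 2))) * Real.log (hField h L r z) ^ 9 :=
          drift_mid_arith hW hR0 hη0 hlm hs0 hm h7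
        _ ≤ _ := by gcongr

end RWRE

namespace RWRE

variable {d : ℕ}

/-! ### Green's functions from supersolutions -/

section Potential

open Classical

variable {V U N : Set (Lat d)} {F : Kern d}

/-- The expected time spent in `U` before leaving `V`. -/
noncomputable def occ (V : Set (Lat d)) (F : Kern d) (U : Set (Lat d)) (x : Lat d) : ℝ≥0∞ :=
  potential (killed V F) (fun z => if z ∈ U then 1 else 0) x

theorem occ_eq_tsum (V : Set (Lat d)) (F : Kern d) (U : Set (Lat d)) (x : Lat d) :
    occ V F U x = ∑' z : U, green V F x z := by
  rw [occ, ← tsum_green_mul, tsum_subtype U (fun z => green V F x z)]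
  refine tsum_congr fun z => ?_
  by_cases hz : z ∈ U <;> simp [hz]

theorem occ_mono {U' : Set (Lat d)} (h : U ⊆ U') (x : Lat d) : occ V F U x ≤ occ V F U' x := by
  rw [occ_eq_tsum, occ_eq_tsum]
  exact ENNReal.tsum_mono_subtype _ h

/-- On V the function f/m is a supersolution for the indicator of U: on U each step loses at least
m. -/
theorem occ_le_of_drift {f e : Lat d → ℝ} {m : ℝ} (hm : 0 < m)
    (hdrift : ∀ x ∈ V, ∑' z, F x z * (if z ∈ V then ENNReal.ofReal (f z) else 0)
      + ENNReal.ofReal (e x) ≤ ENNReal.ofReal (f x))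
    (hU : ∀ x ∈ U, x ∈ V ∧ m ≤ e x) {x : Lat d} (hx : x ∈ V) :
    occ V F U x ≤ ENNReal.ofReal (f x / m) := by
  have key := potential_le (F := killed V F) (g := fun z => if z ∈ U then 1 else 0)
    (u := fun z => if z ∈ V then ENNReal.ofReal (f z / m) else 0) ?_ x
  · simpa [hx, occ] using key
  intro y
  by_cases hy : y ∈ V
  · rw [kAct_killed_of_mem hy, if_pos hy]
    have e1 : ∀ t : ℝ, ENNReal.ofReal (t / m) = ENNReal.ofReal m⁻¹ * ENNReal.ofReal t := fun t => by
      rw [← ENNReal.ofReal_mul (by positivity)]; congr 1; ring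
    have e2 : kAct F (fun z => if z ∈ V then ENNReal.ofReal (f z / m) else 0) y
        = ENNReal.ofReal m⁻¹ * ∑' z, F y z * (if z ∈ V then ENNReal.ofReal (f z) else 0) := by
      rw [kAct, ← ENNReal.tsum_mul_left]
      refine tsum_congr fun z => ?_
      split_ifs
      · rw [e1]; ring
      · simp
    have e3 : (if y ∈ U then (1 : ℝ≥0∞) else 0) ≤ ENNReal.ofReal m⁻¹ * ENNReal.ofReal (e y) := by
      split_ifs with h
      · rw [← ENNReal.ofReal_mul (by positivity), ← ENNReal.ofReal_one]
        apply ENNReal.ofReal_le_ofReal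
        rw [inv_mul_eq_div, le_div_iff₀ hm, one_mul]
        exact (hU y h).2
      · exact zero_le
    rw [e2, e1]
    calc _ ≤ ENNReal.ofReal m⁻¹ * ENNReal.ofReal (e y) + ENNReal.ofReal m⁻¹ *
          ∑' z, F y z * (if z ∈ V then ENNReal.ofReal (f z) else 0) := by gcongr
      _ = ENNReal.ofReal m⁻¹ * (∑' z, F y z * (if z ∈ V then ENNReal.ofReal (f z) else 0)
          + ENNReal.ofReal (e y)) := by ring
      _ ≤ _ := by gcongr; exact hdrift y hy
  · rw [kAct_killed_of_notMem hy, if_neg hy, if_neg (fun h => hy (hU y h).1)]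
    simp

/-- A maximum principle: a bound for the occupation time on the rim of `N` propagates outside. -/
theorem occ_le_outside {f : Lat d → ℝ} {B : ℝ} (hB : 0 ≤ B)
    (hdrift : ∀ x ∈ V, ∑' z, F x z * (if z ∈ V then ENNReal.ofReal (f z) else 0)
      ≤ ENNReal.ofReal (f x))
    (hU : U ⊆ N ∩ V)
    (hrim : ∀ x ∈ V, x ∉ N → ∀ z ∈ V, z ∈ N → F x z ≠ 0 →
      occ V F U z ≤ ENNReal.ofReal (B * f z)) {x : Lat d} (hx : x ∈ V) (hxN : x ∉ N) :
    occ V F U x ≤ ENNReal.ofReal (B * f x) := by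
  -- The competitor is the occupation time on N and its minimum with Bf outside N. Outside N the
  -- minimum of two supersolutions is again one, the rim hypothesis covering steps into N.
  -- Minimality of the occupation time then gives the bound.
  have key := potential_le (F := killed V F) (g := fun z => if z ∈ U then 1 else 0)
    (u := fun z => if z ∈ V then (if z ∈ N then occ V F U z else
      min (occ V F U z) (ENNReal.ofReal (B * f z))) else 0) ?_ x
  · simp only [hx, hxN, if_true, if_false] at key
    exact key.trans (min_le_right _ _)
  intro y
  by_cases hy : y ∈ V
  · have h1 : (if y ∈ U then (1 : ℝ≥0∞) else 0) + kAct (killed V F) (fun z => if z ∈ V then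
        (if z ∈ N then occ V F U z else min (occ V F U z) (ENNReal.ofReal (B * f z))) else 0) y
        ≤ occ V F U y := by
      conv_rhs => rw [occ, potential_eq]
      gcongr
      refine kAct_mono (fun z => ?_) y
      split_ifs
      · exact le_rfl
      · exact min_le_left _ _
      · exact zero_le
    rw [if_pos hy]
    by_cases hyN : y ∈ N
    · rw [if_pos hyN]; exact h1
    · rw [if_neg hyN]
      refine le_min h1 ?_
      have hyU : y ∉ U := fun h => hyN (hU h).1
      rw [if_neg hyU, zero_add, kAct_killed_of_mem hy, kAct]
      have e1 : ∀ t : ℝ, ENNReal.ofReal (B * t) = ENNReal.ofReal B * ENNReal.ofReal t := fun t =>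
        ENNReal.ofReal_mul hB
      calc _ ≤ ∑' z, ENNReal.ofReal B * (F y z * (if z ∈ V then ENNReal.ofReal (f z) else 0)) := by
            refine ENNReal.tsum_le_tsum fun z => ?_
            by_cases hF : F y z = 0
            · simp [hF]
            rw [mul_left_comm]
            gcongr
            split_ifs with hz hzN
            · rw [← e1]; exact hrim y hy hyN z hz hzN hF
            · rw [← e1]; exact min_le_right _ _
            · exact zero_le
        _ = ENNReal.ofReal B * ∑' z, F y z * (if z ∈ V then ENNReal.ofReal (f z) else 0) :=
            ENNReal.tsum_mul_left
        _ ≤ ENNReal.ofReal B * ENNReal.ofReal (f y) := by gcongr; exact hdrift y hy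
        _ = _ := (e1 _).symm
  · rw [kAct_killed_of_notMem hy, if_neg hy, if_neg (fun h => hy (hU h).2)]
    simp

end Potential

/-! ### Geometry of the neighbourhoods -/

theorem sq_rpow_neg {n β : ℝ} (hn : 0 ≤ n) {k : ℕ} (h : 2 * β = k) :
    (n ^ 2) ^ (-β) = (n ^ k)⁻¹ := by
  rw [Real.rpow_neg (sq_nonneg n), ← Real.rpow_natCast n 2, ← Real.rpow_mul hn]
  push_cast
  rw [h, Real.rpow_natCast]

theorem sq_rpow_neg_interior (hd : 3 ≤ d) {n : ℝ} (hn : 0 ≤ n) :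
    (n ^ 2) ^ (-(d / 2 - 1 : ℝ)) = (n ^ (d - 2))⁻¹ :=
  sq_rpow_neg hn (by push_cast [Nat.cast_sub (show 2 ≤ d by omega)]; ring)

theorem shiftSq_rpow (ζ : EuclideanSpace ℝ (Fin d)) (x : Lat d) :
    shiftSq 0 ζ x ^ (-(d / 2 : ℝ)) = (‖emb x - ζ‖ ^ d)⁻¹ := by
  rw [shiftSq, zero_add]
  exact sq_rpow_neg (norm_nonneg _) (by ring)

/-- The reflection of a point in the sphere of radius `R`. -/
theorem exists_reflection [NeZero d] {R : ℝ} {y : Lat d} (hy : eNorm y ≤ R) :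
    ∃ ζ : EuclideanSpace ℝ (Fin d), ‖ζ‖ = 2 * R - eNorm y ∧
      ‖emb y - ζ‖ = 2 * (R - eNorm y) := by
  have h0 := eNorm_nonneg y
  rcases h0.eq_or_lt with h | h
  · refine ⟨(2 * R) • EuclideanSpace.single 0 1, ?_, ?_⟩
    · rw [norm_smul, ← h]; simp; linarith
    · have : emb y = 0 := by rw [← norm_eq_zero, ← eNorm_eq, h]
      rw [this, zero_sub, norm_neg, norm_smul, ← h]; simp; linarith
  · refine ⟨((2 * R - eNorm y) / eNorm y) • emb y, ?_, ?_⟩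
    · rw [norm_smul, ← eNorm_eq, Real.norm_of_nonneg (div_nonneg (by linarith) h0)]
      field_simp
    · have : emb y - ((2 * R - eNorm y) / eNorm y) • emb y
          = -((2 * (R - eNorm y) / eNorm y) • emb y) := by
        have e : (2 * R - eNorm y) / eNorm y = 1 + 2 * (R - eNorm y) / eNorm y := by
          field_simp; ring
        rw [e, add_smul, one_smul]; abel
      rw [this, norm_neg, norm_smul, ← eNorm_eq, Real.norm_of_nonneg (div_nonneg (by linarith) h0)]
      field_simp

theorem bdist_nonneg {t : ℝ} {x : Lat d} (hx : x ∈ ball0 d t) : 0 ≤ bdist t x :=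
  sub_nonneg.2 hx

theorem dTilde_comparable {A L r R : ℝ} (hA : 4 ≤ A) (hr : 0 < r) (hR : R = L + A * r) {x : Lat d}
    (hx : x ∈ ball0 d (L + r)) :
    dTilde L r x ≤ R - eNorm x ∧ R - eNorm x ≤ A * dTilde L r x := by
  have h1 := bdist_nonneg hx
  have hb : bdist (L + r) x = L + r - eNorm x := rfl
  have h2 := le_max_left (bdist (L + r) x / 2) (3 * r)
  have h3 := le_max_right (bdist (L + r) x / 2) (3 * r)
  have hAr : 4 * r ≤ A * r := by gcongr
  rw [dTilde]
  constructor
  · exact max_le (by linarith) (by linarith)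
  · have h4 : A * (3 * r) ≤ A * max (bdist (L + r) x / 2) (3 * r) := by gcongr
    have h5 : 4 * (bdist (L + r) x / 2) ≤ A * max (bdist (L + r) x / 2) (3 * r) := by gcongr
    nlinarith

theorem aFun_pos {L r : ℝ} (hr : 0 < r) (hs : 0 < sScale L) (y : Lat d) : 0 < aFun L r y :=
  lt_min (lt_max_of_lt_right (by positivity)) hs

/-- Steps from the neighbourhood of `y` have length of order `a(y)`. -/
theorem aFun_le_hField {h : ℝ → ℝ} (hh : IsCGProfile h) {L r : ℝ} (hr : 0 < r)
    (hs : 0 < sScale L) {y z : Lat d} (hz : eNorm (z - y) ≤ 7 / 6 * aFun L r y) :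
    aFun L r y / 60 ≤ hField h L r z := by
  have ha1 : aFun L r y ≤ dTilde L r y := min_le_left _ _
  have ha2 : aFun L r y ≤ sScale L := min_le_right _ _
  have h1 := le_hField_of_radius (h := h) (L := L) (r := r) z
  have h2 := le_hField hh hs hr.le z
  rcases le_total (bdist (L + r) y / 2) (3 * r) with hc | hc
  · rw [dTilde, max_eq_right hc] at ha1
    linarith
  · rw [dTilde, max_eq_left hc] at ha1
    have hb : bdist (L + r) y = L + r - eNorm y := rfl
    have hb' : bdist L z = L - eNorm z := rfl
    have h3 := eNorm_le_add z y
    have h4 : aFun L r y / 2 ≤ min (bdist L z) (sScale L / 2) := le_min (by linarith) (by linarith)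
    have := aFun_pos hr hs y
    linarith

end RWRE

namespace RWRE

variable {d : ℕ}

/-! ### Occupation time bounds -/

theorem le_mul_gam {L r C X : ℝ} {x y : Lat d}
    (h1 : X ≤ C * (aFun L r y ^ d * Gamma1 L r x y))
    (h2 : X ≤ C * (aFun L r y ^ d * Gamma2 L r x y)) :
    X ≤ C * (aFun L r y ^ d * Gam L r x y) := by
  rw [Gam]
  rcases le_total (Gamma1 L r x y) (Gamma2 L r x y) with h | h
  · rwa [min_eq_left h]
  · rwa [min_eq_right h]

/-- The slightly enlarged neighbourhood of `y`. -/
def wideNbhd (L r : ℝ) (y : Lat d) : Set (Lat d) :=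
  ballAt (7 / 6 * aFun L r y) y ∩ ball0 d (L + r)

section Bounds

variable {h : ℝ → ℝ} {κ L r R C : ℝ} {F : Kern d} {x y : Lat d}

theorem dTilde_lip (x y : Lat d) :
    dTilde L r x ≤ dTilde L r y + eNorm (x - y) := by
  have h1 := le_max_left (bdist (L + r) y / 2) (3 * r)
  have h2 := le_max_right (bdist (L + r) y / 2) (3 * r)
  have hb : bdist (L + r) x = L + r - eNorm x := rfl
  have hb' : bdist (L + r) y = L + r - eNorm y := rfl
  have h3 := eNorm_le_add y x
  rw [eNorm_sub_comm] at h3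
  have h4 := eNorm_nonneg (x - y)
  rw [dTilde, dTilde]
  exact max_le (by linarith) (by linarith)

/-- The distance to the reflection of `y`. -/
theorem reflection_bounds {ζ : EuclideanSpace ℝ (Fin d)} (hζ : ‖ζ‖ = 2 * R - eNorm y)
    (hζy : ‖emb y - ζ‖ = 2 * (R - eNorm y)) (w : Lat d) :
    (R - eNorm y) + (R - eNorm w) ≤ ‖emb w - ζ‖ ∧
      ‖emb w - ζ‖ ≤ eNorm (w - y) + 2 * (R - eNorm y) ∧
      eNorm (w - y) ≤ ‖emb w - ζ‖ + 2 * (R - eNorm y) := by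
  refine ⟨?_, ?_, ?_⟩
  · have := norm_sub_norm_le ζ (emb w)
    rw [norm_sub_rev, ← eNorm_eq] at this; linarith
  · have := norm_sub_le_norm_sub_add_norm_sub (emb w) (emb y) ζ
    rw [← eNorm_sub_eq] at this; linarith
  · have := norm_sub_le_norm_sub_add_norm_sub (emb w) ζ (emb y)
    rw [← eNorm_sub_eq, norm_sub_rev ζ] at this; linarith

open Classical in
-- Boundary layer, with a = d̃(y): for ζ the reflection of y, bdryFun(x) is at most of order
-- d̃(x)/(a+|x-y|)^d, while a step from the neighbourhood, of length at least a/60, gains at least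
-- order a²·a^{-d-1}. The quotient is of order a^d Γ⁽¹⁾.
theorem occ_le_of_dTilde_le [NeZero d] (hd : 3 ≤ d) (hκ : 128 ≤ κ) (hκd : Real.log (36 * d) ≤ κ)
    (hh : IsCGProfile h) (hr : 100 ≤ r) (hrs : r ≤ sScale L) (hL : 0 < L)
    (hR : R = L + (Real.exp κ + 2) * r) (hC : 0 < C)
    (hdrift : ∀ ζ : EuclideanSpace ℝ (Fin d), R ≤ ‖ζ‖ → ‖ζ‖ ≤ 2 * R → ∀ x ∈ ball0 d (L + r),
      ∑' z, F x z * (if z ∈ ball0 d (L + r) then ENNReal.ofReal (bdryFun R r ζ z) else 0)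
        + ENNReal.ofReal (hField h L r x ^ 2 * bdryDrift R r ζ x / C)
        ≤ ENNReal.ofReal (bdryFun R r ζ x))
    (hy : y ∈ ball0 d (L + r)) (hys : dTilde L r y ≤ sScale L) (hx : x ∈ ball0 d (L + r)) :
    occ (ball0 d (L + r)) F (wideNbhd L r y) x ≤ ENNReal.ofReal
      (4 * (Real.exp κ + 2) * 4 ^ d * 1800 * C * (3 * (Real.exp κ + 2)) ^ (d + 2)
        * (aFun L r y ^ d * Gam L r x y)) := by
  have hd1 : 1 ≤ d := Nat.one_le_iff_ne_zero.2 (NeZero.ne d)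
  have hexp := Real.add_one_le_exp κ
  have hr0 : 0 < r := by linarith
  have hs : 0 < sScale L := by linarith
  set A : ℝ := Real.exp κ + 2 with hA
  have hAr : 131 * r ≤ A * r := by gcongr; linarith
  have hAe : A * r = Real.exp κ * r + 2 * r := by rw [hA]; ring
  have hy' : eNorm y ≤ L + r := hy
  have hx' : eNorm x ≤ L + r := hx
  obtain ⟨y1, y2⟩ := dTilde_comparable (A := A) (by linarith) hr0 hR hy
  obtain ⟨x1, x2⟩ := dTilde_comparable (A := A) (by linarith) hr0 hR hx
  have ha : aFun L r y = dTilde L r y := min_eq_left hys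
  have ha0 := aFun_pos (L := L) hr0 hs y
  have hR0 : 0 < R := by linarith
  have hxd : 0 < dTilde L r x := lt_max_of_lt_right (by positivity)
  have hlip := dTilde_lip (L := L) (r := r) x y
  have hρ0 := eNorm_nonneg (x - y)
  obtain ⟨ζ, hζ, hζy⟩ := exists_reflection (R := R) (y := y) (by linarith)
  have hy0 := eNorm_nonneg y
  have hζ1 : R ≤ ‖ζ‖ := by linarith
  have hζ2 : ‖ζ‖ ≤ 2 * R := by linarith
  have her : 0 < Real.exp κ * r := by positivity
  rw [← ha] at y1 y2 hlip
  set a := aFun L r y with hadef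
  set D := R - eNorm y with hD
  have hm0 : 0 < a ^ 3 / (1800 * C * (3 * A * a) ^ (d + 2)) := by positivity
  have key := occ_le_of_drift (V := ball0 d (L + r)) (U := wideNbhd L r y) (F := F) hm0
    (hdrift ζ hζ1 hζ2) ?_ hx
  · refine key.trans (ENNReal.ofReal_le_ofReal ?_)
    have hf := (bdryFun_size (x := x) (r := r) hd1 hκ hκd hr hζ1 hζ2 (by linarith)).2.1
    rw [shiftSq_rpow] at hf
    obtain ⟨-, S2, -⟩ := bndS_bounds (R := R) (x := x) (by linarith)
    obtain ⟨n1, n2, n3⟩ := reflection_bounds hζ hζy x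
    have hn : a + eNorm (x - y) ≤ 4 * ‖emb x - ζ‖ := by linarith
    have hn0 : 0 < ‖emb x - ζ‖ := by linarith
    have hq : (‖emb x - ζ‖ ^ d)⁻¹ ≤ 4 ^ d / (a + eNorm (x - y)) ^ d := by
      rw [inv_le_comm₀ (by positivity) (by positivity), inv_div, div_le_iff₀ (by positivity),
        mul_comm, ← mul_pow]
      gcongr
    have hf2 : bdryFun R r ζ x ≤ 4 * A * 4 ^ d * dTilde L r x / (a + eNorm (x - y)) ^ d := by
      calc bdryFun R r ζ x ≤ 2 * ((‖emb x - ζ‖ ^ d)⁻¹ * bndS R (emb x)) := hf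
        _ ≤ 2 * (4 ^ d / (a + eNorm (x - y)) ^ d * (2 * (A * dTilde L r x))) := by
          have : bndS R (emb x) ≤ 2 * (A * dTilde L r x) := by linarith
          have h0 : 0 ≤ bndS R (emb x) := by
            linarith [(bndS_bounds (R := R) (x := x) (by linarith)).1]
          gcongr
        _ = _ := by ring
    -- d̃ is 1-Lipschitz, so d̃(x)·a ≤ (a+|x-y|)²: here Γ⁽¹⁾ is exactly the minimum.
    have hΓ : Gam L r x y = Gamma1 L r x y := by
      rw [Gam]
      apply min_eq_left
      rw [Gamma1, Gamma2, ← ha, ← hadef]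
      have e : (a + eNorm (x - y)) ^ d = (a + eNorm (x - y)) ^ (d - 2) * (a + eNorm (x - y)) ^ 2 := by
        rw [← pow_add, Nat.sub_add_cancel (by omega)]
      rw [div_le_div_iff₀ (by positivity) (by positivity), e, one_mul]
      have h5 : dTilde L r x * a ≤ (a + eNorm (x - y)) ^ 2 := by
        rw [pow_two]; gcongr; linarith
      calc _ = a ^ 2 * (a + eNorm (x - y)) ^ (d - 2) * (dTilde L r x * a) := by ring
        _ ≤ a ^ 2 * (a + eNorm (x - y)) ^ (d - 2) * (a + eNorm (x - y)) ^ 2 := by gcongr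
        _ = _ := by ring
    rw [hΓ, Gamma1, ← ha, ← hadef, div_le_iff₀ hm0]
    refine hf2.trans (le_of_eq ?_)
    rw [mul_pow (3 * A) a (d + 2), pow_add a d 2]
    field_simp
    rw [mul_div_cancel_right₀ _ (by positivity)]
  · intro z hz
    refine ⟨hz.2, ?_⟩
    have hz1 : eNorm (z - y) ≤ 7 / 6 * a := hz.1
    have hz2 : eNorm z ≤ L + r := hz.2
    have hh1 := aFun_le_hField hh hr0 hs hz1
    obtain ⟨n1, n2, -⟩ := reflection_bounds hζ hζy z
    have hzR : 0 < R - eNorm z := by linarith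
    have hn0 : 0 < ‖emb z - ζ‖ := by linarith
    have hAa : 131 * a ≤ A * a := by gcongr; linarith
    have hn : ‖emb z - ζ‖ ≤ 3 * A * a := by linarith
    -- ‖ζ‖ = R + D gives σ = 2D + D²/R ≥ 2a; the drift used here comes from ζ lying outside the
    -- sphere.
    have hσ : 2 * a ≤ (‖ζ‖ ^ 2 - R ^ 2) / R := by
      rw [le_div_iff₀ hR0, show ‖ζ‖ = R + D by rw [hζ, hD]; ring]
      nlinarith [sq_nonneg D]
    have hσ0 : 0 ≤ (‖ζ‖ ^ 2 - R ^ 2) / R := by linarith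
    have hdr : ((3 * A * a) ^ d)⁻¹ * (2 * a / (3 * A * a) ^ 2) ≤ bdryDrift R r ζ z := by
      rw [bdryDrift, shiftSq_rpow, shiftSq, zero_add]
      have hS : 0 < bndS R (emb z) := by
        linarith [(bndS_bounds (R := R) (x := z) (by linarith)).1]
      have h0 : 0 ≤ invLog r (bndS R (emb z)) ^ 2 / bndS R (emb z) := by positivity
      calc _ ≤ (‖emb z - ζ‖ ^ d)⁻¹ * ((‖ζ‖ ^ 2 - R ^ 2) / R / ‖emb z - ζ‖ ^ 2) := by gcongr
        _ ≤ _ := by gcongr; linarith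
    calc a ^ 3 / (1800 * C * (3 * A * a) ^ (d + 2))
        = (a / 60) ^ 2 * (((3 * A * a) ^ d)⁻¹ * (2 * a / (3 * A * a) ^ 2)) / C := by
          rw [pow_add]; field_simp; norm_num
      _ ≤ _ := by
        gcongr

end Bounds

end RWRE

/-! ### Occupation times of interior neighbourhoods. -/

namespace RWRE

variable {d : ℕ}

section Bounds

variable {h : ℝ → ℝ} {κ L r R C : ℝ} {F : Kern d} {x y : Lat d}

/-- Occupation time bounds for an interior neighbourhood, seen from not too far away. -/
theorem occ_le_interior_near (hd : 3 ≤ d) (hκ : 128 ≤ κ)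
    (hh : IsCGProfile h) (hr : 100 ≤ r) (hrs : r ≤ sScale L) (hsL : sScale L ≤ L)
    (hR : R = L + (Real.exp κ + 2) * r) (hC : 0 < C)
    (hy : y ∈ ball0 d (L + r)) (ha : aFun L r y = sScale L) (hyD : 2 * sScale L ≤ R - eNorm y)
    (hdrift : ∀ x ∈ ball0 d (L + r),
      ∑' z, F x z * (open Classical in if z ∈ ball0 d (L + r) then ENNReal.ofReal
        (intFun R r (sScale L) (√R)⁻¹ (((R - eNorm y) ^ 2) ^ (-(d / 2 - 1 : ℝ))) y z) else 0)
      + ENNReal.ofReal (hField h L r x ^ 2 *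
        intDrift R r (sScale L) (√R)⁻¹ (((R - eNorm y) ^ 2) ^ (-(d / 2 - 1 : ℝ))) y x / C)
      ≤ ENNReal.ofReal
        (intFun R r (sScale L) (√R)⁻¹ (((R - eNorm y) ^ 2) ^ (-(d / 2 - 1 : ℝ))) y x))
    (hx : x ∈ ball0 d (L + r)) (hxy : eNorm (x - y) ≤ 3 / 4 * (R - eNorm y)) :
    occ (ball0 d (L + r)) F (wideNbhd L r y) x ≤ ENNReal.ofReal
      (288000 * C * 4 ^ (d - 2) * (sScale L ^ (d - 2) / (sScale L + eNorm (x - y)) ^ (d - 2))) := by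
  have hd' : (3 : ℝ) ≤ d := by exact_mod_cast hd
  have hexp := Real.add_one_le_exp κ
  have hr0 : 0 < r := by linarith
  have hs : 0 < sScale L := by linarith
  have hAr : 131 * r ≤ (Real.exp κ + 2) * r := by gcongr; linarith
  have hx' : eNorm x ≤ L + r := hx
  have hy' : eNorm y ≤ L + r := hy
  have hl : 0 ≤ invLog r (bndS R (emb x)) := by
    refine (invLog_bounds hκ ?_).1.le
    have hxR : eNorm x < R := by linarith
    have h1 := (bndS_bounds hxR).1
    have hS : Real.exp κ * r ≤ bndS R (emb x) := by linarith
    have : 0 < Real.exp κ * r := by positivity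
    rw [Real.le_log_iff_exp_le (div_pos (by linarith) hr0), le_div_iff₀ hr0]
    exact hS
  set s := sScale L with hsd
  set D := R - eNorm y with hD
  set ρ := eNorm (x - y) with hρ
  have hρ0 : 0 ≤ ρ := eNorm_nonneg _
  -- Gain per step: length at least s/60, squared, times (2s)^{-(d-2)} s²/(2s)⁴; 57600 = 60²·2⁴.
  have hm0 : 0 < ((2 * s) ^ (d - 2))⁻¹ / (57600 * C) := by positivity
  have key := occ_le_of_drift (V := ball0 d (L + r)) (U := wideNbhd L r y) (F := F) hm0
    hdrift ?_ hx
  · refine key.trans (ENNReal.ofReal_le_ofReal ?_)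
    have hf := intFun_near_le (r := r) (s := s) (R := R) (x := x) (y := y) hd (D := D) (by linarith)
      hs (by linarith) (by linarith) (by linarith) hl hyD hxy
    have hv : (s + ρ) ^ 2 ≤ 4 * shiftSq (s ^ 2) (emb y) x := by
      rw [shiftSq, ← eNorm_sub_eq]; nlinarith [sq_nonneg (s - ρ)]
    have h2 := rpow_neg_le_of_le_four_mul (α := (d / 2 - 1 : ℝ)) (by positivity) hv (by linarith)
    rw [sq_rpow_neg_interior hd (by positivity)] at h2
    have h4 : (4 : ℝ) ^ (d / 2 - 1 : ℝ) = 2 ^ (d - 2) := by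
      rw [show (4 : ℝ) = 2 ^ (2 : ℝ) by norm_num, ← Real.rpow_mul (by norm_num), ← Real.rpow_natCast]
      congr 1
      push_cast [Nat.cast_sub (show 2 ≤ d by omega)]
      ring
    rw [h4] at h2
    rw [div_le_iff₀ hm0]
    refine hf.trans ((mul_le_mul_of_nonneg_left h2 (by norm_num)).trans (le_of_eq ?_))
    rw [show (4 : ℝ) = 2 * 2 by norm_num, mul_pow 2 2, mul_pow 2 s]
    field_simp
    norm_num
  · intro z hz
    refine ⟨hz.2, ?_⟩
    have hz1 : eNorm (z - y) ≤ 7 / 6 * aFun L r y := hz.1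
    have hz2 : eNorm z ≤ L + r := hz.2
    have hh1 := aFun_le_hField hh hr0 hs hz1
    rw [ha] at hz1 hh1
    have hz0 := eNorm_nonneg (z - y)
    have hv1 : shiftSq (s ^ 2) (emb y) z ≤ (2 * s) ^ 2 := by
      rw [shiftSq, ← eNorm_sub_eq]; nlinarith
    have hv0 : 0 < shiftSq (s ^ 2) (emb y) z := by rw [shiftSq]; positivity
    have hW : ((2 * s) ^ (d - 2))⁻¹ ≤ shiftSq (s ^ 2) (emb y) z ^ (-(d / 2 - 1 : ℝ)) := by
      rw [← sq_rpow_neg_interior hd (by positivity)]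
      exact Real.rpow_le_rpow_of_nonpos hv0 hv1 (by linarith)
    have hdr : ((2 * s) ^ (d - 2))⁻¹ * (s ^ 2 / ((2 * s) ^ 2) ^ 2)
        ≤ intDrift R r s (√R)⁻¹ ((D ^ 2) ^ (-(d / 2 - 1 : ℝ))) y z := by
      unfold intDrift
      have h1 := Real.rpow_nonneg hv0.le (-(d / 2 - 5 / 4 : ℝ))
      have h2 := Real.rpow_nonneg (sq_nonneg D) (-(d / 2 - 1 : ℝ))
      have h3 : 0 ≤ (√R)⁻¹ * (shiftSq (s ^ 2) (emb y) z ^ (-(d / 2 - 5 / 4 : ℝ)) /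
        shiftSq (s ^ 2) (emb y) z) := by positivity
      have h4 : 0 ≤ (D ^ 2) ^ (-(d / 2 - 1 : ℝ)) *
        (invLog r (bndS R (emb z)) ^ 2 / bndS R (emb z) ^ 2) := by positivity
      have h5 : ((2 * s) ^ (d - 2))⁻¹ * (s ^ 2 / ((2 * s) ^ 2) ^ 2)
          ≤ shiftSq (s ^ 2) (emb y) z ^ (-(d / 2 - 1 : ℝ)) *
            (s ^ 2 / shiftSq (s ^ 2) (emb y) z ^ 2) := by gcongr
      linarith
    calc ((2 * s) ^ (d - 2))⁻¹ / (57600 * C)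
        = (s / 60) ^ 2 * (((2 * s) ^ (d - 2))⁻¹ * (s ^ 2 / ((2 * s) ^ 2) ^ 2)) / C := by
          field_simp; norm_num
      _ ≤ _ := by gcongr

open Classical in
/-- Occupation time bounds for an interior neighbourhood, seen from far away. -/
theorem occ_le_interior_far [NeZero d] (hd : 3 ≤ d) (hκ : 128 ≤ κ)
    (hκd : Real.log (36 * d) ≤ κ) (hh : IsCGProfile h)
    (hr : 100 ≤ r) (hrs : r ≤ sScale L) (hsL : sScale L ≤ L)
    (hR : R = L + (Real.exp κ + 2) * r) {c : ℝ} (hc : 0 ≤ c)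
    (hy : y ∈ ball0 d (L + r)) (ha : aFun L r y = sScale L) (hyD : 2 * sScale L ≤ R - eNorm y)
    {ζ : EuclideanSpace ℝ (Fin d)} (hζ : ‖ζ‖ = 2 * R - eNorm y)
    (hζy : ‖emb y - ζ‖ = 2 * (R - eNorm y))
    (hdrift : ∀ x ∈ ball0 d (L + r),
      ∑' z, F x z * (if z ∈ ball0 d (L + r) then ENNReal.ofReal (bdryFun R r ζ z) else 0)
        ≤ ENNReal.ofReal (bdryFun R r ζ x))
    (hsupp : ∀ x ∈ ball0 d (L + r), ∀ z, F x z ≠ 0 → eNorm (z - x) ≤ 2 * hField h L r x + 1)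
    (hnear : ∀ z ∈ ball0 d (L + r), eNorm (z - y) ≤ 3 / 4 * (R - eNorm y) →
      occ (ball0 d (L + r)) F (wideNbhd L r y) z ≤ ENNReal.ofReal
        (c * (sScale L ^ (d - 2) / (sScale L + eNorm (z - y)) ^ (d - 2))))
    (hx : x ∈ ball0 d (L + r)) (hxy : 3 / 4 * (R - eNorm y) < eNorm (x - y)) :
    occ (ball0 d (L + r)) F (wideNbhd L r y) x ≤ ENNReal.ofReal
      (c * 64 * 24 ^ d * sScale L ^ (d - 2) * ((R - eNorm x) * (R - eNorm y)
        / ((R - eNorm y) + eNorm (x - y)) ^ d)) := by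
  have hd1 : 1 ≤ d := by omega
  have hexp := Real.add_one_le_exp κ
  have hr0 : 0 < r := by linarith
  have hs : 0 < sScale L := by linarith
  have hAr : 131 * r ≤ (Real.exp κ + 2) * r := by gcongr; linarith
  have hAe : (Real.exp κ + 2) * r = Real.exp κ * r + 2 * r := by ring
  have her : 0 < Real.exp κ * r := by positivity
  have hx' : eNorm x ≤ L + r := hx
  have hy' : eNorm y ≤ L + r := hy
  have hy0 := eNorm_nonneg y
  have hR0 : 0 < R := by linarith
  have hζ1 : R ≤ ‖ζ‖ := by linarith
  have hζ2 : ‖ζ‖ ≤ 2 * R := by linarith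
  have hsize : ∀ {w : Lat d}, eNorm w ≤ L + r → _ := fun {w} hw =>
    bdryFun_size (x := w) hd1 hκ hκd hr hζ1 hζ2 (by linarith)
  set s := sScale L with hsd
  set D := R - eNorm y with hD
  have hD0 : 0 < D := by linarith
  -- On the rim |z-ζ| ≤ 3D and S ≥ D/4, so this B makes B·bdryFun at least 8c(2s/D)^{d-2}, more than
  -- the near bound c(s/(s+|z-y|))^{d-2}.
  set B : ℝ := c * 16 * 6 ^ d * s ^ (d - 2) * D with hB
  have hB0 : 0 ≤ B := by positivity
  have key := occ_le_outside (V := ball0 d (L + r)) (U := wideNbhd L r y) (F := F)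
    (N := {z | eNorm (z - y) ≤ 3 / 4 * D}) hB0 hdrift ?_ ?_ hx (fun h => by
      have : eNorm (x - y) ≤ 3 / 4 * D := h
      linarith)
  · refine key.trans (ENNReal.ofReal_le_ofReal ?_)
    have hf := (hsize hx').2.1
    rw [shiftSq_rpow] at hf
    obtain ⟨S1, S2, -⟩ := bndS_bounds (R := R) (x := x) (by linarith)
    obtain ⟨n1, n2, n3⟩ := reflection_bounds hζ hζy x
    have hρ0 := eNorm_nonneg (x - y)
    have hn : D + eNorm (x - y) ≤ 4 * ‖emb x - ζ‖ := by linarith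
    have hn0 : 0 < ‖emb x - ζ‖ := by linarith
    have hq : (‖emb x - ζ‖ ^ d)⁻¹ ≤ 4 ^ d / (D + eNorm (x - y)) ^ d := by
      rw [inv_le_comm₀ (by positivity) (by positivity), inv_div, div_le_iff₀ (by positivity),
        mul_comm, ← mul_pow]
      gcongr
    have hS0 : 0 ≤ bndS R (emb x) := by linarith
    calc B * bdryFun R r ζ x ≤ B * (2 * ((‖emb x - ζ‖ ^ d)⁻¹ * bndS R (emb x))) := by gcongr
      _ ≤ B * (2 * (4 ^ d / (D + eNorm (x - y)) ^ d * (2 * (R - eNorm x)))) := by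
        gcongr
      _ = _ := by
        rw [hB, show (24 : ℝ) = 6 * 4 by norm_num, mul_pow 6 4]
        ring
      _ ≤ _ := le_rfl
  · intro z hz
    have hz1 : eNorm (z - y) ≤ 7 / 6 * aFun L r y := hz.1
    rw [ha] at hz1
    refine ⟨?_, hz.2⟩
    change eNorm (z - y) ≤ 3 / 4 * D
    linarith
  · intro w hw hwN z hz hzN hF
    have hw' : eNorm w ≤ L + r := hw
    have hz' : eNorm z ≤ L + r := hz
    have hwN' : 3 / 4 * D < eNorm (w - y) := not_le.1 hwN
    have hzN' : eNorm (z - y) ≤ 3 / 4 * D := hzN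
    refine (hnear z hz hzN').trans (ENNReal.ofReal_le_ofReal ?_)
    have h1 := hsupp w hw z hF
    have h2 := step_le_range hh hr hrs (R := R) (by linarith) hw'
    have h3 := min_le_right (R - eNorm w) s
    have h4 := eNorm_sub_le w z y
    rw [eNorm_sub_comm w z] at h4
    -- A step is at most 0.11 s ≤ 0.055 D long, so it cannot enter the ball of radius 3D/4 deeper
    -- than D/2.
    have hzD : D / 2 ≤ eNorm (z - y) := by linarith
    have hf := (hsize hz').1
    rw [shiftSq_rpow] at hf
    obtain ⟨n1, n2, -⟩ := reflection_bounds hζ hζy z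
    have hn3 : ‖emb z - ζ‖ ≤ 3 * D := by linarith
    have hn0 : 0 < ‖emb z - ζ‖ := by linarith
    have hzy := eNorm_le_add z y
    obtain ⟨S1, -, -⟩ := bndS_bounds (R := R) (x := z) (by linarith)
    have hS : D / 4 ≤ bndS R (emb z) := by linarith
    have hf2 : ((3 * D) ^ d)⁻¹ * (D / 4) / 2 ≤ bdryFun R r ζ z := by
      refine le_trans ?_ hf
      gcongr
    calc c * (s ^ (d - 2) / (s + eNorm (z - y)) ^ (d - 2)) ≤ c * (s ^ (d - 2) / (D / 2) ^ (d - 2)) := by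
          gcongr
          linarith
      _ ≤ B * (((3 * D) ^ d)⁻¹ * (D / 4) / 2) := by
          have e1 : D ^ d = D ^ (d - 2) * D ^ 2 := by rw [← pow_add, Nat.sub_add_cancel (by omega)]
          have e2 : (2 : ℝ) ^ d = 2 ^ (d - 2) * 2 ^ 2 := by
            rw [← pow_add, Nat.sub_add_cancel (by omega)]
          rw [hB, mul_pow 3 D, e1, show (6 : ℝ) = 3 * 2 by norm_num, mul_pow 3 2, e2, div_pow]
          apply le_of_sub_nonneg
          have : c * 16 * (3 ^ d * (2 ^ (d - 2) * 2 ^ 2)) * s ^ (d - 2) * D *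
              ((3 ^ d * (D ^ (d - 2) * D ^ 2))⁻¹ * (D / 4) / 2)
              - c * (s ^ (d - 2) / (D ^ (d - 2) / 2 ^ (d - 2)))
              = 7 * (c * (s ^ (d - 2) / (D ^ (d - 2) / 2 ^ (d - 2)))) := by
            field_simp
            ring
          rw [this]
          positivity
      _ ≤ _ := by gcongr

end Bounds

end RWRE

/-! ### Comparison with Γ and the bound for the goodified walk in V_{L+r}. -/

namespace RWRE

variable {d : ℕ}

section Combine

variable {L r R A : ℝ} {x y : Lat d}

theorem pow_mul_gamma1 (hd : 3 ≤ d) (ha : 0 < aFun L r y) :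
    aFun L r y ^ d * Gamma1 L r x y = aFun L r y ^ (d - 2) *
      (dTilde L r x * dTilde L r y / (aFun L r y + eNorm (x - y)) ^ d) := by
  have e : aFun L r y ^ d = aFun L r y ^ (d - 2) * aFun L r y ^ 2 := by
    rw [← pow_add, Nat.sub_add_cancel (by omega)]
  have := eNorm_nonneg (x - y)
  rw [Gamma1, e]
  field_simp

theorem pow_mul_gamma2 (hd : 3 ≤ d) (ha : 0 < aFun L r y) :
    aFun L r y ^ d * Gamma2 L r x y =
      aFun L r y ^ (d - 2) / (aFun L r y + eNorm (x - y)) ^ (d - 2) := by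
  have e : aFun L r y ^ d = aFun L r y ^ (d - 2) * aFun L r y ^ 2 := by
    rw [← pow_add, Nat.sub_add_cancel (by omega)]
  have := eNorm_nonneg (x - y)
  rw [Gamma2, e]
  field_simp

/-- Within 3D/4 of y both boundary distances are at least of order D and a + |x-y| is at most of
that order, so Γ⁽¹⁾ dominates a multiple of Γ⁽²⁾ and a bound of the form Γ⁽²⁾ suffices. -/
theorem near_le_gam (hd : 3 ≤ d) (hA : 4 ≤ A) (hr : 0 < r) (hR : R = L + A * r)
    (hx : x ∈ ball0 d (L + r)) (hy : y ∈ ball0 d (L + r)) (ha : 0 < aFun L r y)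
    (hyD : 2 * aFun L r y ≤ R - eNorm y) (hxy : eNorm (x - y) ≤ 3 / 4 * (R - eNorm y)) :
    aFun L r y ^ (d - 2) / (aFun L r y + eNorm (x - y)) ^ (d - 2)
      ≤ 7 * A ^ 2 * (aFun L r y ^ d * Gam L r x y) := by
  have hρ := eNorm_nonneg (x - y)
  obtain ⟨y1, y2⟩ := dTilde_comparable hA hr hR hy
  obtain ⟨x1, x2⟩ := dTilde_comparable hA hr hR hx
  have hxd : 0 < dTilde L r x := lt_max_of_lt_right (by positivity)
  have hyd : 0 < dTilde L r y := lt_max_of_lt_right (by positivity)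
  have hxx := eNorm_le_add x y
  have hX : 0 ≤ aFun L r y ^ (d - 2) / (aFun L r y + eNorm (x - y)) ^ (d - 2) := by positivity
  have hA2 : 1 ≤ 7 * A ^ 2 := by nlinarith
  refine le_mul_gam ?_ ?_
  · rw [pow_mul_gamma1 hd ha]
    set a := aFun L r y
    set t := eNorm (x - y)
    set D := R - eNorm y
    have e : (a + t) ^ d = (a + t) ^ (d - 2) * (a + t) ^ 2 := by
      rw [← pow_add, Nat.sub_add_cancel (by omega)]
    have h1 : (a + t) ^ 2 ≤ (5 / 4 * D) ^ 2 := by gcongr; linarith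
    have h2 : D / 4 * D ≤ A * dTilde L r x * (A * dTilde L r y) :=
      mul_le_mul (by linarith) y2 (by linarith) (by positivity)
    have h3 : (a + t) ^ 2 ≤ 7 * A ^ 2 * (dTilde L r x * dTilde L r y) := by nlinarith
    have h4 : 1 ≤ 7 * A ^ 2 * (dTilde L r x * dTilde L r y) / (a + t) ^ 2 := by
      rw [le_div_iff₀ (by positivity)]; linarith
    calc a ^ (d - 2) / (a + t) ^ (d - 2) ≤ a ^ (d - 2) / (a + t) ^ (d - 2) *
          (7 * A ^ 2 * (dTilde L r x * dTilde L r y) / (a + t) ^ 2) := le_mul_of_one_le_right hX h4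
      _ = _ := by rw [e]; field_simp
  · rw [pow_mul_gamma2 hd ha]
    exact le_mul_of_one_le_left hX hA2

/-- Γ⁽¹⁾ arises by comparing R - |·| with d̃; Γ⁽²⁾ because R - |x| and D are both at most D + |x-y|.
-/
theorem far_le_gam (hd : 3 ≤ d) (hA : 4 ≤ A) (hr : 0 < r) (hR : R = L + A * r)
    (hx : x ∈ ball0 d (L + r)) (hy : y ∈ ball0 d (L + r)) (ha : 0 < aFun L r y)
    (hyD : aFun L r y ≤ R - eNorm y) :
    aFun L r y ^ (d - 2) * ((R - eNorm x) * (R - eNorm y)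
      / ((R - eNorm y) + eNorm (x - y)) ^ d) ≤ A ^ 2 * (aFun L r y ^ d * Gam L r x y) := by
  have hρ := eNorm_nonneg (x - y)
  obtain ⟨y1, y2⟩ := dTilde_comparable hA hr hR hy
  obtain ⟨x1, x2⟩ := dTilde_comparable hA hr hR hx
  have hxd : 0 < dTilde L r x := lt_max_of_lt_right (by positivity)
  have hyd : 0 < dTilde L r y := lt_max_of_lt_right (by positivity)
  have hyx := eNorm_le_add y x
  rw [eNorm_sub_comm] at hyx
  have hA2 : 1 ≤ A ^ 2 := by nlinarith
  refine le_mul_gam ?_ ?_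
  · rw [pow_mul_gamma1 hd ha]
    have h2 : (R - eNorm x) * (R - eNorm y) ≤ A * dTilde L r x * (A * dTilde L r y) :=
      mul_le_mul x2 y2 (by linarith) (by positivity)
    calc _ ≤ aFun L r y ^ (d - 2) * (A * dTilde L r x * (A * dTilde L r y)
          / (aFun L r y + eNorm (x - y)) ^ d) := by gcongr
      _ = _ := by ring
  · rw [pow_mul_gamma2 hd ha]
    have hX : 0 ≤ aFun L r y ^ (d - 2) / (aFun L r y + eNorm (x - y)) ^ (d - 2) := by positivity
    refine le_trans ?_ (le_mul_of_one_le_left hX hA2)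
    set D := R - eNorm y
    set t := eNorm (x - y)
    have e : (D + t) ^ d = (D + t) * (D + t) * (D + t) ^ (d - 2) := by
      rw [← pow_two, ← pow_add, Nat.add_sub_cancel' (by omega)]
    have h1 : (R - eNorm x) * D ≤ (D + t) * (D + t) :=
      mul_le_mul (by linarith) (by linarith) (by linarith) (by linarith)
    have hDt : 0 < D + t := by linarith
    refine le_trans (mul_le_mul_of_nonneg_left ?_ (by positivity)) (div_eq_mul_inv _ _).ge
    calc (R - eNorm x) * D / (D + t) ^ d ≤ (D + t) * (D + t) / (D + t) ^ d := by gcongr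
      _ = ((D + t) ^ (d - 2))⁻¹ := by rw [e]; field_simp
      _ ≤ _ := by gcongr

end Combine

/-- The expected time that the goodified walk in `V_{L+r}` spends near `y`. -/
theorem occ_tildeGood_le [NeZero d] (hd : 3 ≤ d) : ∃ C δ₀ M : ℝ, 1 ≤ C ∧ 0 < δ₀ ∧ 3 ≤ M ∧
    ∀ {φ h : ℝ → ℝ} {L r δ : ℝ} {ω : Env d} {x y : Lat d},
    IsCGDensity φ → IsCGProfile h → LargeScale M L → 100 ≤ r → r ≤ rScale L → 0 ≤ δ → δ ≤ δ₀ →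
    x ∈ ball0 d (L + r) → y ∈ ball0 d (L + r) →
    occ (ball0 d (L + r)) (tildeGood φ h L r δ ω) (wideNbhd L r y) x
      ≤ ENNReal.ofReal (C * (aFun L r y ^ d * Gam L r x y)) := by
  obtain ⟨κ₁, hκ₁, hκd, H1⟩ := goodified_bdry (d := d) hd
  obtain ⟨κ₂, hκ₂, H2⟩ := goodified_int (d := d) hd
  -- A common κ gives the boundary and the interior function the same R.
  set κ := max κ₁ κ₂ with hκdef
  have hκ : 128 ≤ κ := hκ₁.trans (le_max_left _ _)
  have hκd' : Real.log (36 * d) ≤ κ := hκd.trans (le_max_left _ _)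
  obtain ⟨C₁, δ₁, M₁, hC₁, hδ₁, hM₁, H1⟩ := H1 κ (le_max_left _ _)
  obtain ⟨C₂, δ₂, M₂, hC₂, hδ₂, hM₂, H2⟩ := H2 κ (le_max_right _ _)
  have hexp := Real.add_one_le_exp κ
  set A : ℝ := Real.exp κ + 2 with hA
  have hA4 : 4 ≤ A := by linarith
  set K₁ : ℝ := 4 * A * 4 ^ d * 1800 * C₁ * (3 * A) ^ (d + 2) with hK₁
  set c : ℝ := 288000 * C₂ * 4 ^ (d - 2) with hc
  have hc0 : 0 < c := by positivity
  have hK0 : 0 < K₁ := by positivity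
  set K : ℝ := K₁ + c * (7 * A ^ 2) + c * 64 * 24 ^ d * A ^ 2 + 1 with hK
  have hK2 : 0 ≤ c * (7 * A ^ 2) := by positivity
  have hK3 : 0 ≤ c * 64 * 24 ^ d * A ^ 2 := by positivity
  refine ⟨K, min δ₁ δ₂, max 3 (max M₁ M₂), by linarith, lt_min hδ₁ hδ₂, le_max_left _ _, ?_⟩
  intro φ h L r δ ω x y hφ hh hL hr hrL hδ0 hδ hx hy
  have hM1 : (1 : ℝ) ≤ max 3 (max M₁ M₂) := le_max_of_le_left (by norm_num)
  have hL₁ : LargeScale M₁ L := hL.mono ((le_max_left _ _).trans (le_max_right _ _)) hM1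
  have hL₂ : LargeScale M₂ L := hL.mono ((le_max_right _ _).trans (le_max_right _ _)) hM1
  have hL₃ : LargeScale 3 L := hL.mono (le_max_left _ _) hM1
  have hL0 := hL₃.pos (by norm_num)
  have h3r := hL₃.mul_le_sScale (by norm_num) hrL
  have hsL : sScale L ≤ L := by
    have := hL₃.mul_sScale_le (by norm_num)
    have := hL₃.le_sScale (by norm_num)
    linarith
  have hr0 : 0 < r := by linarith
  have hs : 0 < sScale L := by linarith
  have hrs : r ≤ sScale L := by linarith
  have hδ1 := hδ.trans (min_le_left _ _)
  have hδ2 := hδ.trans (min_le_right _ _)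
  have ha0 := aFun_pos (L := L) hr0 hs y
  have hΓ0 : 0 ≤ aFun L r y ^ d * Gam L r x y := by
    have hxd : 0 < dTilde L r x := lt_max_of_lt_right (by positivity)
    have hyd : 0 < dTilde L r y := lt_max_of_lt_right (by positivity)
    have := eNorm_nonneg (x - y)
    refine mul_nonneg (by positivity) (le_min ?_ ?_)
    · rw [Gamma1]; positivity
    · rw [Gamma2]; positivity
  have mono : ∀ {K' : ℝ}, K' ≤ K → K' * (aFun L r y ^ d * Gam L r x y)
      ≤ K * (aFun L r y ^ d * Gam L r x y) := fun h => mul_le_mul_of_nonneg_right h hΓ0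
  obtain ⟨R, hR⟩ : ∃ R, R = L + (Real.exp κ + 2) * r := ⟨_, rfl⟩
  -- Either y is in the boundary layer, where a(y) = d̃(y), or a(y) = s_L and the distance from y to
  -- the sphere of radius R exceeds 2s_L.
  rcases le_or_gt (dTilde L r y) (sScale L) with hys | hys
  · refine (occ_le_of_dTilde_le hd hκ hκd' hh hr hrs hL0 hR (by linarith : 0 < C₁)
      (fun ζ hζ1 hζ2 w hw => H1 hφ hh hL₁ hr hrL hδ0 hδ1 hR hζ1 hζ2 hw) hy hys hx).trans ?_
    exact ENNReal.ofReal_le_ofReal (mono (by linarith))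
  · have ha : aFun L r y = sScale L := min_eq_right hys.le
    have hyD : 2 * sScale L ≤ R - eNorm y := by
      have hb : bdist (L + r) y = L + r - eNorm y := rfl
      have hlt : sScale L < bdist (L + r) y / 2 := by
        rcases lt_max_iff.1 hys with h | h
        · exact h
        · linarith
      have : 131 * r ≤ (Real.exp κ + 2) * r := by gcongr; linarith
      linarith
    have hnear := fun {z : Lat d} (hz : z ∈ ball0 d (L + r)) =>
      occ_le_interior_near (F := tildeGood φ h L r δ ω) hd hκ hh hr hrs hsL hR (by linarith : 0 < C₂) hy ha hyD
        (fun w hw => H2 hφ hh hL₂ hr hrL hδ0 hδ2 hR hyD hw) hz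
    rcases le_or_gt (eNorm (x - y)) (3 / 4 * (R - eNorm y)) with hxy | hxy
    · refine (hnear hx hxy).trans (ENNReal.ofReal_le_ofReal ?_)
      have := near_le_gam hd hA4 hr0 hR hx hy ha0 (by rw [ha]; exact hyD) hxy
      calc _ = c * (aFun L r y ^ (d - 2) / (aFun L r y + eNorm (x - y)) ^ (d - 2)) := by rw [ha]
        _ ≤ c * (7 * A ^ 2 * (aFun L r y ^ d * Gam L r x y)) := by gcongr
        _ = c * (7 * A ^ 2) * (aFun L r y ^ d * Gam L r x y) := by ring
        _ ≤ _ := mono (by linarith)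
    · obtain ⟨ζ, hζ, hζy⟩ := exists_reflection (R := R) (y := y) (by linarith)
      have hy0 := eNorm_nonneg y
      refine (occ_le_interior_far hd hκ hκd' hh hr hrs hsL hR hc0.le hy ha hyD hζ hζy
        (fun w hw => le_self_add.trans (H1 hφ hh hL₁ hr hrL hδ0 hδ1 hR (by linarith) (by linarith)
          hw)) (fun w hw z hz => tildeGood_support hφ hr0 δ ω hw hz)
        (fun z hz hzy => hnear hz hzy) hx hxy).trans (ENNReal.ofReal_le_ofReal ?_)
      have := far_le_gam hd hA4 hr0 hR hx hy ha0 (by rw [ha]; linarith)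
      rw [← ha]
      calc _ = c * 64 * 24 ^ d * (aFun L r y ^ (d - 2) * ((R - eNorm x) * (R - eNorm y)
          / ((R - eNorm y) + eNorm (x - y)) ^ d)) := by ring
        _ ≤ c * 64 * 24 ^ d * (A ^ 2 * (aFun L r y ^ d * Gam L r x y)) := by gcongr
        _ = c * 64 * 24 ^ d * A ^ 2 * (aFun L r y ^ d * Gam L r x y) := by ring
        _ ≤ _ := mono (by linarith)

end RWRE

namespace RWRE

variable {d : ℕ}

/-! ### Cutting the walk at the smaller ball -/

section Cut

open Classical

/-- Twice the larger occupation time is a supersolution for the smaller chain. One copy of the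
indicator of U' pays for a visit to U inside W, the other for the single visit to U at the exit from
W, since such a jump starts in U'. -/
theorem occ_le_two_mul {V W U U' : Set (Lat d)} {F G : Kern d} (hWV : W ⊆ V) (hU : U ⊆ U')
    (hle : ∀ x ∈ W, ∀ z ∈ W, F x z ≤ G x z) (hmass : ∀ x ∈ W, ∑' z, F x z ≤ 1)
    (hjump : ∀ x ∈ W, ∀ z ∉ W, z ∈ U → F x z ≠ 0 → x ∈ U') (x : Lat d) :
    occ W F U x ≤ 2 * occ V G U' x := by
  have hone : ∀ z ∈ U', 1 ≤ occ V G U' z := fun z hz => by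
    rw [occ, potential_eq, if_pos hz]; exact le_self_add
  have key : occ W F U x ≤ if x ∈ W then 2 * occ V G U' x else if x ∈ U then 1 else 0 := by
    refine potential_le (u := fun x => if x ∈ W then 2 * occ V G U' x else if x ∈ U then 1 else 0)
      (fun y => ?_) x
    by_cases hy : y ∈ W
    · have hexp : 2 * occ V G U' y = 2 * (if y ∈ U' then 1 else 0) + 2 * kAct G (occ V G U') y := by
        conv_lhs => rw [occ, potential_eq, kAct_killed_of_mem (hWV hy), mul_add]
        rfl
      have hin : (if y ∈ U then (1 : ℝ≥0∞) else 0) ≤ if y ∈ U' then 1 else 0 := by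
        by_cases h : y ∈ U
        · rw [if_pos h, if_pos (hU h)]
        · rw [if_neg h]; exact zero_le
      have hout : ∑' z, F y z * (if z ∈ W then 0 else if z ∈ U then 1 else 0)
          ≤ if y ∈ U' then 1 else 0 := by
        by_cases h : y ∈ U'
        · rw [if_pos h]
          refine le_trans (ENNReal.tsum_le_tsum fun z => ?_) (hmass y hy)
          refine mul_le_of_le_one_right zero_le ?_
          split_ifs <;> simp
        · rw [if_neg h, nonpos_iff_eq_zero, ENNReal.tsum_eq_zero]
          intro z
          by_cases hz : z ∈ W
          · simp [hz]
          by_cases hzU : z ∈ U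
          · have : F y z = 0 := by
              by_contra hF
              exact h (hjump y hy z hz hzU hF)
            simp [this]
          · simp [hz, hzU]
      rw [kAct_killed_of_mem hy, if_pos hy, hexp]
      have hsplit : kAct F (fun z => if z ∈ W then 2 * occ V G U' z else if z ∈ U then 1 else 0) y
          ≤ 2 * kAct G (occ V G U') y
            + ∑' z, F y z * (if z ∈ W then 0 else if z ∈ U then 1 else 0) := by
        rw [kAct, kAct, ← ENNReal.tsum_mul_left, ← ENNReal.tsum_add]
        refine ENNReal.tsum_le_tsum fun z => ?_
        by_cases hz : z ∈ W
        · rw [if_pos hz, if_pos hz, mul_zero, add_zero, mul_left_comm]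
          gcongr
          exact hle y hy z hz
        · rw [if_neg hz, if_neg hz]
          exact le_add_self
      calc _ ≤ (if y ∈ U' then (1 : ℝ≥0∞) else 0) + (2 * kAct G (occ V G U') y
            + if y ∈ U' then 1 else 0) := add_le_add hin (hsplit.trans (add_le_add_right hout _))
        _ = _ := by rw [two_mul (if y ∈ U' then (1 : ℝ≥0∞) else 0)]; ring
    · rw [kAct_killed_of_notMem hy, if_neg hy, add_zero]
  refine key.trans ?_
  by_cases hx : x ∈ W
  · rw [if_pos hx]
  · rw [if_neg hx]
    by_cases hxU : x ∈ U
    · rw [if_pos hxU, two_mul]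
      exact (hone x (hU hxU)).trans le_self_add
    · rw [if_neg hxU]; exact zero_le

end Cut

section Hat

variable {φ h : ℝ → ℝ} {L r : ℝ}

theorem nbhd_subset_wideNbhd (hr : 0 < r) (hs : 0 < sScale L) (y : Lat d) :
    nbhd L r y ⊆ wideNbhd L r y := fun z hz => by
  have h1 : eNorm (z - y) ≤ aFun L r y := hz.1
  have := aFun_pos (L := L) hr hs y
  exact ⟨show eNorm (z - y) ≤ _ by linarith, hz.2⟩

theorem exists_hatGood_eq [NeZero d] (δ : ℝ) (ω : Env d) {x : Lat d} (hx : x ∈ ball0 d L) :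
    ∃ ω' : Env d, hatGood φ h L r δ ω x
      = cgKern φ (ball0 d L) (hField h L r) (envStep ω') x := by
  unfold hatGood hatPi hatKern
  rw [if_pos hx, if_pos hx]
  split_ifs
  · exact ⟨_, rfl⟩
  · exact ⟨_, rfl⟩

/-- If U(y) meets the complement of V_L then d̃(y) = 3r, so a(y) = 3r; a jump out of V_L is possible
only where the step size is r/20. Its length r/10 + 1 is below a(y)/6, which is the room left by the
factor 7/6. -/
theorem mem_wideNbhd_of_jump (hh : IsCGProfile h) (hr : 100 ≤ r)
    (hrs : 3 * r ≤ sScale L) {x y z : Lat d} (hx : x ∈ ball0 d L) (hz : z ∉ ball0 d L)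
    (hzy : z ∈ nbhd L r y) (hxz : eNorm (z - x) ≤ 2 * hField h L r x + 1) :
    x ∈ wideNbhd L r y := by
  have hs : 0 < sScale L := by linarith
  have hx' : eNorm x ≤ L := hx
  have hz' : L < eNorm z := not_le.1 hz
  have h1 : eNorm (z - y) ≤ aFun L r y := hzy.1
  have hb : bdist L x = L - eNorm x := rfl
  have hby : bdist (L + r) y = L + r - eNorm y := rfl
  have h2 := eNorm_le_add z y
  have h3 := eNorm_le_add z x
  have h4 := eNorm_sub_le x z y
  rw [eNorm_sub_comm x z] at h4
  have ha : aFun L r y = 3 * r := by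
    have h5 : aFun L r y ≤ dTilde L r y := min_le_left _ _
    have h6 : dTilde L r y = 3 * r := by
      refine max_eq_right ?_
      by_contra hcon
      rw [dTilde, max_eq_left (not_le.1 hcon).le] at h5
      linarith
    rw [aFun, h6, min_eq_left hrs]
  have h7 := hField_le hh hs (r := r) x
  have h8 : max (min (bdist L x) (sScale L)) r = r := by
    refine max_eq_right ?_
    by_contra hcon
    rw [max_eq_left (not_le.1 hcon).le] at h7
    have := min_le_left (bdist L x) (sScale L)
    linarith
  rw [h8] at h7
  refine ⟨?_, show eNorm x ≤ L + r by linarith⟩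
  change eNorm (x - y) ≤ 7 / 6 * aFun L r y
  rw [ha] at h1 ⊢
  linarith

theorem occ_hatGood_le [NeZero d] (hφ : IsCGDensity φ) (hh : IsCGProfile h) (hr : 100 ≤ r)
    (hrs : 3 * r ≤ sScale L) (δ : ℝ) (ω : Env d) (x y : Lat d) :
    occ (ball0 d L) (hatGood φ h L r δ ω) (nbhd L r y) x
      ≤ 2 * occ (ball0 d (L + r)) (tildeGood φ h L r δ ω) (wideNbhd L r y) x := by
  have hr0 : 0 < r := by linarith
  have hs : 0 < sScale L := by linarith
  refine occ_le_two_mul (ball0_mono (by linarith)) (nbhd_subset_wideNbhd hr0 hs y)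
    (fun w hw z hz => hatGood_le_tildeGood hφ hh hs hr0 δ ω hw hz) (fun w hw => ?_)
    (fun w hw z hz hzy hF => ?_) x
  · obtain ⟨ω', e⟩ := exists_hatGood_eq (φ := φ) (h := h) (r := r) δ ω hw
    rw [e]
    exact tsum_cgKern_le_one hφ (hField_pos hr0 w)
  · obtain ⟨ω', e⟩ := exists_hatGood_eq (φ := φ) (h := h) (r := r) δ ω hw
    rw [e] at hF
    exact mem_wideNbhd_of_jump hh hr hrs hw hz hzy (cgKern_support hφ hr0 _ _ hF)

end Hat

/-! ### The mass that `Γ` gives to a neighbourhood -/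

section GammaMass

theorem norm_sub_le_sum (p q : EuclideanSpace ℝ (Fin d)) : ‖p - q‖ ≤ ∑ i, |p i - q i| := by
  rw [EuclideanSpace.norm_eq, Real.sqrt_le_left (Finset.sum_nonneg fun i _ => abs_nonneg _)]
  simp only [PiLp.sub_apply, Real.norm_eq_abs]
  exact Finset.sum_sq_le_sq_sum_of_nonneg fun i _ => abs_nonneg _

/-- A box with side length at least two contains many lattice points. -/
theorem pow_le_card_box {ρ : ℝ} (hρ : 1 ≤ ρ) (p : Fin d → ℝ) :
    ρ ^ d ≤ (Fintype.piFinset fun i => Finset.Icc ⌈p i - ρ⌉ ⌊p i + ρ⌋).card := by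
  rw [Fintype.card_piFinset]
  push_cast
  calc ρ ^ d = ∏ _i : Fin d, ρ := by simp
    _ ≤ _ := by
      refine Finset.prod_le_prod (fun _ _ => by linarith) fun i _ => ?_
      rw [Int.card_Icc]
      have h1 := Int.lt_floor_add_one (p i + ρ)
      have h2 := Int.ceil_lt_add_one (p i - ρ)
      have h3 : ((⌊p i + ρ⌋ + 1 - ⌈p i - ρ⌉ : ℤ) : ℝ)
          ≤ (((⌊p i + ρ⌋ + 1 - ⌈p i - ρ⌉).toNat : ℤ) : ℝ) := by
        exact_mod_cast Int.self_le_toNat _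
      push_cast at h3
      linarith

/-- Neighbourhoods have volume of the right order. -/
theorem exists_finset_subset_nbhd (hd : 3 ≤ d) {L r : ℝ} (hr : 0 < r) (hs : 0 < sScale L)
    (hsL : sScale L ≤ L) {y : Lat d} (hy : y ∈ ball0 d (L + r)) :
    ∃ T : Finset (Lat d), (T : Set (Lat d)) ⊆ nbhd L r y ∧
      (aFun L r y / (2 * d)) ^ d ≤ T.card := by
  have hd0 : (0 : ℝ) < d := by exact_mod_cast (show 0 < d by omega)
  have ha0 := aFun_pos (L := L) hr hs y
  have has : aFun L r y ≤ sScale L := min_le_right _ _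
  have hy' : eNorm y ≤ L + r := hy
  set a := aFun L r y with ha
  -- If a < 2d the required number of points is below one and the point y suffices.
  rcases le_or_gt 1 (a / (2 * d)) with h1 | h1
  -- The centre is moved from y by a/2 towards the origin (or is the origin itself), so that the
  -- ball of radius a/2 about p lies in both V_a(y) and V_{L+r}. A box of half side a/(2d) fits
  -- inside.
  · obtain ⟨p, hp1, hp2⟩ : ∃ p : EuclideanSpace ℝ (Fin d), ‖p - emb y‖ ≤ a / 2 ∧
        ‖p‖ + a / 2 ≤ L + r := by
      rcases le_or_gt (eNorm y) (a / 2) with h | h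
      · refine ⟨0, by rwa [zero_sub, norm_neg, ← eNorm_eq], ?_⟩
        rw [norm_zero]; linarith
      · have hy0 : 0 < eNorm y := by linarith
        refine ⟨(1 - a / 2 / eNorm y) • emb y, ?_, ?_⟩
        · have e : (1 - a / 2 / eNorm y) • emb y - emb y = -((a / 2 / eNorm y) • emb y) := by
            rw [sub_smul, one_smul]; abel
          rw [e, norm_neg, norm_smul, ← eNorm_eq, Real.norm_of_nonneg (by positivity)]
          field_simp
          exact le_rfl
        · have : a / 2 / eNorm y ≤ 1 := (div_le_one hy0).2 h.le
          rw [norm_smul, ← eNorm_eq, Real.norm_of_nonneg (by linarith), sub_mul,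
            div_mul_cancel₀ _ hy0.ne']
          linarith
    refine ⟨Fintype.piFinset fun i => Finset.Icc ⌈p i - a / (2 * d)⌉ ⌊p i + a / (2 * d)⌋, ?_,
      pow_le_card_box h1 p⟩
    intro z hz
    rw [Finset.mem_coe, Fintype.mem_piFinset] at hz
    have hzp : ‖emb z - p‖ ≤ a / 2 := by
      refine (norm_sub_le_sum _ _).trans ?_
      calc ∑ i, |emb z i - p i| ≤ ∑ _i : Fin d, a / (2 * d) := by
            refine Finset.sum_le_sum fun i _ => ?_
            obtain ⟨l, u⟩ := Finset.mem_Icc.1 (hz i)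
            have l' := Int.ceil_le.1 l
            have u' := Int.le_floor.1 u
            have e : emb z i = (z i : ℝ) := rfl
            rw [abs_le, e]
            constructor <;> linarith
        _ = a / 2 := by
          rw [Finset.sum_const, Finset.card_univ, Fintype.card_fin, nsmul_eq_mul]
          field_simp
    constructor
    · change eNorm (z - y) ≤ a
      rw [eNorm_sub_eq]
      have := norm_sub_le_norm_sub_add_norm_sub (emb z) p (emb y)
      linarith
    · change eNorm z ≤ L + r
      have := norm_le_norm_add_norm_sub' (emb z) p
      rw [eNorm_eq]
      linarith
  · refine ⟨{y}, ?_, ?_⟩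
    · rw [Finset.coe_singleton, Set.singleton_subset_iff]
      refine ⟨?_, hy⟩
      change eNorm (y - y) ≤ a
      rw [sub_self, eNorm_zero]
      exact ha0.le
    · rw [Finset.card_singleton, Nat.cast_one]
      exact pow_le_one₀ (by positivity) h1.le

/-- `Γ(x, ·)` varies only by a bounded factor over a neighbourhood. -/
theorem gam_le_of_mem_nbhd (hd : 3 ≤ d) {L r : ℝ} (hr : 0 < r) (hs : 0 < sScale L)
    {x y z : Lat d} (hz : z ∈ nbhd L r y) : Gam L r x y ≤ 2 * 3 ^ (d + 2) * Gam L r x z := by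
  have hzy : eNorm (z - y) ≤ aFun L r y := hz.1
  have hy0 := aFun_pos (L := L) hr hs y
  have hz0 := aFun_pos (L := L) hr hs z
  have hyd : aFun L r y ≤ dTilde L r y := min_le_left _ _
  have hxd : 0 < dTilde L r x := lt_max_of_lt_right (by positivity)
  have hyd0 : 0 < dTilde L r y := lt_max_of_lt_right (by positivity)
  have hzd0 : 0 < dTilde L r z := lt_max_of_lt_right (by positivity)
  have hb : bdist (L + r) z = L + r - eNorm z := rfl
  have hb' : bdist (L + r) y = L + r - eNorm y := rfl
  have t1 := eNorm_le_add z y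
  have t2 := eNorm_le_add y z
  rw [eNorm_sub_comm] at t2
  have n0 := eNorm_nonneg (z - y)
  have hdz : dTilde L r y ≤ 2 * dTilde L r z := by
    have h1 := le_max_left (bdist (L + r) z / 2) (3 * r)
    have h2 := le_max_right (bdist (L + r) z / 2) (3 * r)
    have h3 : dTilde L r y ≤ dTilde L r z + aFun L r y / 2 := by
      rw [dTilde, dTilde]
      exact max_le (by linarith) (by linarith)
    linarith
  have haz : aFun L r z ≤ 2 * aFun L r y := by
    have h1 := le_max_left (bdist (L + r) y / 2) (3 * r)
    have h2 := le_max_right (bdist (L + r) y / 2) (3 * r)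
    have h3 : dTilde L r z ≤ dTilde L r y + aFun L r y / 2 := by
      rw [dTilde, dTilde]
      exact max_le (by linarith) (by linarith)
    rw [aFun, aFun] at *
    rcases le_total (dTilde L r y) (sScale L) with h | h
    · rw [min_eq_left h] at *
      exact (min_le_left _ _).trans (by linarith)
    · rw [min_eq_right h] at *
      exact (min_le_right _ _).trans (by linarith)
  have t3 := eNorm_sub_le x y z
  rw [eNorm_sub_comm y z] at t3
  have m0 := eNorm_nonneg (x - y)
  have k0 := eNorm_nonneg (x - z)
  have hsum : aFun L r z + eNorm (x - z) ≤ 3 * (aFun L r y + eNorm (x - y)) := by linarith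
  have hz2 : 0 < aFun L r z ^ 2 := by positivity
  have hden : ∀ k ≤ d, aFun L r z ^ 2 * (aFun L r z + eNorm (x - z)) ^ k
      ≤ 3 ^ (d + 2) * (aFun L r y ^ 2 * (aFun L r y + eNorm (x - y)) ^ k) := fun k hk => by
    calc _ ≤ (3 * aFun L r y) ^ 2 * (3 * (aFun L r y + eNorm (x - y))) ^ k := by
          gcongr
          linarith
      _ = 3 ^ (k + 2) * (aFun L r y ^ 2 * (aFun L r y + eNorm (x - y)) ^ k) := by
          rw [mul_pow, mul_pow, pow_add]; ring
      _ ≤ _ := by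
          gcongr
          norm_num
  have g1 : Gamma1 L r x y ≤ 2 * 3 ^ (d + 2) * Gamma1 L r x z := by
    rw [Gamma1, Gamma1, mul_div_assoc', div_le_div_iff₀ (by positivity) (by positivity)]
    calc dTilde L r x * dTilde L r y * (aFun L r z ^ 2 * (aFun L r z + eNorm (x - z)) ^ d)
        ≤ dTilde L r x * (2 * dTilde L r z) * (3 ^ (d + 2) *
          (aFun L r y ^ 2 * (aFun L r y + eNorm (x - y)) ^ d)) := by
          have h0 : dTilde L r x * dTilde L r y ≤ dTilde L r x * (2 * dTilde L r z) := by gcongr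
          exact mul_le_mul h0 (hden d le_rfl) (by positivity) (by positivity)
      _ = _ := by ring
  have g2 : Gamma2 L r x y ≤ 2 * 3 ^ (d + 2) * Gamma2 L r x z := by
    rw [Gamma2, Gamma2, mul_div_assoc', div_le_div_iff₀ (by positivity) (by positivity)]
    have := hden (d - 2) (by omega)
    have p0 : 0 ≤ aFun L r z ^ 2 * (aFun L r z + eNorm (x - z)) ^ (d - 2) := by positivity
    linarith
  rw [Gam, Gam]
  rcases le_total (Gamma1 L r x z) (Gamma2 L r x z) with h | h
  · rw [min_eq_left h]; exact (min_le_left _ _).trans g1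
  · rw [min_eq_right h]; exact (min_le_right _ _).trans g2

theorem gam_nonneg {L r : ℝ} (hr : 0 < r) (hs : 0 < sScale L) (x y : Lat d) : 0 ≤ Gam L r x y := by
  have hxd : 0 < dTilde L r x := lt_max_of_lt_right (by positivity)
  have hyd : 0 < dTilde L r y := lt_max_of_lt_right (by positivity)
  have := eNorm_nonneg (x - y)
  have := aFun_pos (L := L) hr hs y
  refine le_min ?_ ?_
  · rw [Gamma1]; positivity
  · rw [Gamma2]; positivity

/-- U(y) contains at least (a/(2d))^d points and Γ(x,·) is comparable to Γ(x,y) at each of them: the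
pointwise form a^d Γ(x,y) is dominated by the mass of Γ on U(y). -/
theorem le_tsum_gamKern (hd : 3 ≤ d) {L r C : ℝ} (hr : 0 < r) (hs : 0 < sScale L)
    (hsL : sScale L ≤ L) (hC : 0 ≤ C) {x y : Lat d} (hy : y ∈ ball0 d (L + r)) :
    ENNReal.ofReal (C * (aFun L r y ^ d * Gam L r x y)) ≤
      ∑' z : nbhd L r y, GamKern (C * (2 * d) ^ d * (2 * 3 ^ (d + 2))) L r x z := by
  classical
  have hd0 : (0 : ℝ) < d := by exact_mod_cast (show 0 < d by omega)
  obtain ⟨T, hT, hcard⟩ := exists_finset_subset_nbhd hd hr hs hsL hy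
  have hΓ := gam_nonneg (L := L) hr hs x y
  rw [div_pow, div_le_iff₀ (by positivity)] at hcard
  rw [tsum_subtype (nbhd L r y)
    (fun z => GamKern (C * (2 * d) ^ d * (2 * 3 ^ (d + 2))) L r x z)]
  refine le_trans ?_ (ENNReal.sum_le_tsum T)
  calc ENNReal.ofReal (C * (aFun L r y ^ d * Gam L r x y))
      ≤ ENNReal.ofReal (T.card * (C * (2 * d) ^ d * Gam L r x y)) := by
        refine ENNReal.ofReal_le_ofReal ?_
        calc C * (aFun L r y ^ d * Gam L r x y)
            ≤ C * (T.card * (2 * d) ^ d * Gam L r x y) := by gcongr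
          _ = _ := by ring
    _ = ∑ _z ∈ T, ENNReal.ofReal (C * (2 * d) ^ d * Gam L r x y) := by
        rw [Finset.sum_const, nsmul_eq_mul, ENNReal.ofReal_mul (by positivity),
          ENNReal.ofReal_natCast]
    _ ≤ _ := by
        refine Finset.sum_le_sum fun z hz => ?_
        rw [Set.indicator_of_mem (hT hz), GamKern]
        refine ENNReal.ofReal_le_ofReal ?_
        have := gam_le_of_mem_nbhd hd hr hs (x := x) (hT hz)
        calc C * (2 * d) ^ d * Gam L r x y ≤ C * (2 * d) ^ d * (2 * 3 ^ (d + 2) * Gam L r x z) := by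
              gcongr
          _ = _ := by ring

end GammaMass

/-- Both Green's functions of the goodified walks are dominated by `Γ`. -/
theorem goodified_green_le [NeZero d] (hd : 3 ≤ d) : ∃ C δ₀ L₀ : ℝ, 0 < C ∧ 0 < δ₀ ∧ 0 < L₀ ∧
    ∀ {φ h : ℝ → ℝ} {L r δ : ℝ} {ω : Env d}, IsCGDensity φ → IsCGProfile h → L₀ ≤ L → 100 ≤ r →
    r ≤ rScale L → 0 ≤ δ → δ ≤ δ₀ →
    KernLE L r (hatGg φ h L r δ ω) (GamKern C L r) ∧
      KernLE L r (tildeGg φ h L r δ ω) (GamKern C L r) := by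
  obtain ⟨C, δ₀, M, hC, hδ₀, hM, H⟩ := occ_tildeGood_le (d := d) hd
  obtain ⟨L₀, hL₀, hLS⟩ := exists_largeScale M
  have hd0 : (0 : ℝ) < d := by exact_mod_cast (show 0 < d by omega)
  refine ⟨2 * C * (2 * d) ^ d * (2 * 3 ^ (d + 2)), δ₀, L₀, by positivity, hδ₀, hL₀, ?_⟩
  intro φ h L r δ ω hφ hh hL hr hrL hδ0 hδ
  have hS := hLS L hL
  have hS3 : LargeScale 3 L := hS.mono hM (by linarith)
  have h3r := hS3.mul_le_sScale (by norm_num) hrL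
  have h3s := hS3.mul_sScale_le (by norm_num)
  have hr0 : 0 < r := by linarith
  have hs : 0 < sScale L := by linarith
  have hsL : sScale L ≤ L := by linarith
  refine ⟨fun x hx y hy => ?_, fun x hx y hy => ?_⟩
  · refine le_trans ?_ (le_tsum_gamKern hd hr0 hs hsL (by positivity) hy)
    rw [hatGg, ← occ_eq_tsum]
    refine (occ_hatGood_le hφ hh hr h3r δ ω x y).trans ?_
    rw [mul_assoc 2 C, ENNReal.ofReal_mul zero_le_two, ENNReal.ofReal_ofNat]
    gcongr
    exact H hφ hh hS hr hrL hδ0 hδ hx hy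
  · refine le_trans ?_ (le_tsum_gamKern hd hr0 hs hsL (by positivity) hy)
    rw [tildeGg, ← occ_eq_tsum]
    refine (occ_mono (nbhd_subset_wideNbhd hr0 hs y) x).trans
      ((H hφ hh hS hr hrL hδ0 hδ hx hy).trans (ENNReal.ofReal_le_ofReal ?_))
    refine mul_le_mul_of_nonneg_right (by linarith) ?_
    have := gam_nonneg (L := L) hr0 hs x y
    have := aFun_pos (L := L) hr0 hs y
    positivity

end RWRE

/-! ### Conclusion: simple random walk as a special environment, and the goodified walks. -/

theorem lemma5p3 (d : ℕ) [NeZero d] (hd : 3 ≤ d)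
    (φ h : ℝ → ℝ) (hφ : RWRE.IsCGDensity φ) (hh : RWRE.IsCGProfile h) :
    (∃ C₁ : ℝ, 0 < C₁ ∧ ∃ L₀ : ℝ, 0 < L₀ ∧
      ∀ L : ℝ, L₀ ≤ L → ∀ r : ℝ, 100 ≤ r → r ≤ RWRE.rScale L →
        RWRE.KernLE (d := d) L r (RWRE.hatg φ h L r) (RWRE.GamKern C₁ L r) ∧
        RWRE.KernLE (d := d) L r (RWRE.tildeg φ h L r) (RWRE.GamKern C₁ L r)) ∧
    (∃ C : ℝ, 0 < C ∧ ∃ δ₀ : ℝ, 0 < δ₀ ∧ ∃ L₀ : ℝ, 0 < L₀ ∧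
      ∀ δ : ℝ, 0 < δ → δ ≤ δ₀ → ∀ L : ℝ, L₀ ≤ L → ∀ r : ℝ, 100 ≤ r → r ≤ RWRE.rScale L →
        ∀ ω : RWRE.Env d,
          RWRE.KernLE L r (RWRE.hatGg φ h L r δ ω) (RWRE.GamKern C L r) ∧
          RWRE.KernLE L r (RWRE.tildeGg φ h L r δ ω) (RWRE.GamKern C L r)) := by
  obtain ⟨C, δ₀, L₀, hC, hδ₀, hL₀, H⟩ := RWRE.goodified_green_le (d := d) hd
  obtain ⟨L₁, hL₁, hLS⟩ := RWRE.exists_largeScale 3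
  refine ⟨⟨C, hC, max L₀ L₁, lt_max_of_lt_left hL₀, fun L hL r hr hrL => ?_⟩,
    C, hC, δ₀, hδ₀, L₀, hL₀, fun δ hδ0 hδ L hL r hr hrL ω => H hφ hh hL hr hrL hδ0.le hδ⟩
  have hs : 0 < RWRE.sScale L := by
    linarith [(hLS L ((le_max_right _ _).trans hL)).le_sScale (by norm_num)]
  -- In the environment of simple random walk the goodified kernels are π̂ and π̃ for every δ, so δ₀
  -- serves as a dummy value.
  have key := H (ω := RWRE.srwEnv d) hφ hh ((le_max_left _ _).trans hL) hr hrL hδ₀.le le_rfl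
  rwa [RWRE.hatGg, RWRE.tildeGg, RWRE.hatGood_srw,
    RWRE.tildeGood_srw hφ hh hs (by linarith)] at key
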